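/- Fix $n, q\ge 1$ and an involution $\iota$ of $\{1,\dots,q\}$ (so $\iota\circ\iota=\mathrm{id}$); a jig of type $j$ fits together with jigs of type $\iota(j)$. Consider an $n\times n$ grid of square pieces. A *carving* assigns to each of the four sides of each piece, including the sides along the boundary of the grid, a jig type in $\{1,\dots,q\}$, such that any two sides that touch each other get complementary types $j$ and $\iota(j)$; there are $q^{2n(n+1)}$ carvings. A *random jigsaw puzzle* with $q$ types of jigs is given by a carving $\omega$ chosen uniformly at random among all of these. The case $\iota=\mathrm{id}$ is the *random edge-matching puzzle* with $q$ colours. An *assembly* puts the $n^2$ (labelled) pieces, each rotated by a multiple of $90^\circ$ but not flipped, bijectively into the cells of the $n\times n$ grid; the planted assembly leaves every piece in its original position and orientation. An assembly is a *solution* for $\omega$ if, with the pieces carved according to $\omega$, any two adjacent pieces fit together along their common side. Two solutions are *similar* if they show the same carving of the grid up to a global rotation of the grid; equivalently, if they differ only by a global rotation, by permuting duplicate pieces (pieces with the same jigs in the same cyclic order), and by rotating rotationally symmetric pieces. The solution is *unique up to global rotation* if the only solutions are the four global rotations of the planted assembly. **Theorem.** Let $q=q(n)$ be positive integers and let $\iota=\iota_n$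 be any involutions of $\{1,\dots,q(n)\}$. For the random $n\times n$ jigsaw puzzle with $q(n)$ types of jigs and complementarity map $\iota_n$ (in particular, for the random edge-matching puzzle with $q(n)$ colours) the following hold. 1. If $2\le q(n)\le \frac{2}{\sqrt e}\,n$ for all sufficiently large $n$, then the probability that there are at least two non-similar solutions tends to $1$ as $n\to\infty$. 2. If, for some fixed $\varepsilon>0$, $q(n)\ge(2+\varepsilon)n$ for all sufficiently large $n$, then the probability that all solutions are similar tends to $1$ as $n\to\infty$. 3. If $q(n)/n\to\infty$, then the probability that the solution is unique up to global rotation tends to $1$ as $n\to\infty$. -/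

import Mathlib

open Filter Topology Asymptotics

namespace Jigsaw

/-- The cells `(x, y)` of the `n × n` grid: column `x` (counted from the left) and row `y`
(counted from the bottom). -/
abbrev Cell (n : ℕ) : Type := Fin n × Fin n

/-- The four directions in counterclockwise order, as displacements:
`0` is east, `1` is north, `2` is west and `3` is south.  Thus adding `1` to a direction is a
counterclockwise quarter turn and `d + 2` is the direction opposite to `d`. -/
def step (d : ZMod 4) : ℤ × ℤ :=
  (![(1, 0), (0, 1), (-1, 0), (0, -1)] : Fin 4 → ℤ × ℤ) d

/-- `p'` is the cell next to `p` in direction `d`. -/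
def IsNeighbor {n : ℕ} (p : Cell n) (d : ZMod 4) (p' : Cell n) : Prop :=
  (((p'.1 : ℕ) : ℤ), ((p'.2 : ℕ) : ℤ)) = (((p.1 : ℕ) : ℤ), ((p.2 : ℕ) : ℤ)) + step d

/-- A labelling gives a jig type, out of `q`, to each of the four sides of each cell;
`f p d` is the jig at the side of `p` facing direction `d`. -/
abbrev Labelling (n q : ℕ) : Type := Cell n → ZMod 4 → Fin q

/-- Any two sides that touch each other carry complementary jigs, where jigs of type `j` fit
together with jigs of type `ι j`.  There is no condition on the sides along the boundary. -/
def Fits {n q : ℕ} (ι : Fin q → Fin q) (f : Labelling n q) : Prop :=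
  ∀ (p : Cell n) (d : ZMod 4) (p' : Cell n), IsNeighbor p d p' → f p' (d + 2) = ι (f p d)

/-- The sample space: the carvings of the planted `n × n` puzzle, i.e. all assignments of jigs to
the sides of the pieces (boundary sides included) such that connected sides get complementary
types.  For `ι = id` these are the colorings of an edge-matching puzzle. -/
def Carving (n : ℕ) {q : ℕ} (ι : Fin q → Fin q) : Type :=
  {f : Labelling n q // Fits ι f}

/-- The probability of an event when the carving is chosen uniformly at random. -/
noncomputable def prob {n q : ℕ} {ι : Fin q → Fin q} (E : Carving n ι → Prop) : ℝ :=
  (Nat.card {ω : Carving n ι // E ω} : ℝ) / (Nat.card (Carving n ι) : ℝ)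

/-- A complete assembly of the puzzle.  A piece is named after the cell it occupies in the planted
assembly; the piece `p` is placed at the cell `pos p`, after having been rotated by `rot p`
counterclockwise quarter turns. -/
@[ext]
structure Assembly (n : ℕ) where
  pos : Cell n ≃ Cell n
  rot : Cell n → ZMod 4

/-- The planted assembly: every piece in its original position and orientation. -/
def planted (n : ℕ) : Assembly n where
  pos := Equiv.refl _
  rot := fun _ => 0

/-- The labelling of the grid that one sees after the pieces, carved as in `f` in the planted
assembly, have been rearranged according to `A`: the side of the cell `p` facing direction `d`
is the side `d - rot` of the piece lying there. -/
def Assembly.shown {n q : ℕ} (A : Assembly n) (f : Labelling n q) : Labelling n q :=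
  fun p d => f (A.pos.symm p) (d - A.rot (A.pos.symm p))

/-- `A` is a solution of the puzzle with carving `ω`: all adjacent pieces fit together. -/
def IsSolution {n q : ℕ} {ι : Fin q → Fin q} (ω : Carving n ι) (A : Assembly n) : Prop :=
  Fits ι (A.shown ω.1)

/-- The counterclockwise quarter turn of the grid about its centre,
`(x, y) ↦ (n - 1 - y, x)` in coordinates starting at `0`. -/
def turn (n : ℕ) : Cell n ≃ Cell n where
  toFun p := (p.2.rev, p.1)
  invFun p := (p.2, p.1.rev)
  left_inv p := by simp
  right_inv p := by simp

/-- The assembly `A` after a global counterclockwise quarter turn of the whole puzzle. -/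
def Assembly.turn {n : ℕ} (A : Assembly n) : Assembly n where
  pos := A.pos.trans (Jigsaw.turn n)
  rot := fun p => A.rot p + 1

/-- Two solutions are similar if they show the same carving up to a global rotation: after one of
the four global rotations of `A`, each cell shows the same four jigs as in `B`.  In other words,
they differ only by a global rotation, by permuting duplicate pieces (pieces with the same jigs in
the same cyclic order) and by rotating rotationally symmetric pieces. -/
def Similar {n q : ℕ} {ι : Fin q → Fin q} (ω : Carving n ι) (A B : Assembly n) : Prop :=
  ∃ k < 4, (Assembly.turn^[k] A).shown ω.1 = B.shown ω.1

/-- There are at least two non-similar solutions. -/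
def HasNonSimilarSolutions {n q : ℕ} {ι : Fin q → Fin q} (ω : Carving n ι) : Prop :=
  ∃ A B : Assembly n, IsSolution ω A ∧ IsSolution ω B ∧ ¬ Similar ω A B

/-- All solutions are similar. -/
def AllSolutionsSimilar {n q : ℕ} {ι : Fin q → Fin q} (ω : Carving n ι) : Prop :=
  ∀ A B : Assembly n, IsSolution ω A → IsSolution ω B → Similar ω A B

/-- The solution is unique up to global rotation: the only solutions are the four global rotations
of the planted assembly. -/
def UniqueUpToRotation {n q : ℕ} {ι : Fin q → Fin q} (ω : Carving n ι) : Prop :=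
  ∀ A : Assembly n, IsSolution ω A → ∃ k < 4, A = Assembly.turn^[k] (planted n)

end Jigsaw

namespace Jigsaw

/-! Few types: counting. Two puzzles with the same multiset of pieces solve each other, so a puzzle
all of whose solutions are similar is determined by its pieces up to the four rotations
(`card_allSolutionsSimilar_le`). By Burnside's lemma there are about `q^4 / 4` kinds of pieces,
hence roughly `(e q^4 / (4 n^2))^(n^2)` multisets. For `q ≤ 2 n / √e` this is at most a constant
times `q^(2 n^2)`, whereas there are `q^(2 n^2 + 2 n)` carvings, so such puzzles are exponentially
rare (`prob_not_hasNonSimilar_le`).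

Many types: a first moment argument in polylogarithmic windows. Two sides are identified when they
lie on the same edge of the planted grid, or when they touch in the new assembly. The number of
classes lost through the second kind of identification is the `rank`, and a partial assembly fits
with probability at most `q^(-rank)` (`prob_fitsOn_le`). Let the left, bottom and right sides of a
window be filled, and fill the inside row by row. A piece which is far from all pieces used so far
can be chosen in at most `4 n^2` ways, but it imposes two independent constraints, west and south,
and `4 n^2 / q^2 ≤ β^2` with `β = 2 / (2 + ε) < 1`. A piece close to a used one has only
polylogarithmically many choices and costs a further constraint, with at most one exception per
step. Right after a far piece there is no exception at all, and a run of far pieces that reaches the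
end of its row pays a third constraint there. Hence the weighted number of fillings is close to one
(`fillSum_weight_le`), even when a factor `β` is kept back from every constraint.

This has three consequences, each with high probability and for all solutions simultaneously. First,
the number of defects (adjacencies that are not planted) in a window is at most `O(log n)` times one
plus their number on three sides of the window (`prob_not_controlled_le`). Applying this twice, with
an averaging over rows and columns in between, leaves fewer defects than rows, so that defect-free
rows and columns form a net which moves rigidly. Overlapping windows share this motion
(`Controlled.anchored`), and after a global rotation it is a translation by some `τ`.

Second, when the boundary of a window is translated by `τ`, two deviating pieces inside impose three
constraints beyond those that pay for the far pieces: the probability `n^(-3 + o(1))` beats the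
`n^(2 + o(1))` windows (`prob_not_rigid_le`). A single deviating piece shows the same jigs as the
right one, and the two can be exchanged without changing what is shown.

Third, the translation extends to the boundary of the grid line by line. The first failure on a line
has probability `n^(-2 + o(1))`, or `n^(-1 + o(1))` close to a corner of the grid, against `n^(1 +
o(1))` and `n^(o(1))` places (`prob_broken_le`). A translation of the whole grid is trivial, so
every solution shows the planted carving up to rotation.

If `q / n → ∞`, then with high probability no two pieces are equal and none is symmetric
(`prob_not_noDuplicates_le`), and similar solutions differ by a global rotation only. -/

/-- Integer coordinates of a cell. -/
def co {n : ℕ} (p : Cell n) : ℤ × ℤ := (((p.1 : ℕ) : ℤ), ((p.2 : ℕ) : ℤ))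

/-! ### Sides of pieces and edges of the planted grid -/

/-- A piece together with a rotation; also used for a piece together with one of its sides. -/
abbrev Tile (n : ℕ) : Type := Cell n × ZMod 4

/-- Twice the midpoint of a side in the planted assembly: this identifies the edges of the grid. -/
def mid {n : ℕ} (h : Tile n) : ℤ × ℤ := co h.1 + co h.1 + step h.2

/-- The side of the piece `x.1` which faces direction `d` after rotation by `x.2`. -/
def side {n : ℕ} (x : Tile n) (d : ZMod 4) : Tile n := (x.1, d - x.2)

lemma isNeighbor_iff {n : ℕ} {p p' : Cell n} {d : ZMod 4} :
    IsNeighbor p d p' ↔ co p' = co p + step d := Iff.rfl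

lemma co_injective {n : ℕ} : Function.Injective (co : Cell n → ℤ × ℤ) := by
  rintro ⟨a, b⟩ ⟨c, d⟩ h
  simp only [co, Prod.mk.injEq, Nat.cast_inj] at h
  ext <;> simp [h.1, h.2]

lemma step_zero : step 0 = (1, 0) := rfl
lemma step_one : step 1 = (0, 1) := rfl
lemma step_two : step 2 = (-1, 0) := rfl
lemma step_three : step 3 = (0, -1) := rfl

lemma dir_cases (d : ZMod 4) : d = 0 ∨ d = 1 ∨ d = 2 ∨ d = 3 := by
  revert d; decide

lemma step_add_two (d : ZMod 4) : step (d + 2) = -step d := by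
  revert d; decide

lemma step_injective : Function.Injective step := by
  intro a b; revert a b; decide

lemma step_ne_zero (d : ZMod 4) : step d ≠ 0 := by
  revert d; decide

lemma add_two_add_two (d : ZMod 4) : d + 2 + 2 = d := by
  revert d; decide

lemma add_two_ne (d : ZMod 4) : d + 2 ≠ d := by
  revert d; decide

lemma IsNeighbor.symm {n : ℕ} {p p' : Cell n} {d : ZMod 4} (h : IsNeighbor p d p') :
    IsNeighbor p' (d + 2) p := by
  rw [isNeighbor_iff] at *
  rw [h, step_add_two]; simp

lemma IsNeighbor.unique {n : ℕ} {p p' p'' : Cell n} {d : ZMod 4} (h : IsNeighbor p d p')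
    (h' : IsNeighbor p d p'') : p' = p'' := co_injective (Eq.trans h (Eq.symm h'))

lemma IsNeighbor.ne {n : ℕ} {p p' : Cell n} {d : ZMod 4} (h : IsNeighbor p d p') : p ≠ p' := by
  rintro rfl
  rw [isNeighbor_iff] at h
  exact step_ne_zero d (by simpa using h)

/-- Exactly one coordinate of `u + u + step d` is odd, and it tells the axis of `d`. So `d` and `e`
are equal or opposite. -/
lemma parity_aux {u v : ℤ × ℤ} {d e : ZMod 4} (h : u + u + step d = v + v + step e) :
    (u = v ∧ d = e) ∨ (v = u + step d ∧ e = d + 2) := by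
  obtain ⟨a, b⟩ := u
  obtain ⟨a', b'⟩ := v
  rcases dir_cases d with rfl | rfl | rfl | rfl <;>
  rcases dir_cases e with rfl | rfl | rfl | rfl <;>
  simp only [step_zero, step_one, step_two, step_three, Prod.mk_add_mk, Prod.mk.injEq] at h <;>
  obtain ⟨h1, h2⟩ := h <;>
  first
  | (exfalso; omega)
  | exact Or.inl ⟨Prod.ext (by show a = a'; omega) (by show b = b'; omega), rfl⟩
  | exact Or.inr ⟨Prod.ext (by simp only [Prod.fst_add, step_zero, step_one, step_two, step_three]; omega)
      (by simp only [Prod.snd_add, step_zero, step_one, step_two, step_three]; omega), by decide⟩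

lemma mid_eq_iff {n : ℕ} {h g : Tile n} :
    mid h = mid g ↔ h = g ∨ (IsNeighbor h.1 h.2 g.1 ∧ g.2 = h.2 + 2) := by
  constructor
  · intro e
    rcases parity_aux e with ⟨h1, h2⟩ | ⟨h1, h2⟩
    · left; exact Prod.ext (co_injective h1) h2
    · right; exact ⟨h1, h2⟩
  · rintro (rfl | ⟨h1, h2⟩)
    · rfl
    · rw [isNeighbor_iff] at h1
      simp only [mid, h1, h2, step_add_two]; abel

/-- An edge has at most two sides, one on each of the pieces next to it. -/
lemma mid_fiber {n : ℕ} {a b c : Tile n} (h1 : mid a = mid b) (h2 : mid a = mid c) :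
    a = b ∨ b = c ∨ a = c := by
  rcases mid_eq_iff.1 h1 with h | ⟨h, h'⟩
  · exact Or.inl h
  rcases mid_eq_iff.1 h2 with g | ⟨g, g'⟩
  · exact Or.inr (Or.inr g)
  right; left
  exact Prod.ext (h.unique g) (h'.trans g'.symm)

lemma mid_neighbor {n : ℕ} {p p' : Cell n} {d : ZMod 4} (h : IsNeighbor p d p') :
    mid ((p', d + 2) : Tile n) = mid ((p, d) : Tile n) :=
  (mid_eq_iff.2 (Or.inr ⟨h, rfl⟩)).symm

lemma mid_same_piece {n : ℕ} {p : Cell n} {d e : ZMod 4}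
    (h : mid ((p, d) : Tile n) = mid ((p, e) : Tile n)) : d = e := by
  simpa [mid] using step_injective (by simpa [mid] using h)

@[simp] lemma side_fst {n : ℕ} (x : Tile n) (d : ZMod 4) : (side x d).1 = x.1 := rfl

lemma side_injective {n : ℕ} (d : ZMod 4) : Function.Injective (fun x : Tile n => side x d) := by
  rintro ⟨p, r⟩ ⟨p', r'⟩ h
  simp only [side, Prod.mk.injEq, sub_right_inj] at h
  exact Prod.ext h.1 h.2

lemma side_inj_dir {n : ℕ} (x : Tile n) {d e : ZMod 4} (h : side x d = side x e) : d = e := by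
  simpa [side] using h

/-! ### Equivalences on the sides -/

/-- Oriented adjacencies `(c, d, c')` of cells, with `d` east or north. -/
abbrev Adjacency (n : ℕ) : Type := Cell n × ZMod 4 × Cell n

open Classical in
/-- The adjacencies within a set of cells. -/
noncomputable def adjs {n : ℕ} (S : Finset (Cell n)) : Finset (Adjacency n) :=
  Finset.univ.filter fun e => e.1 ∈ S ∧ e.2.2 ∈ S ∧ (e.2.1 = 0 ∨ e.2.1 = 1) ∧
    IsNeighbor e.1 e.2.1 e.2.2

def src {n : ℕ} (A : Cell n → Tile n) (e : Adjacency n) : Tile n := side (A e.1) e.2.1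
def tgt {n : ℕ} (A : Cell n → Tile n) (e : Adjacency n) : Tile n := side (A e.2.2) (e.2.1 + 2)

/-- The equivalence generated by sharing an edge in the planted assembly, and by touching across
one of the adjacencies in `E` after assembling the pieces according to `A`. -/
def join {n : ℕ} (E : Finset (Adjacency n)) (A : Cell n → Tile n) : Setoid (Tile n) :=
  Relation.EqvGen.setoid fun h g => mid h = mid g ∨ ∃ e ∈ E, h = src A e ∧ g = tgt A e

/-- The equivalence of sides forced by the planted assembly and by `A` restricted to `S`. -/
noncomputable def rel {n : ℕ} (S : Finset (Cell n)) (A : Cell n → Tile n) : Setoid (Tile n) :=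
  join (adjs S) A

lemma join_of_mid {n : ℕ} {E : Finset (Adjacency n)} {A : Cell n → Tile n} {h g : Tile n}
    (e : mid h = mid g) : join E A h g := Relation.EqvGen.rel _ _ (Or.inl e)

lemma join_of_mem {n : ℕ} {E : Finset (Adjacency n)} {A : Cell n → Tile n} {e : Adjacency n}
    (he : e ∈ E) : join E A (src A e) (tgt A e) :=
  Relation.EqvGen.rel _ _ (Or.inr ⟨e, he, rfl, rfl⟩)

lemma join_le {n : ℕ} {E : Finset (Adjacency n)} {A : Cell n → Tile n} {r : Setoid (Tile n)}
    (h1 : ∀ h g, mid h = mid g → r h g) (h2 : ∀ e ∈ E, r (src A e) (tgt A e)) :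
    join E A ≤ r := by
  intro a b hab
  induction hab with
  | rel x y h =>
    rcases h with h | ⟨e, he, rfl, rfl⟩
    · exact h1 _ _ h
    · exact h2 e he
  | refl x => exact r.refl x
  | symm x y _ ih => exact r.symm ih
  | trans x y z _ _ ih1 ih2 => exact r.trans ih1 ih2

/-- A predicate respecting the generating pairs respects the equivalence. -/
lemma join_invariant {n : ℕ} {E : Finset (Adjacency n)} {A : Cell n → Tile n} (P : Tile n → Prop)
    (h1 : ∀ h g, mid h = mid g → (P h ↔ P g)) (h2 : ∀ e ∈ E, (P (src A e) ↔ P (tgt A e)))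
    {h g : Tile n} (hg : join E A h g) : P h ↔ P g :=
  join_le (r := ⟨fun a b => (P a ↔ P b), ⟨fun _ => Iff.rfl, fun h => h.symm, fun h h' => h.trans h'⟩⟩)
    h1 h2 hg

lemma join_mono {n : ℕ} {E E' : Finset (Adjacency n)} (h : E ⊆ E') (A : Cell n → Tile n) :
    join E A ≤ join E' A :=
  join_le (fun _ _ => join_of_mid) fun _ he => join_of_mem (h he)

lemma mem_adjs {n : ℕ} {S : Finset (Cell n)} {e : Adjacency n} :
    e ∈ adjs S ↔ e.1 ∈ S ∧ e.2.2 ∈ S ∧ (e.2.1 = 0 ∨ e.2.1 = 1) ∧ IsNeighbor e.1 e.2.1 e.2.2 := by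
  simp [adjs]

lemma adjs_mono {n : ℕ} {S S' : Finset (Cell n)} (h : S ⊆ S') : adjs S ⊆ adjs S' := by
  intro e he
  rw [mem_adjs] at *
  exact ⟨h he.1, h he.2.1, he.2.2⟩

lemma rel_mono {n : ℕ} {S S' : Finset (Cell n)} (h : S ⊆ S') (A : Cell n → Tile n) :
    rel S A ≤ rel S' A := join_mono (adjs_mono h) A

lemma rel_of_mid {n : ℕ} {S : Finset (Cell n)} {A : Cell n → Tile n} {h g : Tile n}
    (e : mid h = mid g) : rel S A h g := join_of_mid e

lemma rel_of_neighbor {n : ℕ} {S : Finset (Cell n)} {A : Cell n → Tile n} {c c' : Cell n}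
    {d : ZMod 4} (hc : c ∈ S) (hc' : c' ∈ S) (h : IsNeighbor c d c') :
    rel S A (side (A c) d) (side (A c') (d + 2)) := by
  have key : (d = 0 ∨ d = 1) ∨ (d + 2 = 0 ∨ d + 2 = 1) := by clear h; revert d; decide
  rcases key with hd | hd
  · exact join_of_mem (e := (c, d, c')) (mem_adjs.2 ⟨hc, hc', hd, h⟩)
  · have := join_of_mem (A := A) (e := (c', d + 2, c)) (mem_adjs.2 ⟨hc', hc, hd, h.symm⟩)
    simp only [src, tgt, add_two_add_two] at this
    exact (join _ _).symm this

lemma rel_congr {n : ℕ} {S : Finset (Cell n)} {A A' : Cell n → Tile n}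
    (h : ∀ c ∈ S, A c = A' c) : rel S A = rel S A' := by
  have key : ∀ {A A' : Cell n → Tile n}, (∀ c ∈ S, A c = A' c) → rel S A ≤ rel S A' := by
    intro A A' h
    refine join_le (fun _ _ => join_of_mid) fun e he => ?_
    have hm := mem_adjs.1 he
    have := join_of_mem (A := A') he
    rwa [src, tgt, ← h _ hm.1, ← h _ hm.2.1] at this
  exact le_antisymm (key h) (key fun c hc => (h c hc).symm)

/-- A predicate respecting planted edges and touching sides respects `rel`. -/
lemma rel_invariant {n : ℕ} {S : Finset (Cell n)} {A : Cell n → Tile n} (P : Tile n → Prop)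
    (h1 : ∀ h g, mid h = mid g → (P h ↔ P g))
    (h2 : ∀ c ∈ S, ∀ c' ∈ S, ∀ d, IsNeighbor c d c' →
      (P (side (A c) d) ↔ P (side (A c') (d + 2))))
    {h g : Tile n} (hg : rel S A h g) : P h ↔ P g :=
  join_invariant P h1 (fun e he => by
    obtain ⟨a, b, -, c⟩ := mem_adjs.1 he
    exact h2 _ a _ b _ c) hg

/-! ### Counting classes -/

/-- The number of classes of sides. -/
noncomputable def cc {n : ℕ} (S : Finset (Cell n)) (A : Cell n → Tile n) : ℕ :=
  Nat.card (Quotient (rel S A))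

/-- The number of independent constraints imposed by `A` on `S`. -/
noncomputable def rank {n : ℕ} (S : Finset (Cell n)) (A : Cell n → Tile n) : ℕ :=
  cc ∅ A - cc S A

lemma card_quotient_anti {α : Type*} [Finite α] {r s : Setoid α} (h : r ≤ s) :
    Nat.card (Quotient s) ≤ Nat.card (Quotient r) :=
  Nat.card_le_card_of_surjective (Quotient.map' (s₁ := r) (s₂ := s) id h) fun x =>
    Quotient.inductionOn' x fun a => ⟨Quotient.mk'' a, rfl⟩

/-- Under `s`, each class of an element of `G` is merged with a class that does not meet `G`. So the
`r`-classes other than the `G.card` classes of elements of `G` still represent all `s`-classes. -/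
lemma card_quotient_drop {α : Type*} [Finite α] {r s : Setoid α} (hrs : r ≤ s) (G : Finset α)
    (hG : ∀ g ∈ G, ∀ g' ∈ G, r g g' → g = g')
    (hh : ∀ g ∈ G, ∃ h, s g h ∧ ∀ g' ∈ G, ¬ r g' h) :
    Nat.card (Quotient s) + G.card ≤ Nat.card (Quotient r) := by
  classical
  have := Fintype.ofFinite (Quotient r)
  have := Fintype.ofFinite (Quotient s)
  let T : Finset (Quotient r) := G.image (Quotient.mk r)
  have hT : T.card = G.card := Finset.card_image_of_injOn fun a ha b hb hab =>
    hG a ha b hb (Quotient.exact hab)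
  have hsurj : (Finset.univ : Finset (Quotient s)) ⊆ Tᶜ.image (Quotient.map' (s₁ := r) (s₂ := s) id hrs) := by
    intro x _
    induction x using Quotient.inductionOn' with
    | h a =>
    by_cases ha : Quotient.mk r a ∈ T
    · obtain ⟨g, hg, hga⟩ := Finset.mem_image.1 ha
      obtain ⟨h, hgh, hn⟩ := hh g hg
      refine Finset.mem_image.2 ⟨Quotient.mk r h, ?_, ?_⟩
      · rw [Finset.mem_compl]
        intro hm
        obtain ⟨g', hg', e⟩ := Finset.mem_image.1 hm
        exact hn g' hg' (Quotient.exact e)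
      · exact Quotient.sound (s.trans (s.symm hgh) (hrs (Quotient.exact hga)))
    · exact Finset.mem_image.2 ⟨Quotient.mk r a, Finset.mem_compl.2 ha, rfl⟩
  have h1 := Finset.card_le_card hsurj
  have h2 := Finset.card_image_le (s := Tᶜ) (f := Quotient.map' (s₁ := r) (s₂ := s) id hrs)
  rw [Finset.card_compl, hT] at h2
  have h3 : G.card ≤ Fintype.card (Quotient r) := hT ▸ Finset.card_le_univ T
  rw [Nat.card_eq_fintype_card, Nat.card_eq_fintype_card]
  rw [Finset.card_univ] at h1
  omega

/-- A proper coarsening loses at least one class: this is the preceding lemma for a single element.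
-/
lemma le_of_card_quotient_eq {α : Type*} [Finite α] {r s : Setoid α} (h : r ≤ s)
    (hc : Nat.card (Quotient r) ≤ Nat.card (Quotient s)) : s ≤ r := by
  intro a b hab
  by_contra hn
  have := card_quotient_drop h {a} (by simp) (by
    simp only [Finset.mem_singleton, forall_eq]
    exact ⟨b, hab, hn⟩)
  simp at this
  omega

lemma cc_anti {n : ℕ} {S S' : Finset (Cell n)} (h : S ⊆ S') (A : Cell n → Tile n) :
    cc S' A ≤ cc S A := card_quotient_anti (rel_mono h A)

lemma cc_congr {n : ℕ} {S : Finset (Cell n)} {A A' : Cell n → Tile n}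
    (h : ∀ c ∈ S, A c = A' c) : cc S A = cc S A' := by
  rw [cc, cc, rel_congr h]

/-- Merging one pair of classes. -/
lemma exists_merge {α : Type*} [Finite α] (r : Setoid α) (u v : α) :
    ∃ s : Setoid α, r ≤ s ∧ s u v ∧
      (∀ a b, s a b → r a b ∨ (r a u ∧ r v b) ∨ (r a v ∧ r u b)) ∧
      Nat.card (Quotient r) ≤ Nat.card (Quotient s) + 1 := by
  classical
  -- The class of `v` is redirected to the class of `u`; the kernel of this map is the merged
  -- relation.
  let φ : α → Quotient r := fun a => if r a v then Quotient.mk r u else Quotient.mk r a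
  refine ⟨Setoid.ker φ, ?_, ?_, ?_, ?_⟩
  · intro a b hab
    show φ a = φ b
    simp only [φ]
    by_cases ha : r a v
    · rw [if_pos ha, if_pos (r.trans (r.symm hab) ha)]
    · rw [if_neg ha, if_neg (fun hb => ha (r.trans hab hb))]
      exact Quotient.sound hab
  · show φ u = φ v
    simp only [φ, if_pos (r.refl v)]
    split_ifs <;> rfl
  · intro a b hab
    change φ a = φ b at hab
    simp only [φ] at hab
    split_ifs at hab with h1 h2 h2
    · exact Or.inl (r.trans h1 (r.symm h2))
    · exact Or.inr (Or.inr ⟨h1, Quotient.exact hab⟩)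
    · exact Or.inr (Or.inl ⟨Quotient.exact hab, r.symm h2⟩)
    · exact Or.inl (Quotient.exact hab)
  · have e := Nat.card_congr (Setoid.quotientKerEquivRange φ)
    rw [e]
    have := Fintype.ofFinite (Quotient r)
    have hsub : (Finset.univ : Finset (Quotient r)) ⊆ insert (Quotient.mk r v)
        (Set.range φ).toFinset := by
      intro x _
      induction x using Quotient.inductionOn' with
      | h a =>
      by_cases ha : r a v
      · exact Finset.mem_insert.2 (Or.inl (Quotient.sound ha))
      · exact Finset.mem_insert.2 (Or.inr (by
          rw [Set.mem_toFinset]; exact ⟨a, if_neg ha⟩))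
    have h1 := (Finset.card_le_card hsub).trans (Finset.card_insert_le _ _)
    rw [Finset.card_univ, Set.toFinset_card] at h1
    rwa [Nat.card_eq_fintype_card, Nat.card_eq_fintype_card]

lemma join_insert {n : ℕ} [DecidableEq (Adjacency n)] (e : Adjacency n) (E : Finset (Adjacency n))
    (A : Cell n → Tile n) :
    (∀ a b, join (insert e E) A a b → join E A a b ∨
      (join E A a (src A e) ∧ join E A (tgt A e) b) ∨
      (join E A a (tgt A e) ∧ join E A (src A e) b)) ∧
    Nat.card (Quotient (join E A)) ≤ Nat.card (Quotient (join (insert e E) A)) + 1 := by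
  obtain ⟨s, h1, h2, h3, h4⟩ := exists_merge (join E A) (src A e) (tgt A e)
  have hle : join (insert e E) A ≤ s := join_le (fun _ _ h => h1 (join_of_mid h)) fun e' he' => by
    rcases Finset.mem_insert.1 he' with rfl | he'
    · exact h2
    · exact h1 (join_of_mem he')
  exact ⟨fun a b hab => h3 a b (hle hab), h4.trans (Nat.add_le_add_right (card_quotient_anti hle) 1)⟩

/-- The number of classes drops at most by the number of nontrivial adjacencies. -/
lemma card_join_empty_le {n : ℕ} (E : Finset (Adjacency n)) (A : Cell n → Tile n) :
    Nat.card (Quotient (join ∅ A)) ≤ Nat.card (Quotient (join E A)) +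
      (E.filter fun e => mid (src A e) ≠ mid (tgt A e)).card := by
  classical
  induction E using Finset.induction_on with
  | empty => simp
  | insert e E he ih =>
    rw [Finset.filter_insert]
    split_ifs with h
    · rw [Finset.card_insert_of_notMem (by simp [he])]
      have := (join_insert e E A).2
      omega
    · rw [not_not] at h
      have hle : join (insert e E) A ≤ join E A := join_le (fun _ _ => join_of_mid) fun e' he' => by
        rcases Finset.mem_insert.1 he' with rfl | he'
        · exact join_of_mid h
        · exact join_of_mem he'
      have := card_quotient_anti hle
      omega

/-- Each class contains at most two sides which have not been assembled yet. -/
lemma free_sides {n : ℕ} (E : Finset (Adjacency n)) (A : Cell n → Tile n)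
    (hst : ∀ e ∈ E, ∀ e' ∈ E, src A e ≠ tgt A e')
    (hs : Set.InjOn (src A) E) (ht : Set.InjOn (tgt A) E)
    {a b c : Tile n} (ha : ∀ e ∈ E, a ≠ src A e ∧ a ≠ tgt A e)
    (hb : ∀ e ∈ E, b ≠ src A e ∧ b ≠ tgt A e) (hc : ∀ e ∈ E, c ≠ src A e ∧ c ≠ tgt A e)
    (hab : join E A a b) (hac : join E A a c) : a = b ∨ b = c ∨ a = c := by
  classical
  -- Without adjacencies a class is an edge and has at most two sides. A new adjacency joins two
  -- classes at sides which were free so far, and uses up both of them, so again at most two free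
  -- sides remain.
  induction E using Finset.induction_on generalizing a b c with
  | empty =>
    have key : ∀ {a b : Tile n}, join ∅ A a b → mid a = mid b := fun h =>
      join_le (E := ∅) (A := A) (r := Setoid.ker mid) (fun _ _ h => h) (by simp) h
    exact mid_fiber (key hab) (key hac)
  | insert e E he ih =>
    have hu : ∀ e' ∈ E, src A e ≠ src A e' ∧ src A e ≠ tgt A e' := fun e' he' =>
      ⟨fun h => he (by
        rw [hs (by simp) (by simp [he']) h]; exact he'), hst e (by simp) e' (by simp [he'])⟩
    have hv : ∀ e' ∈ E, tgt A e ≠ src A e' ∧ tgt A e ≠ tgt A e' := fun e' he' =>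
      ⟨fun h => hst e' (by simp [he']) e (by simp) h.symm, fun h => he (by
        rw [ht (by simp) (by simp [he']) h]; exact he')⟩
    have ih' := @ih (fun e h e' h' => hst e (by simp [h]) e' (by simp [h']))
      (hs.mono (by simp)) (ht.mono (by simp))
    have r : ∀ {x : Tile n}, (∀ e' ∈ insert e E, x ≠ src A e' ∧ x ≠ tgt A e') →
        ∀ e' ∈ E, x ≠ src A e' ∧ x ≠ tgt A e' := fun h e' he' => h e' (by simp [he'])
    -- The side `w` is used up by `e` but is free with respect to `E`. It takes one of the two
    -- places in its old class, so `x` and `y` share the other.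
    have two : ∀ {x y w : Tile n}, (∀ e' ∈ insert e E, x ≠ src A e' ∧ x ≠ tgt A e') →
        (∀ e' ∈ insert e E, y ≠ src A e' ∧ y ≠ tgt A e') → w = src A e ∨ w = tgt A e →
        join E A x w → join E A y w → x = y := by
      intro x y w hx hy hw hxw hyw
      have h1 : ∀ e' ∈ E, w ≠ src A e' ∧ w ≠ tgt A e' := by
        rcases hw with rfl | rfl
        · exact hu
        · exact hv
      have hx' := hx e (by simp)
      have hy' := hy e (by simp)
      rcases ih' (r hx) (r hy) h1 ((join E A).trans hxw ((join E A).symm hyw)) hxw with h | h | h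
      · exact h
      · rcases hw with rfl | rfl
        · exact absurd h hy'.1
        · exact absurd h hy'.2
      · rcases hw with rfl | rfl
        · exact absurd h hx'.1
        · exact absurd h hx'.2
    have hs' : ∀ {x y : Tile n}, join E A x y → join E A y x := fun h => (join E A).symm h
    rcases (join_insert e E A).1 a b hab with h | ⟨h1, h2⟩ | ⟨h1, h2⟩ <;>
    rcases (join_insert e E A).1 a c hac with g | ⟨g1, g2⟩ | ⟨g1, g2⟩
    · exact ih' (r ha) (r hb) (r hc) h g
    · exact Or.inl (two ha hb (Or.inl rfl) g1 ((join E A).trans (hs' h) g1))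
    · exact Or.inl (two ha hb (Or.inr rfl) g1 ((join E A).trans (hs' h) g1))
    · exact Or.inr (Or.inr (two ha hc (Or.inl rfl) h1 ((join E A).trans (hs' g) h1)))
    · exact Or.inr (Or.inl (two hb hc (Or.inr rfl) (hs' h2) (hs' g2)))
    · have := two ha hc (Or.inl rfl) h1 (hs' g2)
      exact Or.inr (Or.inr this)
    · exact Or.inr (Or.inr (two ha hc (Or.inr rfl) h1 ((join E A).trans (hs' g) h1)))
    · exact Or.inr (Or.inr (two ha hc (Or.inr rfl) h1 (hs' g2)))
    · exact Or.inr (Or.inl (two hb hc (Or.inl rfl) (hs' h2) (hs' g2)))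

/-- Three sides not assembled within `S` and in the same class are not distinct. -/
lemma rel_free_sides {n : ℕ} {S : Finset (Cell n)} {A : Cell n → Tile n}
    (hA : Set.InjOn (fun c => (A c).1) S) {a b c : Tile n}
    (ha : ∀ x ∈ S, ∀ y ∈ S, ∀ d, IsNeighbor x d y → a ≠ side (A x) d)
    (hb : ∀ x ∈ S, ∀ y ∈ S, ∀ d, IsNeighbor x d y → b ≠ side (A x) d)
    (hc : ∀ x ∈ S, ∀ y ∈ S, ∀ d, IsNeighbor x d y → c ≠ side (A x) d)
    (hab : rel S A a b) (hac : rel S A a c) : a = b ∨ b = c ∨ a = c := by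
  have key : ∀ {x y : Cell n} {d d' : ZMod 4}, x ∈ S → y ∈ S → side (A x) d = side (A y) d' →
      x = y ∧ d = d' := by
    intro x y d d' hx hy h
    have h1 : x = y := hA hx hy (by have := congrArg Prod.fst h; exact this)
    subst h1
    exact ⟨rfl, side_inj_dir _ h⟩
  have conv : ∀ {a : Tile n}, (∀ x ∈ S, ∀ y ∈ S, ∀ d, IsNeighbor x d y → a ≠ side (A x) d) →
      ∀ e ∈ adjs S, a ≠ src A e ∧ a ≠ tgt A e := by
    intro a ha e he
    obtain ⟨h1, h2, -, h3⟩ := mem_adjs.1 he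
    exact ⟨ha _ h1 _ h2 _ h3, ha _ h2 _ h1 _ h3.symm⟩
  refine free_sides (adjs S) A ?_ ?_ ?_ (conv ha) (conv hb) (conv hc) hab hac
  · intro e he e' he' h
    obtain ⟨h1, h2, h3, h4⟩ := mem_adjs.1 he
    obtain ⟨g1, g2, g3, g4⟩ := mem_adjs.1 he'
    have := (key h1 g2 h).2
    rw [this] at h3
    revert h3 g3
    generalize e'.2.1 = d
    revert d; decide
  · intro e he e' he' h
    obtain ⟨h1, h2, h3, h4⟩ := mem_adjs.1 he
    obtain ⟨g1, g2, g3, g4⟩ := mem_adjs.1 he'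
    obtain ⟨k1, k2⟩ := key h1 g1 h
    rw [k1, k2] at h4
    exact Prod.ext k1 (Prod.ext k2 (h4.unique g4))
  · intro e he e' he' h
    obtain ⟨h1, h2, h3, h4⟩ := mem_adjs.1 he
    obtain ⟨g1, g2, g3, g4⟩ := mem_adjs.1 he'
    obtain ⟨k1, k2⟩ := key h2 g2 h
    have k2' : e.2.1 = e'.2.1 := by simpa using k2
    rw [k1, k2'] at h4
    exact Prod.ext (h4.symm.unique g4.symm) (Prod.ext k2' k1)

lemma rel_empty_iff {n : ℕ} {A : Cell n → Tile n} {h g : Tile n} :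
    rel ∅ A h g ↔ mid h = mid g := by
  refine ⟨fun hg => ?_, rel_of_mid⟩
  exact join_le (r := Setoid.ker mid) (fun _ _ h => h) (fun e he => by simp [mem_adjs] at he) hg

/-- The edges related to some other edge number at most twice the rank. -/
lemma card_touched_le {n : ℕ} (S : Finset (Cell n)) (A : Cell n → Tile n) (T : Finset (ℤ × ℤ))
    (hT : ∀ m ∈ T, ∃ h g, mid h = m ∧ mid g ≠ m ∧ rel S A h g) :
    T.card ≤ 2 * rank S A := by
  classical
  have := Fintype.ofFinite (Quotient (rel ∅ A))
  have := Fintype.ofFinite (Quotient (rel S A))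
  have hle : rel ∅ A ≤ rel S A := rel_mono (Finset.empty_subset S) A
  let φ : Quotient (rel ∅ A) → Quotient (rel S A) :=
    Quotient.map' (s₁ := rel ∅ A) (s₂ := rel S A) id hle
  let μ : Quotient (rel ∅ A) → ℤ × ℤ := fun x => Quotient.liftOn' x mid fun _ _ h => rel_empty_iff.1 h
  have hμ : Function.Injective μ := by
    intro x y
    induction x using Quotient.inductionOn'
    induction y using Quotient.inductionOn'
    intro h
    exact Quotient.sound (rel_empty_iff.2 h)
  let U : Finset (Quotient (rel ∅ A)) := Finset.univ.filter fun x => μ x ∈ T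
  have hU : T.card ≤ U.card := by
    have : T ⊆ U.image μ := by
      intro m hm
      obtain ⟨h, g, rfl, -, -⟩ := hT m hm
      exact Finset.mem_image.2 ⟨Quotient.mk'' h, by simpa [U, μ] using hm, rfl⟩
    exact (Finset.card_le_card this).trans Finset.card_image_le
  -- Every class contains at least two edges, or else a single edge outside `T`. Summing over the
  -- classes gives `2 * cc S A ≤ cc ∅ A + (cc ∅ A - U.card)`.
  have fib : ∀ y : Quotient (rel S A),
      2 ≤ (Finset.univ.filter fun x => φ x = y).card + (Uᶜ.filter fun x => φ x = y).card := by
    intro y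
    induction y using Quotient.inductionOn' with
    | h a =>
    by_cases hex : ∃ x ∈ U, φ x = Quotient.mk'' a
    · obtain ⟨x, hxU, hx⟩ := hex
      induction x using Quotient.inductionOn' with
      | h b =>
      obtain ⟨h, g, h1, h2, h3⟩ := hT (mid b) (Finset.mem_filter.1 hxU).2
      have hne : (Quotient.mk'' b : Quotient (rel ∅ A)) ≠ Quotient.mk'' g := by
        intro he
        exact h2 (rel_empty_iff.1 (Quotient.exact he)).symm
      have hg : φ (Quotient.mk'' g) = Quotient.mk'' a := by
        rw [← hx]
        refine Quotient.sound' ((rel S A).symm ((rel S A).trans ?_ h3))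
        exact rel_of_mid h1.symm
      have : ({Quotient.mk'' b, Quotient.mk'' g} : Finset (Quotient (rel ∅ A))) ⊆
          Finset.univ.filter fun x => φ x = Quotient.mk'' a := by
        intro z hz
        simp only [Finset.mem_insert, Finset.mem_singleton] at hz
        rcases hz with rfl | rfl
        · simpa using hx
        · simpa using hg
      have := Finset.card_le_card this
      rw [Finset.card_pair hne] at this
      omega
    · have ha : φ (Quotient.mk'' a) = Quotient.mk'' a := rfl
      have h1 : 0 < (Finset.univ.filter fun x => φ x = Quotient.mk'' a).card :=
        Finset.card_pos.2 ⟨Quotient.mk'' a, by simpa using ha⟩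
      have h2 : 0 < (Uᶜ.filter fun x => φ x = Quotient.mk'' a).card :=
        Finset.card_pos.2 ⟨Quotient.mk'' a, Finset.mem_filter.2
          ⟨Finset.mem_compl.2 fun hm => hex ⟨_, hm, ha⟩, ha⟩⟩
      omega
  have hsum := Finset.sum_le_sum fun (y : Quotient (rel S A)) (_ : y ∈ Finset.univ) => fib y
  rw [Finset.sum_add_distrib, ← Finset.card_eq_sum_card_fiberwise (fun _ _ => Finset.mem_univ _),
    ← Finset.card_eq_sum_card_fiberwise (fun _ _ => Finset.mem_univ _), Finset.card_compl] at hsum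
  simp only [Finset.sum_const, smul_eq_mul, Finset.card_univ] at hsum
  have hUle : U.card ≤ Fintype.card (Quotient (rel ∅ A)) := Finset.card_le_univ U
  have e1 : cc ∅ A = Fintype.card (Quotient (rel ∅ A)) := Nat.card_eq_fintype_card
  have e2 : cc S A = Fintype.card (Quotient (rel S A)) := Nat.card_eq_fintype_card
  rw [rank, e1, e2]
  omega

instance {n q : ℕ} (ι : Fin q → Fin q) : Finite (Carving n ι) :=
  inferInstanceAs (Finite {f : Labelling n q // Fits ι f})

/-! ### Union bounds, and the probability that given pieces fit -/

section Probability

variable {n q : ℕ} {ι : Fin q → Fin q}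

lemma prob_mono {E F : Carving n ι → Prop} (h : ∀ ω, E ω → F ω) : prob E ≤ prob F := by
  unfold prob
  gcongr
  exact Nat.card_mono (Set.toFinite {ω | F ω}) h

lemma prob_le_one (E : Carving n ι → Prop) : prob E ≤ 1 := by
  unfold prob
  refine div_le_one_of_le₀ ?_ (by positivity)
  exact_mod_cast Finite.card_subtype_le E

lemma prob_or_le (E F : Carving n ι → Prop) : prob (fun ω => E ω ∨ F ω) ≤ prob E + prob F := by
  unfold prob
  rw [← add_div]
  gcongr
  exact_mod_cast Set.ncard_union_le {ω | E ω} {ω | F ω}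

lemma prob_false : prob (fun _ : Carving n ι => False) = 0 := by
  simp [prob]

lemma prob_exists_finset_le {α : Type*} (s : Finset α) (E : α → Carving n ι → Prop) :
    prob (fun ω => ∃ i ∈ s, E i ω) ≤ ∑ i ∈ s, prob (E i) := by
  classical
  induction s using Finset.induction_on with
  | empty => simp [prob_false]
  | insert i s hi ih =>
    rw [Finset.sum_insert hi]
    refine le_trans (prob_mono ?_) ((prob_or_le (E i) fun ω => ∃ i ∈ s, E i ω).trans
      (add_le_add_right ih _))
    rintro ω ⟨j, hj, h⟩
    rcases Finset.mem_insert.1 hj with rfl | hj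
    · exact Or.inl h
    · exact Or.inr ⟨j, hj, h⟩

lemma prob_exists_le {α : Type*} [Fintype α] (E : α → Carving n ι → Prop) :
    prob (fun ω => ∃ i, E i ω) ≤ ∑ i, prob (E i) := by
  simpa using prob_exists_finset_le Finset.univ E

lemma prob_exists_finset_le_const {α : Type*} (s : Finset α) (E : α → Carving n ι → Prop) {C : ℝ}
    (h : ∀ i ∈ s, prob (E i) ≤ C) : prob (fun ω => ∃ i ∈ s, E i ω) ≤ s.card * C := by
  refine (prob_exists_finset_le s E).trans ((Finset.sum_le_sum h).trans ?_)
  simp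

/-- The jig at a side. -/
def Carving.jig (ω : Carving n ι) (h : Tile n) : Fin q := ω.1 h.1 h.2

/-- The pieces placed by `A` on the cells of `S` fit together. -/
def FitsOn (S : Finset (Cell n)) (A : Cell n → Tile n) (ω : Carving n ι) : Prop :=
  ∀ c ∈ S, ∀ c' ∈ S, ∀ d, IsNeighbor c d c' →
    ω.jig (side (A c') (d + 2)) = ι (ω.jig (side (A c) d))

lemma jig_planted (ω : Carving n ι) {p p' : Cell n} {d : ZMod 4} (h : IsNeighbor p d p') :
    ω.jig (p', d + 2) = ι (ω.jig (p, d)) := ω.2 p d p' h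

/-- A carving in which the pieces fit is determined by its jig at one side of each class, since the
jigs at two identified sides determine each other through `ι`. -/
lemma card_fitsOn_le (hι : Function.Involutive ι) (S : Finset (Cell n)) (A : Cell n → Tile n) :
    Nat.card {ω : Carving n ι // FitsOn S A ω} ≤ q ^ cc S A := by
  classical
  have := Fintype.ofFinite (Quotient (rel S A))
  have e : q ^ cc S A = Nat.card (Quotient (rel S A) → Fin q) := by
    rw [Nat.card_fun, Nat.card_fin]; rfl
  rw [e]
  refine Nat.card_le_card_of_injective (fun ω x => ω.1.jig x.out) ?_
  rintro ⟨ω, hω⟩ ⟨ω', hω'⟩ h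
  have key : ∀ h : Tile n, ω.jig h = ω'.jig h := by
    intro g
    have hg := congrFun h (Quotient.mk'' g)
    refine (rel_invariant (fun g => ω.jig g = ω'.jig g) ?_ ?_
      (Quotient.exact (Quotient.out_eq (Quotient.mk'' g : Quotient (rel S A))))).1 hg
    · intro a b hab
      rcases mid_eq_iff.1 hab with rfl | ⟨h1, h2⟩
      · rfl
      · obtain ⟨b1, b2⟩ := b
        simp only at h1 h2
        subst h2
        rw [jig_planted ω h1, jig_planted ω' h1, hι.injective.eq_iff]
    · intro c hc c' hc' d hd
      rw [hω c hc c' hc' d hd, hω' c hc c' hc' d hd, hι.injective.eq_iff]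
  refine Subtype.ext (Subtype.ext ?_)
  funext p d
  exact key (p, d)

lemma pow_le_card_carving (hι : Function.Involutive ι) (A : Cell n → Tile n) :
    q ^ cc ∅ A ≤ Nat.card (Carving n ι) := by
  classical
  have := Fintype.ofFinite (Quotient (rel ∅ A))
  have e : q ^ cc ∅ A = Nat.card (Quotient (rel ∅ A) → Fin q) := by
    rw [Nat.card_fun, Nat.card_fin]; rfl
  rw [e]
  -- The jigs of the edges are free. The value `v` is read on the eastern or northern side of an
  -- edge and `ι v` on the other side; an edge between two pieces has one side of either sort.
  let F : (Quotient (rel ∅ A) → Fin q) → Labelling n q := fun v p d =>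
    if d = 0 ∨ d = 1 then v (Quotient.mk'' (p, d)) else ι (v (Quotient.mk'' (p, d)))
  have hF : ∀ v, Fits ι (F v) := by
    intro v p d p' h
    have hm : (Quotient.mk'' (p', d + 2) : Quotient (rel ∅ A)) = Quotient.mk'' (p, d) :=
      Quotient.sound' (rel_of_mid (mid_neighbor h))
    simp only [F, hm]
    have key : (d = 0 ∨ d = 1) ↔ ¬ (d + 2 = 0 ∨ d + 2 = 1) := by clear hm h; revert d; decide
    by_cases hd : d = 0 ∨ d = 1
    · rw [if_pos hd, if_neg (key.1 hd)]
    · rw [if_neg hd, if_pos (not_not.1 (fun h' => hd (key.2 h'))), hι]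
  refine Nat.card_le_card_of_injective (fun v => (⟨F v, hF v⟩ : Carving n ι)) ?_
  intro v v' h
  funext x
  induction x using Quotient.inductionOn' with
  | h a =>
  obtain ⟨p, d⟩ := a
  have h2 : F v p d = F v' p d := by
    have := congrArg Subtype.val h
    exact congrFun (congrFun this p) d
  simp only [F] at h2
  split_ifs at h2
  · exact h2
  · exact hι.injective h2

/-- The pieces placed by `A` on `S` fit with probability at most `κ ^ (-rank)`. -/
lemma prob_fitsOn_le (hι : Function.Involutive ι) {κ : ℝ} (hκ : 0 < κ) (hq : κ ≤ q)
    (S : Finset (Cell n)) (A : Cell n → Tile n) :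
    prob (fun ω : Carving n ι => FitsOn S A ω) ≤ κ⁻¹ ^ rank S A := by
  have hq0 : (0:ℝ) < q := hκ.trans_le hq
  have h1 : (Nat.card {ω : Carving n ι // FitsOn S A ω} : ℝ) ≤ (q:ℝ) ^ cc S A := by
    exact_mod_cast card_fitsOn_le hι S A
  have h2 : (q:ℝ) ^ cc ∅ A ≤ Nat.card (Carving n ι) := by
    exact_mod_cast pow_le_card_carving hι A
  have h3 : cc ∅ A = cc S A + rank S A := by
    have := cc_anti (Finset.empty_subset S) A
    rw [rank]; omega
  unfold prob
  calc _ ≤ (q:ℝ) ^ cc S A / (q:ℝ) ^ cc ∅ A := by gcongr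
    _ = (q:ℝ)⁻¹ ^ rank S A := by
      rw [h3, pow_add, inv_pow]; field_simp
    _ ≤ κ⁻¹ ^ rank S A := by gcongr

/-- If bad events have vanishing probability, then good events have probability tending to one. -/
lemma prob_add_prob_not [Nonempty (Carving n ι)] (E : Carving n ι → Prop) :
    prob E + prob (fun ω => ¬ E ω) = 1 := by
  classical
  have := Fintype.ofFinite (Carving n ι)
  unfold prob
  rw [← add_div, div_eq_one_iff_eq (by exact_mod_cast Nat.card_pos.ne')]
  rw [Nat.card_eq_fintype_card, Nat.card_eq_fintype_card, Nat.card_eq_fintype_card]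
  exact_mod_cast by rw [add_comm]; exact (Fintype.card_subtype_compl E) ▸
    Nat.sub_add_cancel (Fintype.card_subtype_le E)

lemma nonempty_carving (hι : Function.Involutive ι) (hq : 0 < q) : Nonempty (Carving n ι) := by
  have h := pow_le_card_carving (n := n) hι (fun c => (c, 0))
  have : 0 < Nat.card (Carving n ι) := (pow_pos hq _).trans_le h
  exact (Nat.card_pos_iff.1 this).1

end Probability

lemma tendsto_prob_of_not {q : ℕ → ℕ} {ι : ∀ n, Fin (q n) → Fin (q n)}
    (hι : ∀ n, Function.Involutive (ι n)) (hq : ∀ᶠ n in atTop, 0 < q n)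
    (E : ∀ n, Carving n (ι n) → Prop) {f : ℕ → ℝ} (hf : Tendsto f atTop (𝓝 0))
    (h : ∀ᶠ n in atTop, prob (fun ω => ¬ E n ω) ≤ f n) :
    Tendsto (fun n => prob (E n)) atTop (𝓝 1) := by
  have h1 : Tendsto (fun n => 1 - f n) atTop (𝓝 1) := by simpa using hf.const_sub 1
  refine tendsto_of_tendsto_of_tendsto_of_le_of_le' h1 tendsto_const_nhds ?_
    (Eventually.of_forall fun n => prob_le_one _)
  filter_upwards [h, hq] with n hn hqn
  have := nonempty_carving (n := n) (hι n) hqn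
  have := prob_add_prob_not (E n)
  linarith

/-! ### Sums over successive placements of distinct pieces -/

section Fillings

variable {n : ℕ}

open Classical in
/-- Sum over all ways of placing unused pieces successively on the cells of a list. -/
noncomputable def fillSum : List (Cell n) → Finset (Cell n) → (Cell n → Tile n) →
    ((Cell n → Tile n) → ℝ) → ℝ
  | [], _, A, g => g A
  | c :: l, S, A, g => ∑ x : Tile n, if ∃ b ∈ S, (A b).1 = x.1 then 0 else
      fillSum l (insert c S) (Function.update A c x) g

/-- The pieces placed on `S` are distinct. -/
def DistinctOn (S : Finset (Cell n)) (A : Cell n → Tile n) : Prop :=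
  Set.InjOn (fun c => (A c).1) (S : Set (Cell n))

lemma DistinctOn.congr {S : Finset (Cell n)} {A A' : Cell n → Tile n} (h : ∀ c ∈ S, A c = A' c)
    (hA : DistinctOn S A) : DistinctOn S A' := by
  intro x hx y hy hxy
  refine hA hx hy ?_
  simp only at hxy ⊢
  rw [h x hx, h y hy, hxy]

open Classical in
lemma distinctOn_update {S : Finset (Cell n)} {A : Cell n → Tile n} {c : Cell n} {x : Tile n}
    (hA : DistinctOn S A) (hc : c ∉ S) (hx : ¬ ∃ b ∈ S, (A b).1 = x.1) :
    DistinctOn (insert c S) (Function.update A c x) := by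
  have hne : ∀ {y}, y ∈ S → y ≠ c := by rintro y hy rfl; exact hc hy
  intro y hy z hz hyz
  simp only [Finset.coe_insert, Set.mem_insert_iff, Finset.mem_coe] at hy hz
  rcases hy with rfl | hy <;> rcases hz with rfl | hz
  · rfl
  · simp only [Function.update_self, Function.update_of_ne (hne hz)] at hyz
    exact absurd ⟨z, hz, hyz.symm⟩ hx
  · simp only [Function.update_self, Function.update_of_ne (hne hy)] at hyz
    exact absurd ⟨y, hy, hyz⟩ hx
  · simp only [Function.update_of_ne (hne hy), Function.update_of_ne (hne hz)] at hyz
    exact hA hy hz hyz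

-- The comparison is only needed for assignments that occur in the sum, which agree with `A` off the
-- list and place distinct pieces.
open Classical in
lemma fillSum_mono (l : List (Cell n)) : ∀ (S : Finset (Cell n)) (A : Cell n → Tile n)
    {g g' : (Cell n → Tile n) → ℝ}, l.Nodup → (∀ c ∈ l, c ∉ S) → DistinctOn S A →
    (∀ A', (∀ c, c ∉ l → A' c = A c) → DistinctOn (S ∪ l.toFinset) A' → g A' ≤ g' A') →
    fillSum l S A g ≤ fillSum l S A g' := by
  induction l with
  | nil =>
    intro S A g g' _ _ hA h
    exact h A (fun _ _ => rfl) (by simpa using hA)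
  | cons c l ih =>
    intro S A g g' hl hS hA h
    rw [List.nodup_cons] at hl
    have hcS := hS c (by simp)
    unfold fillSum
    refine Finset.sum_le_sum fun x _ => ?_
    split_ifs with hx
    · exact le_rfl
    refine ih _ _ hl.2 ?_ (distinctOn_update hA hcS hx) ?_
    · intro c' hc'
      rw [Finset.mem_insert, not_or]
      exact ⟨fun e => hl.1 (e ▸ hc'), hS c' (by simp [hc'])⟩
    · intro A' hA' hd
      refine h A' ?_ ?_
      · intro c' hc'
        rw [List.mem_cons, not_or] at hc'
        rw [hA' c' hc'.2, Function.update_of_ne hc'.1]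
      · convert hd using 1
        ext y; simp

lemma fillSum_const_mul (a : ℝ) (l : List (Cell n)) : ∀ (S : Finset (Cell n)) (A : Cell n → Tile n)
    (g : (Cell n → Tile n) → ℝ), fillSum l S A (fun A' => a * g A') = a * fillSum l S A g := by
  induction l with
  | nil => intro S A g; rfl
  | cons c l ih =>
    intro S A g
    simp only [fillSum, ih, Finset.mul_sum, mul_ite, mul_zero]

open Classical in
lemma fillSum_append (l l' : List (Cell n)) : ∀ (S : Finset (Cell n)) (A : Cell n → Tile n)
    (g : (Cell n → Tile n) → ℝ), fillSum (l ++ l') S A g =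
      fillSum l S A (fun A' => fillSum l' (S ∪ l.toFinset) A' g) := by
  induction l with
  | nil => intro S A g; simp [fillSum]
  | cons c l ih =>
    intro S A g
    simp only [List.cons_append, fillSum]
    refine Finset.sum_congr rfl fun x _ => ?_
    split_ifs
    · rfl
    rw [ih]
    have : insert c S ∪ l.toFinset = S ∪ (c :: l).toFinset := by ext y; simp
    rw [this]

open Classical in
/-- Union bound over all fillings. -/
lemma prob_exists_filling_le {q : ℕ} {ι : Fin q → Fin q} (hι : Function.Involutive ι) {κ : ℝ}
    (hκ : 0 < κ) (hq : κ ≤ q) (Q : (Cell n → Tile n) → Prop) (l : List (Cell n)) :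
    ∀ (S : Finset (Cell n)) (A : Cell n → Tile n), l.Nodup → (∀ c ∈ l, c ∉ S) →
    prob (fun ω : Carving n ι => ∃ A', (∀ c, c ∉ l → A' c = A c) ∧
      DistinctOn (S ∪ l.toFinset) A' ∧ FitsOn (S ∪ l.toFinset) A' ω ∧ Q A') ≤
    fillSum l S A (fun A' => if Q A' then κ⁻¹ ^ rank (S ∪ l.toFinset) A' else 0) := by
  induction l with
  | nil =>
    intro S A _ _
    simp only [List.toFinset_nil, Finset.union_empty, fillSum]
    have hA : ∀ A' : Cell n → Tile n, (∀ c, c ∉ ([] : List (Cell n)) → A' c = A c) → A' = A :=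
      fun A' h => funext fun c => h c (by simp)
    split_ifs with h
    · refine le_trans (prob_mono ?_) (prob_fitsOn_le hι hκ hq S A)
      rintro ω ⟨A', h1, -, h2, -⟩
      rwa [← hA A' h1]
    · refine le_trans (prob_mono (F := fun _ => False) ?_) prob_false.le
      rintro ω ⟨A', h1, -, -, h2⟩
      exact h (hA A' h1 ▸ h2)
  | cons c l ih =>
    intro S A hl hS
    rw [List.nodup_cons] at hl
    have hcS := hS c (by simp)
    have hSl : insert c S ∪ l.toFinset = S ∪ (c :: l).toFinset := by ext y; simp
    have hcover : ∀ ω : Carving n ι, (∃ A', (∀ c', c' ∉ c :: l → A' c' = A c') ∧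
        DistinctOn (S ∪ (c :: l).toFinset) A' ∧ FitsOn (S ∪ (c :: l).toFinset) A' ω ∧ Q A') →
        ∃ x : Tile n, (¬ ∃ b ∈ S, (A b).1 = x.1) ∧
          ∃ A', (∀ c', c' ∉ l → A' c' = Function.update A c x c') ∧
          DistinctOn (insert c S ∪ l.toFinset) A' ∧ FitsOn (insert c S ∪ l.toFinset) A' ω ∧
          Q A' := by
      rintro ω ⟨A', h1, h2, h3, h4⟩
      refine ⟨A' c, ?_, A', ?_, hSl ▸ h2, hSl ▸ h3, h4⟩
      · rintro ⟨b, hb, hbx⟩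
        have hbl : b ∉ c :: l := fun h => hS b h hb
        rw [← h1 b hbl] at hbx
        have : b = c := h2 (by simp [hb]) (by simp) hbx
        exact hcS (this ▸ hb)
      · intro c' hc'
        by_cases e : c' = c
        · subst e; simp
        · rw [Function.update_of_ne e]
          exact h1 c' (by simp [e, hc'])
    refine (prob_mono hcover).trans ((prob_exists_le _).trans ?_)
    unfold fillSum
    refine Finset.sum_le_sum fun x _ => ?_
    split_ifs with hx
    · refine le_trans (prob_mono (F := fun _ => False) ?_) prob_false.le
      rintro ω ⟨h, -⟩
      exact h hx
    · refine le_trans (prob_mono fun ω h => h.2) ?_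
      have := ih (insert c S) (Function.update A c x) hl.2 (by
        intro c' hc'
        rw [Finset.mem_insert, not_or]
        exact ⟨fun e => hl.1 (e ▸ hc'), hS c' (by simp [hc'])⟩)
      rw [hSl] at this ⊢
      exact this

/-! ### Fresh pieces -/

/-- Points of the integer lattice at sup-distance more than `K`. -/
def Far (K : ℕ) (u v : ℤ × ℤ) : Prop := (K : ℤ) < |u.1 - v.1| ∨ (K : ℤ) < |u.2 - v.2|

/-- The piece `x.1` is far from all the pieces placed on `S`. -/
def Fresh (K : ℕ) (S : Finset (Cell n)) (A : Cell n → Tile n) (x : Tile n) : Prop :=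
  ∀ b ∈ S, Far K (co (A b).1) (co x.1)

lemma step_abs_le (d : ZMod 4) : |(step d).1| ≤ 1 ∧ |(step d).2| ≤ 1 := by
  revert d; decide

lemma Fresh.not_neighbor {K : ℕ} (hK : 1 ≤ K) {S : Finset (Cell n)} {A : Cell n → Tile n}
    {x : Tile n} (hx : Fresh K S A x) {b : Cell n} (hb : b ∈ S) (d d' : ZMod 4) :
    mid (side (A b) d) ≠ mid (side x d') := by
  intro h
  have hf := hx b hb
  rcases mid_eq_iff.1 h with h | ⟨h, -⟩
  · have : (A b).1 = x.1 := by simpa using congrArg Prod.fst h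
    rw [this] at hf
    rcases hf with hf | hf <;> simp at hf <;> omega
  · rw [isNeighbor_iff] at h
    simp only [side_fst] at h
    rw [Far, h] at hf
    have hs := step_abs_le (side (A b) d).2
    rcases hf with hf | hf <;> simp only [Prod.fst_add, Prod.snd_add, sub_add_cancel_left, abs_neg] at hf <;> omega

/-- An edge which occurs on no placed piece is only related to itself. -/
lemma rel_isolated {S : Finset (Cell n)} {A : Cell n → Tile n} {m : ℤ × ℤ}
    (hm : ∀ b ∈ S, ∀ d, mid (side (A b) d) ≠ m) {h g : Tile n} (hg : rel S A h g) :
    mid h = m ↔ mid g = m :=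
  rel_invariant (fun h => mid h = m) (fun h g e => by rw [e])
    (fun c hc c' hc' d _ => iff_of_false (hm c hc d) (hm c' hc' (d + 2))) hg

open Classical in
/-- Placing a fresh piece imposes independent constraints on all its assembled sides. -/
lemma cc_add_card_le_of_fresh {K : ℕ} (hK : 1 ≤ K) {S : Finset (Cell n)} {A : Cell n → Tile n}
    {c : Cell n} (hx : Fresh K S A (A c)) (D : Finset (ZMod 4))
    (hD : ∀ d ∈ D, ∃ b ∈ S, IsNeighbor c d b) : cc (insert c S) A + D.card ≤ cc S A := by
  have hinj : Function.Injective (side (A c)) := fun d d' h => side_inj_dir _ h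
  rw [← Finset.card_image_of_injective D hinj]
  -- As no placed piece carries an edge of the fresh piece, each such edge is a class of its own
  -- before `c` is filled. The side of the placed neighbour then lies in another class.
  refine card_quotient_drop (rel_mono (Finset.subset_insert c S) A) _ ?_ ?_
  · intro g hg g' hg' h
    obtain ⟨d, hd, rfl⟩ := Finset.mem_image.1 hg
    obtain ⟨d', hd', rfl⟩ := Finset.mem_image.1 hg'
    have := (rel_isolated (fun b hb e => hx.not_neighbor hK hb e d) h).1 rfl
    have h2 : d' - (A c).2 = d - (A c).2 := mid_same_piece this
    rw [sub_left_inj.1 h2]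
  · intro g hg
    obtain ⟨d, hd, rfl⟩ := Finset.mem_image.1 hg
    obtain ⟨b, hb, hn⟩ := hD d hd
    refine ⟨side (A b) (d + 2), rel_of_neighbor (by simp) (by simp [hb]) hn, ?_⟩
    intro g' hg' h
    obtain ⟨d', hd', rfl⟩ := Finset.mem_image.1 hg'
    exact hx.not_neighbor hK hb (d + 2) d' ((rel_isolated (fun b hb e => hx.not_neighbor hK hb e d') h).1 rfl)

-- If no class is lost, the relation is unchanged, so the touching of the new piece with its
-- neighbour was implied before.
open Classical in
lemma rel_of_no_drop {S : Finset (Cell n)} {A : Cell n → Tile n} {c : Cell n}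
    (h0 : cc S A - cc (insert c S) A = 0) {b : Cell n} (hb : b ∈ S) {d : ZMod 4}
    (hn : IsNeighbor c d b) : rel S A (side (A c) d) (side (A b) (d + 2)) :=
  le_of_card_quotient_eq (rel_mono (Finset.subset_insert c S) A) (Nat.sub_eq_zero_iff_le.1 h0)
    (rel_of_neighbor (by simp) (by simp [hb]) hn)

open Classical in
lemma rel_update {S : Finset (Cell n)} {A : Cell n → Tile n} {c : Cell n}
    (hc : c ∉ S) (x : Tile n) : rel S (Function.update A c x) = rel S A :=
  rel_congr fun b hb => Function.update_of_ne (by rintro rfl; exact hc hb) _ _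

open Classical in
/-- At most one piece can be placed without imposing a new constraint. -/
lemma no_drop_unique {S : Finset (Cell n)} {A : Cell n → Tile n} (hA : DistinctOn S A) {c : Cell n}
    (hc : c ∉ S) {a : Cell n} (ha : a ∈ S) {d : ZMod 4} (hn : IsNeighbor c d a) {x y : Tile n}
    (hx : ¬ ∃ b ∈ S, (A b).1 = x.1) (hy : ¬ ∃ b ∈ S, (A b).1 = y.1)
    (hx0 : cc S (Function.update A c x) - cc (insert c S) (Function.update A c x) = 0)
    (hy0 : cc S (Function.update A c y) - cc (insert c S) (Function.update A c y) = 0) : x = y := by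
  have hac : a ≠ c := by rintro rfl; exact hc ha
  have h1 := rel_of_no_drop hx0 ha hn
  have h2 := rel_of_no_drop hy0 ha hn
  rw [rel_update hc, Function.update_self, Function.update_of_ne hac] at h1 h2
  have free : ∀ {z : Tile n}, (¬ ∃ b ∈ S, (A b).1 = z.1) → ∀ u ∈ S, ∀ v ∈ S, ∀ e,
      IsNeighbor u e v → side z d ≠ side (A u) e := by
    intro z hz u hu v hv e _ h
    exact hz ⟨u, hu, (congrArg Prod.fst h).symm⟩
  have hfree : ∀ u ∈ S, ∀ v ∈ S, ∀ e, IsNeighbor u e v → side (A a) (d + 2) ≠ side (A u) e := by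
    intro u hu v hv e he h
    have : a = u := hA ha hu (by have := congrArg Prod.fst h; exact this)
    subst this
    have := side_inj_dir _ h
    subst this
    exact hc (hn.symm.unique he ▸ hv)
  -- The side of `a` towards `c` and the sides of `x` and `y` are free and lie in one class, so two
  -- of them agree. The first belongs to a used piece and differs from the others.
  rcases rel_free_sides hA hfree (free hx) (free hy) ((rel S A).symm h1) ((rel S A).symm h2)
    with h | h | h
  · exact absurd ⟨a, ha, by simpa using congrArg Prod.fst h⟩ hx
  · exact side_injective d h
  · exact absurd ⟨a, ha, by simpa using congrArg Prod.fst h⟩ hy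

open Classical in
/-- Right after a fresh piece, no piece can be placed without imposing a new constraint. -/
lemma drop_after_fresh {K : ℕ} (hK : 2 ≤ K) {S : Finset (Cell n)} {A : Cell n → Tile n} {c : Cell n}
    (hc : c ∉ S) {a b : Cell n} (ha : a ∈ S) (hb : b ∈ S) (hna : IsNeighbor c 2 a)
    (hnb : IsNeighbor c 3 b) (hf : Fresh K (S.erase a) A (A a)) {x : Tile n}
    (hx : ¬ ∃ b ∈ S, (A b).1 = x.1) :
    cc S (Function.update A c x) - cc (insert c S) (Function.update A c x) ≠ 0 := by
  intro h0
  have hac : a ≠ c := by rintro rfl; exact hc ha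
  have hbc : b ≠ c := by rintro rfl; exact hc hb
  have h1 := rel_of_no_drop h0 ha hna
  have h2 := rel_of_no_drop h0 hb hnb
  rw [rel_update hc, Function.update_self, Function.update_of_ne hac] at h1
  rw [rel_update hc, Function.update_self, Function.update_of_ne hbc] at h2
  have hca : IsNeighbor a 0 c := hna.symm
  -- the side of the fresh piece facing `c` is only related to its planted counterpart
  have hz : ∀ z ∈ S, ∀ y ∈ S, ∀ e, IsNeighbor z e y → mid (side (A z) e) ≠ mid (side (A a) 0) := by
    intro z hz y hy e he h
    by_cases hza : z = a
    · subst hza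
      have : e = 0 := by
        have h' : e - (A z).2 = 0 - (A z).2 := mid_same_piece h
        exact sub_left_inj.1 h'
      subst this
      exact hc (hca.unique he ▸ hy)
    · exact hf.not_neighbor (by omega) (Finset.mem_erase.2 ⟨hza, hz⟩) e 0 h
  -- The edge of the fresh piece at `c` is a class of its own, so the western side of `x` lies on
  -- it: `x` is the planted neighbour of the fresh piece there.
  have h3 : mid (side x 2) = mid (side (A a) 0) :=
    (rel_invariant (fun h => mid h = mid (side (A a) 0)) (fun h g e => by rw [e])
      (fun z hz' y hy e he => iff_of_false (hz z hz' y hy e he)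
        (hz y hy z hz' _ he.symm)) h1).2 rfl
  rcases mid_eq_iff.1 h3.symm with h3 | ⟨h3, h4⟩
  · exact hx ⟨a, ha, by simpa using congrArg Prod.fst h3⟩
  simp only [side] at h3 h4
  rw [isNeighbor_iff] at h3
  have hstep : ∀ s : ZMod 4, step s ≠ -step (s + 3) ∧ |(step s).1 + (step (s + 3)).1| ≤ 1 ∧
      |(step s).2 + (step (s + 3)).2| ≤ 1 := by decide
  have h5 : (3 : ZMod 4) - x.2 = 0 - (A a).2 + 3 := by
    have : (2 : ZMod 4) - x.2 + 1 = 0 - (A a).2 + 2 + 1 := by rw [h4]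
    calc (3 : ZMod 4) - x.2 = 2 - x.2 + 1 := by ring
      _ = _ := by rw [this]; ring
  -- Beyond the southern side of `x`, the planted puzzle has a diagonal neighbour of the fresh
  -- piece. It is at distance one from it and therefore not in use. So that edge is a class of its
  -- own as well and cannot be related to the side of `b`.
  have hm : ∀ z ∈ S, ∀ e, mid (side (A z) e) ≠ mid (side x 3) := by
    intro z hz e h
    rcases mid_eq_iff.1 h.symm with h | ⟨h, -⟩
    · exact hx ⟨z, hz, (congrArg Prod.fst h).symm⟩
    simp only [side, h5] at h
    rw [isNeighbor_iff, h3] at h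
    obtain ⟨k1, k2, k3⟩ := hstep (0 - (A a).2)
    by_cases hza : z = a
    · subst hza
      apply k1
      have : step (0 - (A z).2) + step (0 - (A z).2 + 3) = 0 := by
        rw [add_assoc] at h; simpa using h.symm
      exact eq_neg_of_add_eq_zero_left this
    · have := hf z (Finset.mem_erase.2 ⟨hza, hz⟩)
      rw [Far, h] at this
      simp only [Prod.fst_add, Prod.snd_add, add_assoc, add_sub_cancel_left] at this
      omega
  exact hm b hb (3 + 2) ((rel_isolated hm h2).1 rfl)

open Classical in
lemma card_not_far_le (K : ℕ) (u : ℤ × ℤ) :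
    (Finset.univ.filter fun x : Tile n => ¬ Far K u (co x.1)).card ≤ 4 * (2 * K + 1) ^ 2 := by
  let f : Tile n → (ℤ × ℤ) × ZMod 4 := fun x => (co x.1, x.2)
  have hf : Function.Injective f := by
    rintro ⟨x, r⟩ ⟨y, s⟩ h
    simp only [f, Prod.mk.injEq] at h
    exact Prod.ext (co_injective h.1) h.2
  rw [← Finset.card_image_of_injective _ hf]
  have : (Finset.univ.filter fun x : Tile n => ¬ Far K u (co x.1)).image f ⊆
      ((Finset.Icc (u.1 - K) (u.1 + K)) ×ˢ (Finset.Icc (u.2 - K) (u.2 + K))) ×ˢ Finset.univ := by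
    intro y hy
    obtain ⟨x, hx, rfl⟩ := Finset.mem_image.1 hy
    simp only [Far, Finset.mem_filter, Finset.mem_univ, true_and, not_or, not_lt, abs_le] at hx
    simp only [f, Finset.mem_product, Finset.mem_Icc, Finset.mem_univ, and_true]
    omega
  refine (Finset.card_le_card this).trans ?_
  simp only [Finset.card_product, Int.card_Icc, Finset.card_univ, ZMod.card]
  have e1 : (u.1 + K + 1 - (u.1 - K)).toNat = 2 * K + 1 := by omega
  have e2 : (u.2 + K + 1 - (u.2 - K)).toNat = 2 * K + 1 := by omega
  rw [e1, e2]
  apply le_of_eq; ring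

open Classical in
lemma card_not_fresh_le (K : ℕ) (S : Finset (Cell n)) (A : Cell n → Tile n) :
    (Finset.univ.filter fun x : Tile n => ¬ Fresh K S A x).card ≤ S.card * (4 * (2 * K + 1) ^ 2) := by
  have hsub : (Finset.univ.filter fun x : Tile n => ¬ Fresh K S A x) ⊆
      S.biUnion fun b => Finset.univ.filter fun x : Tile n => ¬ Far K (co (A b).1) (co x.1) := by
    intro x hx
    simp only [Fresh, Finset.mem_filter, Finset.mem_univ, true_and, not_forall] at hx
    obtain ⟨b, hb, h⟩ := hx
    simp only [Finset.mem_biUnion, Finset.mem_filter, Finset.mem_univ, true_and]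
    exact ⟨b, hb, h⟩
  exact (Finset.card_le_card hsub).trans
    (Finset.card_biUnion_le_card_mul _ _ _ fun b _ => card_not_far_le K _)

/-! ### Weights of fillings -/

open Classical in
/-- The weight of one placement: the choices for a fresh piece are compensated by two of the
constraints it imposes, every other constraint costs a factor `t`. -/
noncomputable def stepWeight (K : ℕ) (t : ℝ) (S : Finset (Cell n)) (A : Cell n → Tile n)
    (c : Cell n) : ℝ :=
  if Fresh K S A (A c) then ((4 * n ^ 2 : ℕ) : ℝ)⁻¹ * t ^ (cc S A - cc (insert c S) A - 2)
  else t ^ (cc S A - cc (insert c S) A)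

-- This is what remains of the probability bound `κ⁻¹ ^ rank` when a gain has been split off from
-- each constraint, see `weight_eq` and `pow_le_of_split`.
open Classical in
noncomputable def weight (K : ℕ) (t : ℝ) : List (Cell n) → Finset (Cell n) → (Cell n → Tile n) → ℝ
  | [], _, _ => 1
  | c :: l, S, A => stepWeight K t S A c * weight K t l (insert c S) A

lemma fillSum_nonneg {g : (Cell n → Tile n) → ℝ} (l : List (Cell n)) (hg : ∀ A, 0 ≤ g A) :
    ∀ (S : Finset (Cell n)) (A : Cell n → Tile n), 0 ≤ fillSum l S A g := by
  induction l with
  | nil => intro S A; exact hg A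
  | cons c l ih =>
    intro S A
    rw [fillSum]
    refine Finset.sum_nonneg fun x _ => ?_
    split_ifs
    · exact le_rfl
    · exact ih _ _

lemma stepWeight_nonneg {K : ℕ} {t : ℝ} (ht : 0 ≤ t) (S : Finset (Cell n)) (A : Cell n → Tile n)
    (c : Cell n) : 0 ≤ stepWeight K t S A c := by
  unfold stepWeight
  split_ifs <;> positivity

lemma weight_nonneg {K : ℕ} {t : ℝ} (ht : 0 ≤ t) (l : List (Cell n)) :
    ∀ (S : Finset (Cell n)) (A : Cell n → Tile n), 0 ≤ weight K t l S A := by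
  induction l with
  | nil => intro S A; exact zero_le_one
  | cons c l ih => intro S A; exact mul_nonneg (stepWeight_nonneg ht S A c) (ih _ _)

open Classical in
/-- The cells of `l` can be filled row by row: the western and southern neighbours of each cell are
already filled, and at the end of a row also the eastern one; `rem` is the number of cells
remaining in the row. -/
def IsSweep (rem : Cell n → ℕ) : Finset (Cell n) → List (Cell n) → Prop
  | _, [] => True
  | S, c :: l => c ∉ S ∧ (∃ b ∈ S, IsNeighbor c 3 b) ∧ (∃ a ∈ S, IsNeighbor c 2 a) ∧
      ((rem c = 1 ∧ ∃ r ∈ S, IsNeighbor c 0 r) ∨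
        ∃ c' l', l = c' :: l' ∧ IsNeighbor c' 2 c ∧ rem c = rem c' + 1) ∧
      IsSweep rem (insert c S) l

open Classical in
lemma stepWeight_congr (K : ℕ) (t : ℝ) {S : Finset (Cell n)}
    {A A' : Cell n → Tile n} {c : Cell n}
    (h : ∀ b ∈ insert c S, A b = A' b) : stepWeight K t S A c = stepWeight K t S A' c := by
  have h1 : ∀ b ∈ S, A b = A' b := fun b hb => h b (Finset.mem_insert_of_mem hb)
  have hfr : Fresh K S A (A c) ↔ Fresh K S A' (A' c) := by
    rw [h c (Finset.mem_insert_self _ _)]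
    exact forall₂_congr fun b hb => by rw [h1 b hb]
  unfold stepWeight
  rw [cc_congr h1, cc_congr h]
  simp only [hfr]

open Classical in
lemma IsSweep.nodup (rem : Cell n → ℕ) : ∀ (l : List (Cell n)) (S : Finset (Cell n)),
    IsSweep rem S l → l.Nodup ∧ ∀ c ∈ l, c ∉ S := by
  intro l
  induction l with
  | nil => intro S _; simp
  | cons c l ih =>
    rintro S ⟨h1, -, -, -, h2⟩
    obtain ⟨h3, h4⟩ := ih _ h2
    refine ⟨List.nodup_cons.2 ⟨fun h => h4 c h (by simp), h3⟩, ?_⟩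
    intro c' hc'
    rcases List.mem_cons.1 hc' with rfl | hc'
    · exact h1
    · exact fun h => h4 c' hc' (by simp [h])

-- The weight of the first placement does not depend on the later pieces, so it can be taken out of
-- the remaining sum.
open Classical in
lemma fillSum_weight_cons (K : ℕ) (t : ℝ) {c : Cell n} {l : List (Cell n)} {S : Finset (Cell n)}
    {A : Cell n → Tile n} (hl : (c :: l).Nodup) (hS : ∀ b ∈ c :: l, b ∉ S) (hA : DistinctOn S A) :
    fillSum (c :: l) S A (weight K t (c :: l) S) ≤
      ∑ x : Tile n, if ∃ b ∈ S, (A b).1 = x.1 then 0 else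
        stepWeight K t S (Function.update A c x) c *
          fillSum l (insert c S) (Function.update A c x) (weight K t l (insert c S)) := by
  have hcS := hS c (by simp)
  rw [List.nodup_cons] at hl
  rw [fillSum]
  refine Finset.sum_le_sum fun x _ => ?_
  split_ifs with hx
  · exact le_rfl
  rw [← fillSum_const_mul]
  refine fillSum_mono l _ _ hl.2 ?_ (distinctOn_update hA hcS hx) ?_
  · intro c' hc'
    rw [Finset.mem_insert, not_or]
    exact ⟨fun e => hl.1 (e ▸ hc'), hS c' (by simp [hc'])⟩
  · intro A' hA' _
    have : stepWeight K t S A' c = stepWeight K t S (Function.update A c x) c := by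
      refine stepWeight_congr K t fun b hb => hA' b ?_
      intro hbl
      rcases Finset.mem_insert.1 hb with rfl | hb
      · exact hl.1 hbl
      · exact hS b (by simp [hbl]) hb
    rw [weight, this]

open Classical in
lemma ite_ite_le_add {P F Z : Prop} {e a g : ℝ} (he : 0 ≤ e) (ha : 0 ≤ a) (hg : 0 ≤ g) :
    (if P then 0 else if F then e else if Z then g else a) ≤
      e + (if ¬ F then a else 0) + (if ¬ P ∧ Z then g else 0) := by
  by_cases hP : P <;> by_cases hF : F <;> by_cases hZ : Z <;> simp [hP, hF, hZ] <;> linarith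

set_option maxHeartbeats 800000 in
open Classical in
/-- The total weight of all fillings of a sweep is close to one. -/
lemma fillSum_weight_le {K : ℕ} (hK : 2 ≤ K) {t T δ : ℝ} (ht : 0 < t) (ht1 : t ≤ 1) (m w : ℕ)
    (hT : ((m * (4 * (2 * K + 1) ^ 2) : ℕ) + 1 : ℝ) * t ≤ T) (hδ : T + 2 * T * w ≤ δ)
    (rem : Cell n → ℕ) (l : List (Cell n)) :
    ∀ (S : Finset (Cell n)) (A : Cell n → Tile n), IsSweep rem S l → DistinctOn S A →
    S.card + l.length ≤ m → (∀ c ∈ l, 1 ≤ rem c ∧ rem c ≤ w) →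
    fillSum l S A (weight K t l S) ≤ (1 + δ) ^ l.length ∧
    ∀ c l', l = c :: l' → ∀ a ∈ S, IsNeighbor c 2 a → Fresh K (S.erase a) A (A a) →
      fillSum l S A (weight K t l S) ≤ 2 * T * rem c * (1 + δ) ^ l.length := by
  have hT0 : 0 < T := lt_of_lt_of_le (by positivity) hT
  have hδ0 : 0 < δ := lt_of_lt_of_le (by positivity) hδ
  -- Both bounds are proved together. A step admits at most one placement without cost, boundedly
  -- many at cost `t`, and fresh pieces of total prior weight at most one. The latter are harmless
  -- thanks to the second bound, for a row that continues after a fresh piece: each further step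
  -- must then be fresh or cost `t`, and a fresh piece at the end of the row costs `t` too.
  induction l with
  | nil =>
    intro S A _ _ _ _
    simp [fillSum, weight]
  | cons c l ih =>
    intro S A hsw hA hm hrem
    obtain ⟨hnd, hdis⟩ := hsw.nodup
    obtain ⟨hcS, ⟨b, hbS, hbn⟩, ⟨a, haS, ha⟩, hlast, hsw'⟩ := hsw
    obtain ⟨hrc1, hrcw⟩ := hrem c (by simp)
    have hn : 0 < n := by
      have := c.1.pos; exact this
    have hN : (0:ℝ) < ((4 * n ^ 2 : ℕ) : ℝ) := by positivity
    set G : ℝ := (1 + δ) ^ l.length with hG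
    have hG0 : 0 < G := by positivity
    have hcons := fillSum_weight_cons K t hnd hdis hA
    have hstep : ∀ x : Tile n, (¬ ∃ b ∈ S, (A b).1 = x.1) →
        stepWeight K t S (Function.update A c x) c *
          fillSum l (insert c S) (Function.update A c x) (weight K t l (insert c S)) ≤
        if Fresh K S A x then ((4 * n ^ 2 : ℕ) : ℝ)⁻¹ * ((t + 2 * T * (rem c - 1)) * G)
        else if cc S (Function.update A c x) - cc (insert c S) (Function.update A c x) = 0 then G
        else t * G := by
      intro x hx
      set A1 := Function.update A c x with hA1
      have hag : ∀ b ∈ S, A1 b = A b := fun b hb =>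
        Function.update_of_ne (by rintro rfl; exact hcS hb) _ _
      have hA1c : A1 c = x := by simp [hA1]
      have hfr : Fresh K S A1 (A1 c) ↔ Fresh K S A x := by
        rw [hA1c]; exact forall₂_congr fun b hb => by rw [hag b hb]
      obtain ⟨ih1, ih2⟩ := ih (insert c S) A1 hsw' (distinctOn_update hA hcS hx)
        (by rw [Finset.card_insert_of_notMem hcS]; simp at hm; omega)
        (fun c' hc' => hrem c' (by simp [hc']))
      have ht0 := ht.le
      have hnn : 0 ≤ fillSum l (insert c S) A1 (weight K t l (insert c S)) :=
        fillSum_nonneg _ (fun A' => weight_nonneg ht0 _ _ A') _ _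
      unfold stepWeight
      by_cases h1 : Fresh K S A1 (A1 c)
      · rw [if_pos h1, if_pos (hfr.1 h1)]
        rw [mul_assoc]
        refine mul_le_mul_of_nonneg_left ?_ (by positivity)
        -- At the end of the row the fresh piece has three constrained sides, one more than the two
        -- which pay for its choice. Otherwise the next cell lies to the east of a fresh piece, and
        -- the second bound is available by induction.
        rcases hlast with ⟨hr1, r, hrS, hr⟩ | ⟨c', l', rfl, hc', hrc'⟩
        · have hd := cc_add_card_le_of_fresh (by omega) h1 {0, 2, 3} (by
            intro d hd
            simp only [Finset.mem_insert, Finset.mem_singleton] at hd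
            rcases hd with rfl | rfl | rfl
            exacts [⟨r, hrS, hr⟩, ⟨a, haS, ha⟩, ⟨b, hbS, hbn⟩])
          have hcard : ({0, 2, 3} : Finset (ZMod 4)).card = 3 := by decide
          rw [hcard] at hd
          have : t ^ (cc S A1 - cc (insert c S) A1 - 2) ≤ t := by
            conv_rhs => rw [← pow_one t]
            exact pow_le_pow_of_le_one ht0 ht1 (by omega)
          rw [hr1]
          norm_num
          exact mul_le_mul this ih1 hnn ht0
        · have h4 := ih2 c' l' rfl c (by simp) hc' (by
            rw [Finset.erase_insert hcS]; exact h1)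
          have : t ^ (cc S A1 - cc (insert c S) A1 - 2) ≤ 1 := pow_le_one₀ ht0 ht1
          have e : (rem c : ℝ) - 1 = rem c' := by rw [hrc']; push_cast; ring
          rw [e]
          nlinarith [mul_nonneg ht0 hG0.le]
      · rw [if_neg h1, if_neg (fun h => h1 (hfr.2 h))]
        by_cases h3 : cc S A1 - cc (insert c S) A1 = 0
        · rw [if_pos h3, h3, pow_zero, one_mul]; exact ih1
        · rw [if_neg h3]
          have : t ^ (cc S A1 - cc (insert c S) A1) ≤ t := by
            conv_rhs => rw [← pow_one t]
            exact pow_le_pow_of_le_one ht0 ht1 (by omega)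
          exact mul_le_mul this ih1 hnn ht0
    set B : ℕ := m * (4 * (2 * K + 1) ^ 2) with hB
    set f : Tile n → ℝ := fun x => if ∃ b ∈ S, (A b).1 = x.1 then 0 else
      if Fresh K S A x then ((4 * n ^ 2 : ℕ) : ℝ)⁻¹ * ((t + 2 * T * (rem c - 1)) * G)
      else if cc S (Function.update A c x) - cc (insert c S) (Function.update A c x) = 0 then G
      else t * G with hf
    have hle : fillSum (c :: l) S A (weight K t (c :: l) S) ≤ ∑ x, f x := by
      refine hcons.trans (Finset.sum_le_sum fun x _ => ?_)
      simp only [hf]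
      split_ifs with hx
      · exact le_rfl
      all_goals have := hstep x hx
      all_goals simp_all
    have hrem0 : (0:ℝ) ≤ (rem c : ℝ) - 1 := by
      have : (1:ℝ) ≤ rem c := by exact_mod_cast hrc1
      linarith
    have hq0 : 0 ≤ (t + 2 * T * (rem c - 1)) * G := by positivity
    -- the exceptional pieces
    set Z : Finset (Tile n) := Finset.univ.filter fun x => (¬ ∃ b ∈ S, (A b).1 = x.1) ∧
      cc S (Function.update A c x) - cc (insert c S) (Function.update A c x) = 0 with hZ
    have hfle : ∀ x, f x ≤ ((4 * n ^ 2 : ℕ) : ℝ)⁻¹ * ((t + 2 * T * (rem c - 1)) * G) +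
        (if ¬ Fresh K S A x then t * G else 0) + (if x ∈ Z then G else 0) := by
      intro x
      have e1 : 0 ≤ ((4 * n ^ 2 : ℕ) : ℝ)⁻¹ * ((t + 2 * T * (rem c - 1)) * G) := by positivity
      have e2 : 0 ≤ t * G := by positivity
      have hxZ : x ∈ Z ↔ (¬ ∃ b ∈ S, (A b).1 = x.1) ∧
        cc S (Function.update A c x) - cc (insert c S) (Function.update A c x) = 0 := by simp [hZ]
      simp only [hf, hxZ]
      convert ite_ite_le_add (P := ∃ b ∈ S, (A b).1 = x.1) (F := Fresh K S A x)
        (Z := cc S (Function.update A c x) - cc (insert c S) (Function.update A c x) = 0)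
        e1 e2 hG0.le
    have hsum : ∑ x, f x ≤ (t + 2 * T * (rem c - 1)) * G + B * (t * G) + Z.card * G := by
      refine (Finset.sum_le_sum fun x _ => hfle x).trans ?_
      rw [Finset.sum_add_distrib, Finset.sum_add_distrib, Finset.sum_const, ← Finset.sum_filter,
        Finset.sum_const, ← Finset.sum_filter, Finset.sum_const]
      have hcard : (Finset.univ : Finset (Tile n)).card = 4 * n ^ 2 := by
        simp [Finset.card_univ, Fintype.card_prod, ZMod.card]; ring
      have hZ' : (Finset.univ.filter fun x => x ∈ Z) = Z := by ext; simp
      rw [hcard, hZ', nsmul_eq_mul, nsmul_eq_mul, nsmul_eq_mul, ← mul_assoc,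
        mul_inv_cancel₀ hN.ne', one_mul]
      gcongr
      refine (card_not_fresh_le K S A).trans ?_
      rw [hB]
      gcongr
      simp at hm; omega
    have hlen : (1 + δ) ^ (c :: l).length = (1 + δ) * G := by
      rw [List.length_cons, pow_succ, hG]; ring
    have hB' : ((B:ℝ) + 1) * t ≤ T := by rw [hB]; exact hT
    have hremw : (rem c : ℝ) ≤ w := by exact_mod_cast hrcw
    rw [hlen]
    constructor
    · have hZ1 : (Z.card : ℝ) ≤ 1 := by
        have : Z.card ≤ 1 := by
          refine Finset.card_le_one.2 fun x hx y hy => ?_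
          simp only [hZ, Finset.mem_filter, Finset.mem_univ, true_and] at hx hy
          exact no_drop_unique hA hcS haS ha hx.1 hy.1 hx.2 hy.2
        exact_mod_cast this
      have key : t + 2 * T * (rem c - 1) + B * t + Z.card ≤ 1 + δ := by
        have : 2 * T * ((rem c : ℝ) - 1) ≤ 2 * T * w := by
          refine mul_le_mul_of_nonneg_left ?_ (by positivity)
          linarith
        linarith
      calc _ ≤ _ := hle.trans hsum
        _ = (t + 2 * T * (rem c - 1) + B * t + Z.card) * G := by ring
        _ ≤ _ := mul_le_mul_of_nonneg_right key hG0.le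
    · intro c0 l0 h0 a0 ha0 hna0 hfr0
      obtain ⟨rfl, rfl⟩ := List.cons.inj h0
      -- To the east of a fresh piece there is no placement free of charge.
      have hZ0 : Z = ∅ := by
        refine Finset.filter_eq_empty_iff.2 ?_
        rintro x - ⟨h1, h2⟩
        exact drop_after_fresh hK hcS ha0 hbS hna0 hbn hfr0 h1 h2
      rw [hZ0, Finset.card_empty, Nat.cast_zero, zero_mul, add_zero] at hsum
      -- The terms `t` and `B * t` together are at most `T`, so they are absorbed when the number of
      -- remaining cells rises from `rem c - 1` to `rem c`.
      have key : t + 2 * T * (rem c - 1) + B * t ≤ 2 * T * rem c := by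
        linarith
      calc _ ≤ _ := hle.trans hsum
        _ = (t + 2 * T * (rem c - 1) + B * t) * G := by ring
        _ ≤ 2 * T * rem c * G := mul_le_mul_of_nonneg_right key hG0.le
        _ ≤ 2 * T * rem c * ((1 + δ) * G) := by
          refine mul_le_mul_of_nonneg_left ?_ (by positivity)
          nlinarith

end Fillings
-- Weights in closed form
section Weights

variable {n : ℕ}

open Classical in
/-- The cells of `l` which receive a fresh piece. -/
noncomputable def freshCells (K : ℕ) : List (Cell n) → Finset (Cell n) → (Cell n → Tile n) →
    Finset (Cell n)
  | [], _, _ => ∅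
  | c :: l, S, A => (if Fresh K S A (A c) then {c} else ∅) ∪ freshCells K l (insert c S) A

open Classical in
lemma freshCells_subset (K : ℕ) (A : Cell n → Tile n) : ∀ (l : List (Cell n)) (S : Finset (Cell n)),
    freshCells K l S A ⊆ l.toFinset := by
  intro l
  induction l with
  | nil => intro S; simp [freshCells]
  | cons c l ih =>
    intro S x hx
    rw [freshCells, Finset.mem_union] at hx
    rcases hx with hx | hx
    · split_ifs at hx
      · simp at hx; simp [hx]
      · simp at hx
    · have := ih _ hx
      simp at this
      simp [this]

lemma Far.symm {K : ℕ} {u v : ℤ × ℤ} (h : Far K u v) : Far K v u := by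
  unfold Far at *
  rw [abs_sub_comm v.1, abs_sub_comm v.2]; exact h

open Classical in
lemma fresh_of_mem_freshCells {K : ℕ} {A : Cell n → Tile n} : ∀ (l : List (Cell n))
    (S : Finset (Cell n)), ∀ c ∈ freshCells K l S A, Fresh K S A (A c) ∧
      ∀ c' ∈ freshCells K l S A, c ≠ c' → Far K (co (A c).1) (co (A c').1) := by
  intro l
  induction l with
  | nil => intro S c hc; simp [freshCells] at hc
  | cons b l ih =>
    intro S c hc
    have h1 : ∀ c ∈ freshCells K l (insert b S) A, Fresh K S A (A c) := fun c hc x hx =>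
      (ih _ c hc).1 x (Finset.mem_insert_of_mem hx)
    have h2 : ∀ c ∈ freshCells K l (insert b S) A, Far K (co (A b).1) (co (A c).1) := fun c hc =>
      (ih _ c hc).1 b (Finset.mem_insert_self _ _)
    rw [freshCells, Finset.mem_union] at hc
    refine ⟨?_, fun c' hc' hne => ?_⟩
    · rcases hc with hc | hc
      · split_ifs at hc with hf
        · rw [Finset.mem_singleton] at hc; rw [hc]; exact hf
        · simp at hc
      · exact h1 c hc
    · rw [freshCells, Finset.mem_union] at hc'
      rcases hc with hc | hc <;> rcases hc' with hc' | hc'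
      · split_ifs at hc hc' with hf
        · rw [Finset.mem_singleton] at hc hc'; exact absurd (hc.trans hc'.symm) hne
        · simp at hc
      · split_ifs at hc with hf
        · rw [Finset.mem_singleton] at hc; rw [hc]; exact h2 c' hc'
        · simp at hc
      · split_ifs at hc' with hf
        · rw [Finset.mem_singleton] at hc'; rw [hc']; exact (h2 c hc).symm
        · simp at hc'
      · exact (ih _ c hc).2 c' hc' hne

open Classical in
/-- The weight of a filling of a sweep in closed form. -/
lemma weight_eq {K : ℕ} (hK : 2 ≤ K) (t : ℝ) (rem : Cell n → ℕ) (A : Cell n → Tile n) :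
    ∀ (l : List (Cell n)) (S : Finset (Cell n)), IsSweep rem S l →
    2 * (freshCells K l S A).card ≤ cc S A - cc (S ∪ l.toFinset) A ∧
    weight K t l S A = ((4 * n ^ 2 : ℕ) : ℝ)⁻¹ ^ (freshCells K l S A).card *
      t ^ (cc S A - cc (S ∪ l.toFinset) A - 2 * (freshCells K l S A).card) := by
  intro l
  induction l with
  | nil => intro S _; simp [freshCells, weight]
  | cons c l ih =>
    rintro S hsw
    have hnd := hsw.nodup.1
    rw [List.nodup_cons] at hnd
    obtain ⟨hcS, ⟨b, hbS, hb⟩, ⟨a, haS, ha⟩, -, hsw'⟩ := hsw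
    obtain ⟨ih1, ih2⟩ := ih _ hsw'
    have hSl : insert c S ∪ l.toFinset = S ∪ (c :: l).toFinset := by ext y; simp
    rw [hSl] at ih1 ih2
    have m1 := cc_anti (Finset.subset_insert c S) A
    have m2 : cc (S ∪ (c :: l).toFinset) A ≤ cc (insert c S) A := by
      rw [← hSl]; exact cc_anti Finset.subset_union_left A
    rw [weight, freshCells, ih2, stepWeight]
    by_cases hf : Fresh K S A (A c)
    · have hd := cc_add_card_le_of_fresh (by omega) hf {2, 3} (by
        intro d hd
        simp only [Finset.mem_insert, Finset.mem_singleton] at hd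
        rcases hd with rfl | rfl
        exacts [⟨a, haS, ha⟩, ⟨b, hbS, hb⟩])
      have hcard : ({2, 3} : Finset (ZMod 4)).card = 2 := by decide
      rw [hcard] at hd
      have hcf : c ∉ freshCells K l (insert c S) A := fun h => hnd.1 (by
        simpa using freshCells_subset K A l _ h)
      have e : ({c} ∪ freshCells K l (insert c S) A).card =
          (freshCells K l (insert c S) A).card + 1 := by
        rw [← Finset.insert_eq, Finset.card_insert_of_notMem hcf]
      rw [if_pos hf, if_pos hf, e]
      refine ⟨by omega, ?_⟩
      rw [pow_succ]
      rw [show cc S A - cc (S ∪ (c :: l).toFinset) A - 2 * ((freshCells K l (insert c S) A).card + 1)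
        = (cc S A - cc (insert c S) A - 2) + (cc (insert c S) A - cc (S ∪ (c :: l).toFinset) A
          - 2 * (freshCells K l (insert c S) A).card) by omega, pow_add]
      ring
    · rw [if_neg hf, if_neg hf, Finset.empty_union]
      refine ⟨by omega, ?_⟩
      rw [show cc S A - cc (S ∪ (c :: l).toFinset) A - 2 * (freshCells K l (insert c S) A).card
        = (cc S A - cc (insert c S) A) + (cc (insert c S) A - cc (S ∪ (c :: l).toFinset) A
          - 2 * (freshCells K l (insert c S) A).card) by omega, pow_add]
      ring

/-- Two constraints pay for the `N` choices of each of the `f` fresh pieces and leave `β ^ 2`; each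
other constraint pays `t` and leaves `γ`. With `γ = β` every constraint gains the same factor, which
bounds defects; with `β = 1` the whole gain sits on the surplus constraints, which bounds deviating
pieces. -/
lemma pow_le_of_split {N κ t γ β : ℝ} (hN : 0 < N) (hκ : 0 < κ)
    (h1 : κ⁻¹ ^ 2 ≤ N⁻¹ * β ^ 2) (h2 : κ⁻¹ ≤ t * γ) {f r : ℕ} (hf : 2 * f ≤ r) :
    κ⁻¹ ^ r ≤ N⁻¹ ^ f * t ^ (r - 2 * f) * (β ^ (2 * f) * γ ^ (r - 2 * f)) := by
  have hi : 0 ≤ κ⁻¹ := by positivity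
  calc κ⁻¹ ^ r = (κ⁻¹ ^ 2) ^ f * κ⁻¹ ^ (r - 2 * f) := by
        rw [← pow_mul, ← pow_add]; congr 1; omega
    _ ≤ (N⁻¹ * β ^ 2) ^ f * (t * γ) ^ (r - 2 * f) := by gcongr
    _ = _ := by rw [mul_pow, mul_pow, ← pow_mul]; ring

end Weights

/-! ### Row by row sweeps of rectangles -/

section Rectangles

variable {n : ℕ} [NeZero n]

/-- The cell with the given coordinates. -/
def cell (n : ℕ) [NeZero n] (x y : ℕ) : Cell n := (Fin.ofNat n x, Fin.ofNat n y)

lemma cell_fst {x y : ℕ} (hx : x < n) : ((cell n x y).1 : ℕ) = x := Nat.mod_eq_of_lt hx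
lemma cell_snd {x y : ℕ} (hy : y < n) : ((cell n x y).2 : ℕ) = y := Nat.mod_eq_of_lt hy

lemma cell_eta (c : Cell n) : cell n c.1 c.2 = c := by
  refine Prod.ext (Fin.ext ?_) (Fin.ext ?_)
  · exact cell_fst c.1.isLt
  · exact cell_snd c.2.isLt

lemma co_cell {x y : ℕ} (hx : x < n) (hy : y < n) : co (cell n x y) = ((x : ℤ), (y : ℤ)) := by
  rw [co, cell_fst hx, cell_snd hy]

lemma neighbor_east {x y : ℕ} (hx : x + 1 < n) (hy : y < n) :
    IsNeighbor (cell n x y) 0 (cell n (x + 1) y) := by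
  rw [isNeighbor_iff, co_cell hx hy, co_cell (by omega) hy, step_zero]; simp

lemma neighbor_north {x y : ℕ} (hx : x < n) (hy : y + 1 < n) :
    IsNeighbor (cell n x y) 1 (cell n x (y + 1)) := by
  rw [isNeighbor_iff, co_cell hx hy, co_cell hx (by omega), step_one]; simp

lemma neighbor_west {x y : ℕ} (hx : x + 1 < n) (hy : y < n) :
    IsNeighbor (cell n (x + 1) y) 2 (cell n x y) := (neighbor_east hx hy).symm

lemma neighbor_south {x y : ℕ} (hx : x < n) (hy : y + 1 < n) :
    IsNeighbor (cell n x (y + 1)) 3 (cell n x y) := (neighbor_north hx hy).symm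

/-- The cells `(x, y), ..., (x + k - 1, y)`. -/
def rowList (n : ℕ) [NeZero n] (x k y : ℕ) : List (Cell n) :=
  (List.range' x k).map fun x' => cell n x' y

/-- The order of the sweep: rows from bottom to top, each from west to east. -/
def blockList (n : ℕ) [NeZero n] (x k y m : ℕ) : List (Cell n) :=
  (List.range' y m).flatMap fun y' => rowList n x k y'

lemma mem_rowList {x k y : ℕ} (hx : x + k ≤ n) (hy : y < n) {c : Cell n} :
    c ∈ rowList n x k y ↔ x ≤ c.1 ∧ (c.1 : ℕ) < x + k ∧ (c.2 : ℕ) = y := by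
  simp only [rowList, List.mem_map, List.mem_range'_1]
  constructor
  · rintro ⟨x', h, rfl⟩
    rw [cell_fst (by omega), cell_snd hy]; omega
  · rintro ⟨h1, h2, rfl⟩
    exact ⟨c.1, ⟨h1, h2⟩, cell_eta c⟩

lemma mem_blockList {x k y m : ℕ} (hx : x + k ≤ n) (hy : y + m ≤ n) {c : Cell n} :
    c ∈ blockList n x k y m ↔ x ≤ c.1 ∧ (c.1 : ℕ) < x + k ∧ y ≤ c.2 ∧ (c.2 : ℕ) < y + m := by
  simp only [blockList, List.mem_flatMap, List.mem_range'_1]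
  constructor
  · rintro ⟨y', h, h'⟩
    rw [mem_rowList hx (by omega)] at h'; omega
  · rintro ⟨h1, h2, h3, h4⟩
    exact ⟨c.2, ⟨h3, h4⟩, (mem_rowList hx (by omega)).2 ⟨h1, h2, rfl⟩⟩

lemma length_blockList (x k y m : ℕ) : (blockList n x k y m).length = m * k := by
  simp [blockList, rowList, List.length_flatMap]

open Classical in
lemma isSweep_row {x2 y : ℕ} (hx2 : x2 < n) (hy : y + 1 < n) (rest : List (Cell n)) : ∀ (k x : ℕ)
    (S : Finset (Cell n)), x + 1 + k = x2 →
    (∀ x', x < x' → x' < x2 → cell n x' (y + 1) ∉ S ∧ cell n x' y ∈ S) →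
    cell n x (y + 1) ∈ S → cell n x2 (y + 1) ∈ S →
    IsSweep (fun c => x2 - c.1) (S ∪ (rowList n (x + 1) k (y + 1)).toFinset) rest →
    IsSweep (fun c => x2 - c.1) S (rowList n (x + 1) k (y + 1) ++ rest) := by
  intro k
  induction k with
  | zero => intro x S _ _ _ _ h; simpa [rowList] using h
  | succ k ih =>
    intro x S hk h1 h2 h3 h4
    have e : rowList n (x + 1) (k + 1) (y + 1) = cell n (x + 1) (y + 1) ::
        rowList n (x + 1 + 1) k (y + 1) := by
      simp [rowList, List.range'_succ]
    rw [e] at h4 ⊢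
    have hcS := h1 (x + 1) (by omega) (by omega)
    refine ⟨hcS.1, ⟨_, hcS.2, neighbor_south (by omega) hy⟩, ⟨_, h2, neighbor_west (by omega) hy⟩,
      ?_, ?_⟩
    · rcases Nat.eq_zero_or_pos k with rfl | hk0
      · left
        refine ⟨by show x2 - ((cell n (x + 1) (y + 1)).1 : ℕ) = 1; rw [cell_fst (by omega)]; omega, _, h3, ?_⟩
        rw [← hk]
        exact neighbor_east (by omega) hy
      · right
        obtain ⟨k, rfl⟩ : ∃ k', k = k' + 1 := ⟨k - 1, by omega⟩
        refine ⟨cell n (x + 1 + 1) (y + 1), rowList n (x + 1 + 1 + 1) k (y + 1) ++ rest, ?_,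
          neighbor_west (by omega) hy, ?_⟩
        · simp [rowList, List.range'_succ]
        · show x2 - ((cell n (x + 1) (y + 1)).1 : ℕ) = x2 - ((cell n (x + 1 + 1) (y + 1)).1 : ℕ) + 1
          rw [cell_fst (by omega), cell_fst (by omega)]; omega
    · refine ih (x + 1) _ (by omega) ?_ (Finset.mem_insert_self _ _)
        (Finset.mem_insert_of_mem h3) ?_
      · intro x' hx' hx2'
        obtain ⟨g1, g2⟩ := h1 x' (by omega) hx2'
        refine ⟨?_, Finset.mem_insert_of_mem g2⟩
        rw [Finset.mem_insert, not_or]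
        refine ⟨fun h => ?_, g1⟩
        have : ((cell n x' (y + 1)).1 : ℕ) = ((cell n (x + 1) (y + 1)).1 : ℕ) := by rw [h]
        rw [cell_fst (by omega), cell_fst (by omega)] at this
        omega
      · have e2 : insert (cell n (x + 1) (y + 1)) S ∪ (rowList n (x + 1 + 1) k (y + 1)).toFinset =
            S ∪ (cell n (x + 1) (y + 1) :: rowList n (x + 1 + 1) k (y + 1)).toFinset := by
          ext c; simp
        rwa [e2]

-- Three filled walls suffice: row `y` below and the columns `x1` and `x2`. The eastern wall
-- supplies the third constraint at the end of each row.
open Classical in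
lemma isSweep_block {x1 x2 : ℕ} (hx2 : x2 < n) (hx : x1 < x2) : ∀ (m y : ℕ)
    (S : Finset (Cell n)), y + m < n →
    (∀ x' y', x1 < x' → x' < x2 → y < y' → y' ≤ y + m → cell n x' y' ∉ S) →
    (∀ x', x1 < x' → x' < x2 → cell n x' y ∈ S) →
    (∀ y', y < y' → y' ≤ y + m → cell n x1 y' ∈ S ∧ cell n x2 y' ∈ S) →
    IsSweep (fun c => x2 - c.1) S (blockList n (x1 + 1) (x2 - x1 - 1) (y + 1) m) := by
  intro m
  induction m with
  | zero => intro y S _ _ _ _; simp [blockList, IsSweep]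
  | succ m ih =>
    intro y S hy h1 h2 h3
    have e : blockList n (x1 + 1) (x2 - x1 - 1) (y + 1) (m + 1) =
        rowList n (x1 + 1) (x2 - x1 - 1) (y + 1) ++
          blockList n (x1 + 1) (x2 - x1 - 1) (y + 1 + 1) m := by
      simp [blockList, List.range'_succ]
    rw [e]
    refine isSweep_row hx2 (by omega) _ _ _ _ (by omega) (fun x' g1 g2 => ⟨h1 x' _ g1 g2 (by omega)
      (by omega), h2 x' g1 g2⟩) (h3 _ (by omega) (by omega)).1 (h3 _ (by omega) (by omega)).2 ?_
    have hmem : ∀ {c : Cell n}, c ∈ rowList n (x1 + 1) (x2 - x1 - 1) (y + 1) ↔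
        x1 + 1 ≤ c.1 ∧ (c.1 : ℕ) < x1 + 1 + (x2 - x1 - 1) ∧ (c.2 : ℕ) = y + 1 :=
      mem_rowList (by omega) (by omega)
    refine ih (y + 1) _ (by omega) ?_ ?_ ?_
    · intro x' y' g1 g2 g3 g4
      rw [Finset.mem_union, not_or]
      refine ⟨h1 x' y' g1 g2 (by omega) (by omega), ?_⟩
      rw [List.mem_toFinset, hmem, cell_snd (by omega)]
      omega
    · intro x' g1 g2
      rw [Finset.mem_union, List.mem_toFinset, hmem, cell_fst (by omega), cell_snd (by omega)]
      omega
    · intro y' g1 g2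
      obtain ⟨k1, k2⟩ := h3 y' (by omega) (by omega)
      exact ⟨Finset.mem_union_left _ k1, Finset.mem_union_left _ k2⟩

end Rectangles

/-! ### Filling the frame of a window, and counting defects -/

section Trees

variable {n : ℕ}

open Classical in
/-- Each cell of the list is adjacent, in the direction `par`, to an earlier cell or to `S`. -/
def IsTree (par : Cell n → ZMod 4) : Finset (Cell n) → List (Cell n) → Prop
  | _, [] => True
  | S, c :: l => c ∉ S ∧ (∃ b ∈ S, IsNeighbor c (par c) b) ∧ IsTree par (insert c S) l

/-- The piece at `c` is next to the same piece as in the planted assembly, in direction `par c`. -/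
def Linked (par : Cell n → ZMod 4) (A : Cell n → Tile n) (c : Cell n) : Prop :=
  ∃ b, IsNeighbor c (par c) b ∧ mid (side (A c) (par c)) = mid (side (A b) (par c + 2))

open Classical in
noncomputable def unlinked (par : Cell n → ZMod 4) (l : List (Cell n)) (A : Cell n → Tile n) : ℕ :=
  l.countP fun c => ¬ Linked par A c

open Classical in
lemma unlinked_cons (par : Cell n → ZMod 4) (c : Cell n) (l : List (Cell n)) (A : Cell n → Tile n) :
    unlinked par (c :: l) A = unlinked par l A + if Linked par A c then 0 else 1 := by
  rw [unlinked, unlinked, List.countP_cons]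
  by_cases h : Linked par A c <;> simp [h]

open Classical in
lemma IsTree.nodup {par : Cell n → ZMod 4} : ∀ {l : List (Cell n)} {S : Finset (Cell n)},
    IsTree par S l → l.Nodup ∧ ∀ c ∈ l, c ∉ S := by
  intro l
  induction l with
  | nil => intro S _; simp
  | cons c l ih =>
    rintro S ⟨h1, -, h2⟩
    obtain ⟨h3, h4⟩ := ih h2
    refine ⟨List.nodup_cons.2 ⟨fun h => h4 c h (by simp), h3⟩, ?_⟩
    intro b hb
    rcases List.mem_cons.1 hb with rfl | hb
    · exact h1
    · exact fun h => h4 b hb (by simp [h])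

open Classical in
lemma IsTree.exists_neighbor {par : Cell n → ZMod 4} : ∀ {l : List (Cell n)} {S : Finset (Cell n)},
    IsTree par S l → ∀ c ∈ l, ∃ b ∈ S ∪ l.toFinset, IsNeighbor c (par c) b := by
  intro l
  induction l with
  | nil => intro S _; simp
  | cons c l ih =>
    rintro S ⟨-, ⟨b, hb, hn⟩, h2⟩ c' hc'
    rcases List.mem_cons.1 hc' with rfl | hc'
    · exact ⟨b, by simp [hb], hn⟩
    · obtain ⟨b', hb', hn'⟩ := ih h2 c' hc'
      refine ⟨b', ?_, hn'⟩
      simp only [Finset.mem_union, Finset.mem_insert, List.mem_toFinset, List.mem_cons] at hb' ⊢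
      tauto

lemma linked_congr {par : Cell n → ZMod 4} {A A' : Cell n → Tile n} {c b : Cell n}
    (hb : IsNeighbor c (par c) b) (h1 : A c = A' c) (h2 : A b = A' b) :
    Linked par A c ↔ Linked par A' c := by
  constructor
  · rintro ⟨b', hb', h⟩
    obtain rfl := hb.unique hb'
    exact ⟨b, hb, by rw [← h1, ← h2]; exact h⟩
  · rintro ⟨b', hb', h⟩
    obtain rfl := hb.unique hb'
    exact ⟨b, hb, by rw [h1, h2]; exact h⟩

lemma unlinked_congr {par : Cell n → ZMod 4} {A A' : Cell n → Tile n} {l : List (Cell n)}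
    (h : ∀ c ∈ l, (Linked par A c ↔ Linked par A' c)) : unlinked par l A = unlinked par l A' := by
  classical
  unfold unlinked
  exact List.countP_congr fun c hc => by simp [h c hc]

open Classical in
/-- At most one unused piece is linked to the piece at a given neighbour. -/
lemma card_linked_le_one {S : Finset (Cell n)} {A : Cell n → Tile n} {par : Cell n → ZMod 4}
    {c b : Cell n} (hc : c ∉ S) (hb : b ∈ S) (hn : IsNeighbor c (par c) b) :
    (Finset.univ.filter fun x : Tile n => (¬ ∃ b ∈ S, (A b).1 = x.1) ∧
      Linked par (Function.update A c x) c).card ≤ 1 := by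
  rw [Finset.card_le_one]
  have hbc : b ≠ c := by rintro rfl; exact hc hb
  have key : ∀ {x : Tile n}, Linked par (Function.update A c x) c →
      mid (side (A b) (par c + 2)) = mid (side x (par c)) := by
    rintro x ⟨b', hb', h⟩
    obtain rfl := hn.unique hb'
    rw [Function.update_self, Function.update_of_ne hbc] at h
    exact h.symm
  intro x hx y hy
  simp only [Finset.mem_filter, Finset.mem_univ, true_and] at hx hy
  have hne : ∀ {x : Tile n}, (¬ ∃ b ∈ S, (A b).1 = x.1) →
      side (A b) (par c + 2) ≠ side x (par c) := fun h e =>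
    h ⟨b, hb, by simpa using congrArg Prod.fst e⟩
  rcases mid_fiber (key hx.2) (key hy.2) with h | h | h
  · exact absurd h (hne hx.1)
  · exact side_injective _ h
  · exact absurd h (hne hy.1)

-- At each cell, at most one unused piece continues the planted neighbourhood of the preceding piece
-- and contributes `1`. Each of the at most `4 * n ^ 2` others contributes `s`.
open Classical in
lemma fillSum_pow_unlinked_le {par : Cell n → ZMod 4} {s : ℝ} (hs : 0 ≤ s) (l : List (Cell n)) :
    ∀ (S : Finset (Cell n)) (A : Cell n → Tile n), IsTree par S l → DistinctOn S A →
    fillSum l S A (fun A' => s ^ unlinked par l A') ≤ (1 + 4 * n ^ 2 * s) ^ l.length := by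
  induction l with
  | nil => intro S A _ _; simp [fillSum, unlinked]
  | cons c l ih =>
    intro S A htr hA
    obtain ⟨hcS, ⟨b, hbS, hn⟩, htl⟩ := htr
    obtain ⟨hnd, hdis⟩ := htl.nodup
    have hcl : c ∉ l := fun h => hdis c h (by simp)
    have hbc : b ≠ c := by rintro rfl; exact hcS hbS
    have hbl : b ∉ l := fun h => hdis b h (by simp [hbS])
    set B : ℝ := (1 + 4 * n ^ 2 * s) ^ l.length with hB
    have hB0 : 0 ≤ B := by positivity
    have hterm : ∀ x : Tile n, (if ∃ b ∈ S, (A b).1 = x.1 then 0 else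
        fillSum l (insert c S) (Function.update A c x) fun A' => s ^ unlinked par (c :: l) A') ≤
        B * ((if (¬ ∃ b ∈ S, (A b).1 = x.1) ∧ Linked par (Function.update A c x) c then 1 else 0)
          + s) := by
      intro x
      by_cases hx : ∃ b ∈ S, (A b).1 = x.1
      · rw [if_pos hx, if_neg (fun h => h.1 hx)]; positivity
      rw [if_neg hx]
      have hA' := distinctOn_update hA hcS hx
      have hle : fillSum l (insert c S) (Function.update A c x)
          (fun A' => s ^ unlinked par (c :: l) A') ≤ fillSum l (insert c S) (Function.update A c x)
          (fun A' => (s ^ if Linked par (Function.update A c x) c then 0 else 1) *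
            s ^ unlinked par l A') := by
        refine fillSum_mono l _ _ hnd hdis hA' fun A' hA1 _ => ?_
        have : Linked par A' c ↔ Linked par (Function.update A c x) c :=
          linked_congr hn (hA1 c hcl) (hA1 b hbl)
        rw [unlinked_cons, pow_add, mul_comm]
        simp only [this]
        exact le_rfl
      refine hle.trans ?_
      rw [fillSum_const_mul]
      have h2 := ih _ _ htl hA'
      have h3 : (s ^ if Linked par (Function.update A c x) c then 0 else 1) ≤
          (if (¬ ∃ b ∈ S, (A b).1 = x.1) ∧ Linked par (Function.update A c x) c then 1 else 0)
            + s := by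
        by_cases hL : Linked par (Function.update A c x) c
        · rw [if_pos hL, if_pos ⟨hx, hL⟩]; simpa using hs
        · rw [if_neg hL, if_neg (fun h => hL h.2)]; simp
      rw [mul_comm B]
      refine mul_le_mul h3 h2 (fillSum_nonneg l (fun _ => by positivity) _ _) ?_
      split_ifs <;> positivity
    rw [fillSum]
    refine (Finset.sum_le_sum fun x _ => hterm x).trans ?_
    rw [← Finset.mul_sum, Finset.sum_add_distrib, Finset.sum_boole, List.length_cons, pow_succ,
      ← hB]
    refine mul_le_mul_of_nonneg_left ?_ hB0
    have h1 := card_linked_le_one (A := A) hcS hbS hn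
    have h2 : ((Finset.univ.filter fun x : Tile n => (¬ ∃ b ∈ S, (A b).1 = x.1) ∧
      Linked par (Function.update A c x) c).card : ℝ) ≤ 1 := by exact_mod_cast h1
    rw [Finset.sum_const, Finset.card_univ]
    simp only [Fintype.card_prod, Fintype.card_fin, ZMod.card, nsmul_eq_mul]
    push_cast
    nlinarith [h2]

/-- The adjacencies in `S` where the pieces are not neighbours in the planted assembly. -/
noncomputable def defects (S : Finset (Cell n)) (A : Cell n → Tile n) : Finset (Adjacency n) :=
  (adjs S).filter fun e => mid (src A e) ≠ mid (tgt A e)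

lemma mem_defects {S : Finset (Cell n)} {A : Cell n → Tile n} {e : Adjacency n} :
    e ∈ defects S A ↔ e ∈ adjs S ∧ mid (src A e) ≠ mid (tgt A e) := by
  simp [defects]

lemma defects_mono {S S' : Finset (Cell n)} (h : S ⊆ S') (A : Cell n → Tile n) :
    defects S A ⊆ defects S' A := Finset.filter_subset_filter _ (adjs_mono h)

/-- An adjacency of planted neighbours identifies nothing new, and any other merges at most two
classes. -/
lemma rank_le_card_defects (S : Finset (Cell n)) (A : Cell n → Tile n) :
    rank S A ≤ (defects S A).card := by
  have h := card_join_empty_le (adjs S) A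
  have h1 : cc ∅ A = Nat.card (Quotient (join ∅ A)) := by
    have : adjs (∅ : Finset (Cell n)) = ∅ := by ext e; simp [mem_adjs]
    rw [cc, rel, this]
  rw [rank, h1]
  have h2 : cc S A = Nat.card (Quotient (join (adjs S) A)) := rfl
  rw [h2, defects]
  omega

/-- The edge at the source of a defect is related to another edge, and there are at most `2 * rank`
such edges. An edge has two sides, so it is the source of at most two defects. -/
lemma card_defects_le_rank {S : Finset (Cell n)} {A : Cell n → Tile n} (hA : DistinctOn S A) :
    (defects S A).card ≤ 4 * rank S A := by
  classical
  have h1 := card_touched_le S A ((defects S A).image fun e => mid (src A e)) (by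
    intro m hm
    obtain ⟨e, he, rfl⟩ := Finset.mem_image.1 hm
    obtain ⟨h1, h2⟩ := mem_defects.1 he
    exact ⟨src A e, tgt A e, rfl, h2.symm, join_of_mem h1⟩)
  have hinj : ∀ e ∈ defects S A, ∀ e' ∈ defects S A, src A e = src A e' → e = e' := by
    intro e he e' he' h
    obtain ⟨a1, a2, a3, a4⟩ := mem_adjs.1 (mem_defects.1 he).1
    obtain ⟨b1, b2, b3, b4⟩ := mem_adjs.1 (mem_defects.1 he').1
    have k1 : e.1 = e'.1 := hA a1 b1 (by simpa [src] using congrArg Prod.fst h)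
    have k2 : e.2.1 = e'.2.1 := by
      rw [src, src, k1] at h; exact side_inj_dir _ h
    rw [k1, k2] at a4
    exact Prod.ext k1 (Prod.ext k2 (a4.unique b4))
  have h2 : (defects S A).card ≤ 2 * ((defects S A).image fun e => mid (src A e)).card := by
    refine Finset.card_le_mul_card_image _ 2 fun m _ => ?_
    by_contra! hlt
    obtain ⟨a, b, c, ha, hb, hc, hab, hac, hbc⟩ := Finset.two_lt_card_iff.1 hlt
    rw [Finset.mem_filter] at ha hb hc
    rcases mid_fiber (ha.2.trans hb.2.symm) (ha.2.trans hc.2.symm) with h | h | h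
    · exact hab (hinj _ ha.1 _ hb.1 h)
    · exact hbc (hinj _ hb.1 _ hc.1 h)
    · exact hac (hinj _ ha.1 _ hc.1 h)
  omega

-- An unlinked cell makes a defect with its parent, and this defect is not present before the cell
-- is filled.
open Classical in
lemma unlinked_add_card_defects_le {par : Cell n → ZMod 4} (A : Cell n → Tile n)
    (l : List (Cell n)) : ∀ S : Finset (Cell n), IsTree par S l →
    unlinked par l A + (defects S A).card ≤ (defects (S ∪ l.toFinset) A).card := by
  induction l with
  | nil => intro S _; simp [unlinked]
  | cons c l ih =>
    rintro S ⟨hcS, ⟨b, hbS, hn⟩, htl⟩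
    have h1 := ih _ htl
    have hSl : insert c S ∪ l.toFinset = S ∪ (c :: l).toFinset := by ext y; simp
    rw [hSl] at h1
    rw [unlinked_cons]
    have h2 : (if Linked par A c then 0 else 1) + (defects S A).card ≤
        (defects (insert c S) A).card := by
      split_ifs with hL
      · rw [zero_add]; exact Finset.card_le_card (defects_mono (Finset.subset_insert c S) A)
      · rw [add_comm]
        refine Finset.card_lt_card ((Finset.ssubset_iff_of_subset
          (defects_mono (Finset.subset_insert c S) A)).2 ?_)
        have hne : mid (side (A c) (par c)) ≠ mid (side (A b) (par c + 2)) := fun h => hL ⟨b, hn, h⟩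
        have key : (par c = 0 ∨ par c = 1) ∨ (par c + 2 = 0 ∨ par c + 2 = 1) := by
          generalize par c = d; revert d; decide
        rcases key with hd | hd
        · refine ⟨(c, par c, b), mem_defects.2 ⟨mem_adjs.2 ⟨by simp, by simp [hbS], hd, hn⟩, hne⟩,
            fun h => hcS (mem_adjs.1 (mem_defects.1 h).1).1⟩
        · refine ⟨(b, par c + 2, c), mem_defects.2 ⟨mem_adjs.2 ⟨by simp [hbS], by simp, hd,
            hn.symm⟩, ?_⟩, fun h => hcS (mem_adjs.1 (mem_defects.1 h).1).2.1⟩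
          simp only [src, tgt, add_two_add_two]
          exact hne.symm
    omega

end Trees

/-! ### First moment bound for a frame followed by a sweep -/

section Window

variable {n q : ℕ} {ι : Fin q → Fin q}

open Classical in
/-- Union bound over the fillings of a frame followed by a sweep, with many independent constraints
within the sweep. -/
lemma prob_sweep_le (hι : Function.Involutive ι) {κ : ℝ} (hκ : 1 ≤ κ) (hq : κ ≤ q)
    {K : ℕ} (hK : 2 ≤ K) {t T δ β : ℝ} (ht : 0 < t) (ht1 : t ≤ 1) {m w : ℕ}
    (hT : ((m * (4 * (2 * K + 1) ^ 2) : ℕ) + 1 : ℝ) * t ≤ T) (hδ : T + 2 * T * w ≤ δ)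
    (hβ0 : 0 ≤ β) (hβ1 : β ≤ 1)
    (hκN : κ⁻¹ ^ 2 ≤ ((4 * n ^ 2 : ℕ) : ℝ)⁻¹ * β ^ 2) (hκt : κ⁻¹ ≤ t * β)
    {rem : Cell n → ℕ} {par : Cell n → ZMod 4} {c₀ : Cell n} {rest l : List (Cell n)}
    (htree : IsTree par {c₀} rest) (hsweep : IsSweep rem (c₀ :: rest).toFinset l)
    (hm : (c₀ :: rest).length + l.length ≤ m) (hrem : ∀ c ∈ l, 1 ≤ rem c ∧ rem c ≤ w)
    (lam : ℕ) (A₀ : Cell n → Tile n) :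
    prob (fun ω : Carving n ι => ∃ A', (∀ c, c ∉ c₀ :: rest ++ l → A' c = A₀ c) ∧
      DistinctOn ((c₀ :: rest ++ l).toFinset) A' ∧ FitsOn ((c₀ :: rest ++ l).toFinset) A' ω ∧
      lam * (unlinked par rest A' + 1) ≤
        cc (c₀ :: rest).toFinset A' - cc ((c₀ :: rest ++ l).toFinset) A') ≤
      4 * n ^ 2 * β ^ lam * (1 + δ) ^ m * (1 + 4 * n ^ 2 * β ^ lam) ^ m := by
  set s : ℝ := β ^ lam with hs
  have hN : (0:ℝ) < ((4 * n ^ 2 : ℕ) : ℝ) := by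
    have := c₀.1.pos
    positivity
  have hs0 : 0 ≤ s := by positivity
  obtain ⟨hnd, hdis⟩ := htree.nodup
  obtain ⟨hnl, hdisl⟩ := hsweep.nodup
  set U : Finset (Cell n) := (c₀ :: rest).toFinset with hU
  have hT0 : 0 ≤ T := le_trans (by positivity) hT
  have hδ0 : 0 ≤ δ := le_trans (by positivity) hδ
  have hUe : ({c₀} : Finset (Cell n)) ∪ rest.toFinset = U := by
    ext y; simp [hU]
  have hnd1 : (c₀ :: rest).Nodup := List.nodup_cons.2 ⟨fun h => hdis c₀ h (by simp), hnd⟩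
  have hnd2 : (c₀ :: rest ++ l).Nodup := by
    refine List.Nodup.append hnd1 hnl ?_
    intro c hc hcl
    exact hdisl c hcl (by simpa [hU] using hc)
  set Q : (Cell n → Tile n) → Prop := fun A' => lam * (unlinked par rest A' + 1) ≤
    cc U A' - cc ((c₀ :: rest ++ l).toFinset) A' with hQ
  have h1 := prob_exists_filling_le (n := n) hι (by linarith) hq Q (c₀ :: rest ++ l) ∅ A₀ hnd2
    (by simp)
  simp only [Finset.empty_union] at h1
  refine h1.trans ?_
  have hUl : (c₀ :: rest ++ l).toFinset = U ∪ l.toFinset := by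
    ext y; simp [hU]
  have hlen1 : l.length ≤ m := by omega
  have hlen2 : rest.length ≤ m := by simp at hm; omega
  have hbase : (1:ℝ) ≤ 1 + δ := by linarith
  -- the sum over the sweep
  have hin : ∀ A1 : Cell n → Tile n, DistinctOn U A1 →
      fillSum l U A1 (fun A' => if Q A' then κ⁻¹ ^ rank ((c₀ :: rest ++ l).toFinset) A' else 0) ≤
      (s * (1 + δ) ^ m) * s ^ unlinked par rest A1 := by
    intro A1 hA1
    have hle : fillSum l U A1
        (fun A' => if Q A' then κ⁻¹ ^ rank ((c₀ :: rest ++ l).toFinset) A' else 0) ≤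
        fillSum l U A1 (fun A' => (s * s ^ unlinked par rest A1) * weight K t l U A') := by
      refine fillSum_mono l _ _ hnl hdisl hA1 fun A' hA' _ => ?_
      have hunl : unlinked par rest A' = unlinked par rest A1 := by
        refine unlinked_congr fun c hc => ?_
        obtain ⟨b, hb, hn⟩ := htree.exists_neighbor c hc
        rw [hUe] at hb
        have hcU : c ∈ U := by simp [hU, hc]
        exact linked_congr hn (hA' c fun h => hdisl c h hcU) (hA' b fun h => hdisl b h hb)
      split_ifs with hq'
      · obtain ⟨w1, w2⟩ := weight_eq hK t rem A' l U hsweep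
        rw [hQ] at hq'
        simp only [hUl, hunl] at hq' ⊢
        set inc := cc U A' - cc (U ∪ l.toFinset) A' with hinc
        have hrk : inc ≤ rank (U ∪ l.toFinset) A' := by
          have := cc_anti (Finset.empty_subset U) A'
          rw [rank]; omega
        have hk1 : κ⁻¹ ≤ 1 := inv_le_one_of_one_le₀ hκ
        have hk0 : 0 ≤ κ⁻¹ := by positivity
        -- Every constraint of the sweep keeps a factor `β`. By the event there are at least `lam`
        -- of them for each unlinked cell of the frame, and `lam` more.
        calc κ⁻¹ ^ rank (U ∪ l.toFinset) A' ≤ κ⁻¹ ^ inc := pow_le_pow_of_le_one hk0 hk1 hrk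
          _ ≤ ((4 * n ^ 2 : ℕ) : ℝ)⁻¹ ^ (freshCells K l U A').card *
              t ^ (inc - 2 * (freshCells K l U A').card) * (β ^ (2 * (freshCells K l U A').card) *
                β ^ (inc - 2 * (freshCells K l U A').card)) :=
              pow_le_of_split hN (by linarith) hκN hκt w1
          _ = weight K t l U A' * β ^ inc := by
              rw [w2, ← pow_add, Nat.add_sub_cancel' w1]
          _ ≤ weight K t l U A' * β ^ (lam * (unlinked par rest A1 + 1)) := by
              gcongr _ * ?_
              · exact weight_nonneg ht.le _ _ _
              · exact pow_le_pow_of_le_one hβ0 hβ1 hq'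
          _ = _ := by rw [pow_mul, pow_succ, ← hs]; ring
      · have := weight_nonneg (K := K) ht.le l U A'
        positivity
    refine hle.trans ?_
    rw [fillSum_const_mul]
    have hUc : U.card = (c₀ :: rest).length := List.toFinset_card_of_nodup hnd1
    have := (fillSum_weight_le hK ht ht1 m w hT hδ rem l U A1 hsweep hA1 (by omega) hrem).1
    calc s * s ^ unlinked par rest A1 * fillSum l U A1 (weight K t l U)
        ≤ s * s ^ unlinked par rest A1 * (1 + δ) ^ l.length := by gcongr
      _ ≤ s * s ^ unlinked par rest A1 * (1 + δ) ^ m := by gcongr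
      _ = _ := by ring
  rw [fillSum_append, Finset.empty_union]
  have hout : fillSum (c₀ :: rest) ∅ A₀ (fun A' => fillSum l U A' fun A' =>
      if Q A' then κ⁻¹ ^ rank ((c₀ :: rest ++ l).toFinset) A' else 0) ≤
      fillSum (c₀ :: rest) ∅ A₀ (fun A' => (s * (1 + δ) ^ m) * s ^ unlinked par rest A') := by
    refine fillSum_mono _ _ _ hnd1 (by simp) (by intro x hx; simp at hx) fun A' _ hA' => ?_
    rw [Finset.empty_union] at hA'
    exact hin A' hA'
  refine hout.trans ?_
  rw [fillSum_const_mul, fillSum]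
  have hx : ∀ x : Tile n, (if ∃ b ∈ (∅ : Finset (Cell n)), (A₀ b).1 = x.1 then 0 else
      fillSum rest (insert c₀ ∅) (Function.update A₀ c₀ x) fun A' => s ^ unlinked par rest A') ≤
      (1 + 4 * n ^ 2 * s) ^ m := by
    intro x
    rw [if_neg (by simp)]
    refine (fillSum_pow_unlinked_le hs0 rest _ _ htree ?_).trans ?_
    · intro a ha b hb _
      simp at ha hb
      rw [ha, hb]
    · refine pow_le_pow_right₀ ?_ hlen2
      have : 0 ≤ 4 * (n:ℝ) ^ 2 * s := by positivity
      linarith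
  -- The first piece of the frame is arbitrary. Its `4 * n ^ 2` choices are compensated by the spare
  -- factor `s`.
  have hsum := Finset.sum_le_sum fun (x : Tile n) (_ : x ∈ Finset.univ) => hx x
  rw [Finset.sum_const, Finset.card_univ] at hsum
  simp only [Fintype.card_prod, Fintype.card_fin, ZMod.card, nsmul_eq_mul] at hsum
  push_cast at hsum
  refine (mul_le_mul_of_nonneg_left hsum (by positivity)).trans (le_of_eq (by ring))

end Window

/-! ### Rectangles and their three-sided frames -/

section Rect

variable {n : ℕ}

open Classical in
lemma IsTree.append {par : Cell n → ZMod 4} {l' : List (Cell n)} : ∀ {l : List (Cell n)}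
    {S : Finset (Cell n)}, IsTree par S l → IsTree par (S ∪ l.toFinset) l' →
    IsTree par S (l ++ l') := by
  intro l
  induction l with
  | nil => intro S _ h; simpa using h
  | cons c l ih =>
    rintro S ⟨h1, h2, h3⟩ h
    refine ⟨h1, h2, ih h3 ?_⟩
    have : insert c S ∪ l.toFinset = S ∪ (c :: l).toFinset := by ext y; simp
    rwa [this]

/-- The cells with coordinates in `[x₁, x₂] × [y₁, y₂]`. -/
def rect (n x₁ x₂ y₁ y₂ : ℕ) : Finset (Cell n) :=
  Finset.univ.filter fun c => x₁ ≤ c.1 ∧ (c.1 : ℕ) ≤ x₂ ∧ y₁ ≤ c.2 ∧ (c.2 : ℕ) ≤ y₂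

/-- The left, bottom and right sides of a rectangle. -/
def cup (n x₁ x₂ y₁ y₂ : ℕ) : Finset (Cell n) :=
  (rect n x₁ x₂ y₁ y₂).filter fun c => (c.1 : ℕ) = x₁ ∨ (c.1 : ℕ) = x₂ ∨ (c.2 : ℕ) = y₁

lemma mem_rect {x₁ x₂ y₁ y₂ : ℕ} {c : Cell n} :
    c ∈ rect n x₁ x₂ y₁ y₂ ↔ x₁ ≤ c.1 ∧ (c.1 : ℕ) ≤ x₂ ∧ y₁ ≤ c.2 ∧ (c.2 : ℕ) ≤ y₂ := by
  simp [rect]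

lemma mem_cup {x₁ x₂ y₁ y₂ : ℕ} {c : Cell n} :
    c ∈ cup n x₁ x₂ y₁ y₂ ↔ (x₁ ≤ c.1 ∧ (c.1 : ℕ) ≤ x₂ ∧ y₁ ≤ c.2 ∧ (c.2 : ℕ) ≤ y₂) ∧
      ((c.1 : ℕ) = x₁ ∨ (c.1 : ℕ) = x₂ ∨ (c.2 : ℕ) = y₁) := by
  simp [cup, mem_rect]

end Rect

section Frames

variable {n : ℕ} [NeZero n]

/-- The cells `(x, y), ..., (x, y + m - 1)`. -/
def colList (n : ℕ) [NeZero n] (x y m : ℕ) : List (Cell n) :=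
  (List.range' y m).map fun y' => cell n x y'

lemma mem_colList {x y m : ℕ} (hx : x < n) (hy : y + m ≤ n) {c : Cell n} :
    c ∈ colList n x y m ↔ (c.1 : ℕ) = x ∧ y ≤ c.2 ∧ (c.2 : ℕ) < y + m := by
  simp only [colList, List.mem_map, List.mem_range'_1]
  constructor
  · rintro ⟨y', h, rfl⟩
    rw [cell_snd (by omega), cell_fst hx]; omega
  · rintro ⟨rfl, h1, h2⟩
    exact ⟨c.2, ⟨h1, h2⟩, cell_eta c⟩

open Classical in
lemma isTree_row {par : Cell n → ZMod 4} {y : ℕ} (hy : y < n) : ∀ (k x : ℕ) (S : Finset (Cell n)),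
    x + k < n → (∀ x', x < x' → x' ≤ x + k → cell n x' y ∉ S ∧ par (cell n x' y) = 2) →
    cell n x y ∈ S → IsTree par S (rowList n (x + 1) k y) := by
  intro k
  induction k with
  | zero => intro x S _ _ _; simp [rowList, IsTree]
  | succ k ih =>
    intro x S hk h1 h2
    have e : rowList n (x + 1) (k + 1) y = cell n (x + 1) y :: rowList n (x + 1 + 1) k y := by
      simp [rowList, List.range'_succ]
    rw [e]
    obtain ⟨g1, g2⟩ := h1 (x + 1) (by omega) (by omega)
    refine ⟨g1, ⟨_, h2, g2 ▸ neighbor_west (by omega) hy⟩, ih (x + 1) _ (by omega) ?_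
      (Finset.mem_insert_self _ _)⟩
    intro x' hx1 hx2
    obtain ⟨g3, g4⟩ := h1 x' (by omega) (by omega)
    refine ⟨?_, g4⟩
    rw [Finset.mem_insert, not_or]
    refine ⟨fun h => ?_, g3⟩
    have : ((cell n x' y).1 : ℕ) = ((cell n (x + 1) y).1 : ℕ) := by rw [h]
    rw [cell_fst (by omega), cell_fst (by omega)] at this
    omega

open Classical in
lemma isTree_col {par : Cell n → ZMod 4} {x : ℕ} (hx : x < n) : ∀ (m y : ℕ) (S : Finset (Cell n)),
    y + m < n → (∀ y', y < y' → y' ≤ y + m → cell n x y' ∉ S ∧ par (cell n x y') = 3) →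
    cell n x y ∈ S → IsTree par S (colList n x (y + 1) m) := by
  intro m
  induction m with
  | zero => intro y S _ _ _; simp [colList, IsTree]
  | succ m ih =>
    intro y S hk h1 h2
    have e : colList n x (y + 1) (m + 1) = cell n x (y + 1) :: colList n x (y + 1 + 1) m := by
      simp [colList, List.range'_succ]
    rw [e]
    obtain ⟨g1, g2⟩ := h1 (y + 1) (by omega) (by omega)
    refine ⟨g1, ⟨_, h2, g2 ▸ neighbor_south hx (by omega)⟩, ih (y + 1) _ (by omega) ?_
      (Finset.mem_insert_self _ _)⟩
    intro y' hy1 hy2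
    obtain ⟨g3, g4⟩ := h1 y' (by omega) (by omega)
    refine ⟨?_, g4⟩
    rw [Finset.mem_insert, not_or]
    refine ⟨fun h => ?_, g3⟩
    have : ((cell n x y').2 : ℕ) = ((cell n x (y + 1)).2 : ℕ) := by rw [h]
    rw [cell_snd (by omega), cell_snd (by omega)] at this
    omega

/-- The cells of `cup` apart from the corner `(x, y)`. -/
def cupList (n : ℕ) [NeZero n] (x k y m : ℕ) : List (Cell n) :=
  rowList n (x + 1) k y ++ (colList n x (y + 1) m ++ colList n (x + k) (y + 1) m)

open Classical in
lemma toFinset_cupList {x k y m : ℕ} (hx : x + k < n) (hy : y + m < n) :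
    (cell n x y :: cupList n x k y m).toFinset = cup n x (x + k) y (y + m) := by
  ext c
  have hc : c = cell n x y ↔ (c.1 : ℕ) = x ∧ (c.2 : ℕ) = y := by
    constructor
    · rintro rfl; exact ⟨cell_fst (by omega), cell_snd (by omega)⟩
    · rintro ⟨h1, h2⟩; rw [← cell_eta c, h1, h2]
  simp only [List.toFinset_cons, Finset.mem_insert, List.mem_toFinset, cupList, List.mem_append,
    mem_cup, mem_rowList (show x + 1 + k ≤ n by omega) (show y < n by omega),
    mem_colList (show x < n by omega) (show y + 1 + m ≤ n by omega),
    mem_colList hx (show y + 1 + m ≤ n by omega), hc]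
  omega

open Classical in
lemma toFinset_cup_block {x k y m : ℕ} (hx : x + k < n) (hy : y + m < n) :
    (cell n x y :: cupList n x k y m ++ blockList n (x + 1) (k - 1) (y + 1) m).toFinset =
      rect n x (x + k) y (y + m) := by
  ext c
  rw [List.toFinset_append, toFinset_cupList hx hy, Finset.mem_union, List.mem_toFinset, mem_cup,
    mem_rect, mem_blockList (by omega) (by omega)]
  omega

open Classical in
lemma isTree_cupList {x k y m : ℕ} (hk : 1 ≤ k) (hx : x + k < n) (hy : y + m < n) :
    IsTree (fun c => if (c.2 : ℕ) = y then 2 else 3) {cell n x y} (cupList n x k y m) := by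
  have hfst : ∀ {x' y' : ℕ}, x' < n → ((cell n x' y').1 : ℕ) = x' := fun h => cell_fst h
  refine (isTree_row (by omega) _ _ _ hx ?_ (by simp)).append
    ((isTree_col (by omega) _ _ _ hy ?_ (by simp)).append
    (isTree_col hx _ _ _ hy ?_ ?_))
  · intro x' h1 h2
    rw [Finset.mem_singleton]
    refine ⟨fun h => ?_, by rw [cell_snd (by omega), if_pos rfl]⟩
    have : ((cell n x' y).1 : ℕ) = ((cell n x y).1 : ℕ) := by rw [h]
    rw [cell_fst (by omega), cell_fst (by omega)] at this
    omega
  · intro y' h1 h2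
    have hy' : ((cell n x y').2 : ℕ) = y' := cell_snd (by omega)
    refine ⟨?_, by rw [hy', if_neg (by omega)]⟩
    simp only [Finset.mem_union, Finset.mem_singleton, List.mem_toFinset,
      mem_rowList (show x + 1 + k ≤ n by omega) (show y < n by omega), hy', not_or]
    refine ⟨fun h => ?_, by omega⟩
    rw [h, cell_snd (by omega)] at hy'
    omega
  · intro y' h1 h2
    have hy' : ((cell n (x + k) y').2 : ℕ) = y' := cell_snd (by omega)
    have hx' : ((cell n (x + k) y').1 : ℕ) = x + k := cell_fst (by omega)
    refine ⟨?_, by rw [hy', if_neg (by omega)]⟩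
    simp only [Finset.mem_union, Finset.mem_singleton, List.mem_toFinset,
      mem_rowList (show x + 1 + k ≤ n by omega) (show y < n by omega),
      mem_colList (show x < n by omega) (show y + 1 + m ≤ n by omega), hy', hx', not_or]
    refine ⟨⟨fun h => ?_, by omega⟩, by omega⟩
    rw [h, cell_snd (by omega)] at hy'
    omega
  · refine Finset.mem_union_left _ (Finset.mem_union_right _ ?_)
    rw [List.mem_toFinset, mem_rowList (by omega) (by omega), cell_fst hx, cell_snd (by omega)]
    omega

open Classical in
lemma isSweep_cup {x k y m : ℕ} (hk : 1 ≤ k) (hx : x + k < n) (hy : y + m < n) :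
    IsSweep (fun c => x + k - c.1) (cell n x y :: cupList n x k y m).toFinset
      (blockList n (x + 1) (k - 1) (y + 1) m) := by
  have := isSweep_block (n := n) (x1 := x) hx (by omega) m y
    (cell n x y :: cupList n x k y m).toFinset hy
  rw [show x + k - x - 1 = k - 1 by omega] at this
  rw [toFinset_cupList hx hy] at *
  refine this ?_ ?_ ?_
  · intro x' y' h1 h2 h3 h4
    rw [mem_cup, cell_fst (by omega), cell_snd (by omega)]; omega
  · intro x' h1 h2
    rw [mem_cup, cell_fst (by omega), cell_snd (by omega)]; omega
  · intro y' h1 h2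
    rw [mem_cup, mem_cup, cell_fst (by omega), cell_snd (by omega), cell_fst (by omega),
      cell_snd (by omega)]
    omega

end Frames

/-! ### Solutions as placements of tiles -/

section Solutions

variable {n q : ℕ} {ι : Fin q → Fin q}

/-- The piece at a cell, with its rotation. -/
def Assembly.tile (A : Assembly n) (c : Cell n) : Tile n := (A.pos.symm c, A.rot (A.pos.symm c))

lemma Assembly.distinctOn_tile (A : Assembly n) (S : Finset (Cell n)) : DistinctOn S A.tile :=
  fun _ _ _ _ h => A.pos.symm.injective h

lemma Assembly.shown_eq (A : Assembly n) (ω : Carving n ι) (c : Cell n) (d : ZMod 4) :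
    A.shown ω.1 c d = ω.jig (side (A.tile c) d) := rfl

lemma IsSolution.fitsOn {ω : Carving n ι} {A : Assembly n} (h : IsSolution ω A)
    (S : Finset (Cell n)) : FitsOn S A.tile ω :=
  fun c _ c' _ d hd => h c d c' hd

end Solutions

/-- Parameters for which the first moment bounds below are effective. -/
structure Admissible (n w K : ℕ) (κ t β : ℝ) : Prop where
  one_le : 1 ≤ κ
  two_le : 2 ≤ K
  t_pos : 0 < t
  t_le : t ≤ 1
  small : ((w ^ 2 * (4 * (2 * K + 1) ^ 2) : ℕ) + 1 : ℝ) * t * (1 + 2 * w) * (w : ℝ) ^ 2 ≤ 1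
  β_nonneg : 0 ≤ β
  β_le : β ≤ 1
  sq_le : κ⁻¹ ^ 2 ≤ ((4 * n ^ 2 : ℕ) : ℝ)⁻¹ * β ^ 2
  inv_le : κ⁻¹ ≤ t * β

lemma one_add_pow_le_three {δ : ℝ} (hδ : 0 ≤ δ) {m : ℕ} (h : δ * m ≤ 1) : (1 + δ) ^ m ≤ 3 := by
  calc (1 + δ) ^ m ≤ Real.exp δ ^ m := by
        gcongr
        linarith [Real.add_one_le_exp δ]
    _ = Real.exp (δ * m) := by rw [← Real.exp_nat_mul, mul_comm]
    _ ≤ Real.exp 1 := Real.exp_le_exp.2 h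
    _ ≤ 3 := by linarith [Real.exp_one_lt_d9]

/-! ### Defects in a window are controlled by three of its sides -/

section WindowEvent

variable {n q : ℕ} {ι : Fin q → Fin q}

/-- The number of defects in each rectangle with sides less than `w` is controlled by the number of
defects in three of its sides. -/
def Controlled (w lam : ℕ) (A : Cell n → Tile n) : Prop :=
  ∀ x₁ x₂ y₁ y₂ : ℕ, x₁ < x₂ → x₂ < n → y₁ ≤ y₂ → y₂ < n → x₂ < x₁ + w → y₂ < y₁ + w →
    (defects (rect n x₁ x₂ y₁ y₂) A).card ≤ 8 * lam * ((defects (cup n x₁ x₂ y₁ y₂) A).card + 1)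

-- Let `D` be the number of defects in the frame. More than `8 * lam * (D + 1)` defects in the
-- rectangle force its rank above `2 * lam * (D + 1)`, of which the frame accounts for at most `D`.
-- So the sweep imposes at least `lam * (D + 1)` constraints, while the frame has at most `D`
-- unlinked cells.
open Classical in
lemma prob_window_le (hι : Function.Involutive ι) {w K : ℕ} {κ t β : ℝ}
    (hP : Admissible n w K κ t β) (hq : κ ≤ q) {lam : ℕ} (hlam : 1 ≤ lam)
    (hs : 4 * (n : ℝ) ^ 2 * β ^ lam * (w : ℝ) ^ 2 ≤ 1)
    {x k y m : ℕ} (hk : 1 ≤ k) (hx : x + k < n) (hy : y + m < n) (hkw : k < w) (hmw : m < w) :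
    prob (fun ω : Carving n ι => ∃ A : Assembly n, IsSolution ω A ∧
      8 * lam * ((defects (cup n x (x + k) y (y + m)) A.tile).card + 1) <
        (defects (rect n x (x + k) y (y + m)) A.tile).card) ≤ 36 * n ^ 2 * β ^ lam := by
  have : NeZero n := ⟨by omega⟩
  set rest := cupList n x k y m with hrest
  set l := blockList n (x + 1) (k - 1) (y + 1) m with hl
  set c₀ := cell n x y with hc₀
  have hcup : (c₀ :: rest).toFinset = cup n x (x + k) y (y + m) := toFinset_cupList hx hy
  have hrect : (c₀ :: rest ++ l).toFinset = rect n x (x + k) y (y + m) := toFinset_cup_block hx hy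
  have htree := isTree_cupList hk hx hy
  have hsweep := isSweep_cup hk hx hy
  have hlen : (c₀ :: rest).length + l.length ≤ w ^ 2 := by
    simp only [hrest, hl, cupList, length_blockList, List.length_cons, List.length_append, rowList,
      colList, List.length_map, List.length_range']
    obtain ⟨k, rfl⟩ : ∃ k', k = k' + 1 := ⟨k - 1, by omega⟩
    simp only [Nat.add_sub_cancel]
    nlinarith
  have hrem : ∀ c ∈ l, 1 ≤ x + k - (c.1 : ℕ) ∧ x + k - (c.1 : ℕ) ≤ w := by
    intro c hc
    rw [hl, mem_blockList (by omega) (by omega)] at hc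
    omega
  have h := prob_sweep_le hι hP.one_le hq hP.two_le hP.t_pos hP.t_le
    (m := w ^ 2) (w := w) (T := ((w ^ 2 * (4 * (2 * K + 1) ^ 2) : ℕ) + 1 : ℝ) * t)
    (δ := (((w ^ 2 * (4 * (2 * K + 1) ^ 2) : ℕ) + 1 : ℝ) * t) +
      2 * (((w ^ 2 * (4 * (2 * K + 1) ^ 2) : ℕ) + 1 : ℝ) * t) * w) le_rfl le_rfl hP.β_nonneg hP.β_le hP.sq_le hP.inv_le
    htree hsweep hlen hrem lam (fun c => (c, 0))
  rw [hcup, hrect] at h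
  refine le_trans (prob_mono ?_) (h.trans ?_)
  · rintro ω ⟨A, hA, hlt⟩
    have hmem : ∀ c, c ∈ c₀ :: rest ++ l ↔ c ∈ rect n x (x + k) y (y + m) := fun c => by
      rw [← hrect, List.mem_toFinset]
    -- Outside the rectangle the solution is replaced by a fixed default, as the union bound runs
    -- over the rectangle only.
    obtain ⟨A', hag, hA'⟩ : ∃ A' : Cell n → Tile n,
        (∀ c ∈ rect n x (x + k) y (y + m), A' c = A.tile c) ∧
          ∀ c, c ∉ rect n x (x + k) y (y + m) → A' c = (c, 0) :=
      ⟨fun c => if c ∈ rect n x (x + k) y (y + m) then A.tile c else (c, 0),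
        fun c hc => if_pos hc, fun c hc => if_neg hc⟩
    refine ⟨A', ?_, ?_, ?_, ?_⟩
    · exact fun c hc => hA' c fun h => hc ((hmem c).2 h)
    · exact (A.distinctOn_tile _).congr fun c hc => (hag c hc).symm
    · intro c hc c' hc' d hd
      rw [hag c hc, hag c' hc']
      exact hA.fitsOn _ c hc c' hc' d hd
    · have hsub : cup n x (x + k) y (y + m) ⊆ rect n x (x + k) y (y + m) := Finset.filter_subset _ _
      rw [cc_congr (fun c hc => hag c (hsub hc)), cc_congr hag]
      have hu : unlinked (fun c : Cell n => if (c.2 : ℕ) = y then 2 else 3) rest A' =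
          unlinked (fun c : Cell n => if (c.2 : ℕ) = y then 2 else 3) rest A.tile := by
        refine unlinked_congr fun c hc => ?_
        obtain ⟨b, hb, hn⟩ := htree.exists_neighbor c hc
        refine linked_congr hn (hag c ?_) (hag b ?_)
        · exact (hmem c).1 (by simp [hc])
        · refine (hmem b).1 ?_
          rcases Finset.mem_union.1 hb with hb | hb
          · rw [Finset.mem_singleton.1 hb]; simp [hc₀]
          · simp only [List.mem_toFinset] at hb; simp [hb, hrest]
      rw [hu]
      have e1 := unlinked_add_card_defects_le A.tile _ _ htree
      have e0 : ({cell n x y} : Finset (Cell n)) ∪ (cupList n x k y m).toFinset =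
          cup n x (x + k) y (y + m) := by
        rw [← hcup]; ext c; simp [hc₀, hrest]
      rw [e0] at e1
      have e2 := rank_le_card_defects (cup n x (x + k) y (y + m)) A.tile
      have e3 := card_defects_le_rank (A.distinctOn_tile (rect n x (x + k) y (y + m)))
      have e4 := cc_anti hsub A.tile
      have e5 := cc_anti (Finset.empty_subset (cup n x (x + k) y (y + m))) A.tile
      rw [rank] at e2 e3
      set D := (defects (cup n x (x + k) y (y + m)) A.tile).card
      set u := unlinked (fun c : Cell n => if (c.2 : ℕ) = y then 2 else 3) rest A.tile
      have hu' : u ≤ D := by omega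
      have h8 : lam * (u + 1) ≤ lam * (D + 1) := Nat.mul_le_mul_left _ (by omega)
      have h9 : D + 1 ≤ lam * (D + 1) := Nat.le_mul_of_pos_left _ hlam
      have h10 : 8 * lam * (D + 1) = 8 * (lam * (D + 1)) := by ring
      omega
  · have hβ : 0 ≤ β ^ lam := pow_nonneg hP.β_nonneg _
    have ht := hP.t_pos
    have h1 := one_add_pow_le_three (m := w ^ 2) (by positivity) (le_trans (le_of_eq (by
      push_cast; ring)) hP.small : ((((w ^ 2 * (4 * (2 * K + 1) ^ 2) : ℕ) + 1 : ℝ) * t) +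
        2 * (((w ^ 2 * (4 * (2 * K + 1) ^ 2) : ℕ) + 1 : ℝ) * t) * w) * ((w ^ 2 : ℕ) : ℝ) ≤ 1)
    have h2 := one_add_pow_le_three (δ := 4 * (n : ℝ) ^ 2 * β ^ lam) (m := w ^ 2) (by positivity)
      (by push_cast; exact hs)
    calc _ ≤ 4 * (n : ℝ) ^ 2 * β ^ lam * 3 * 3 := by gcongr
      _ = _ := by ring

lemma prob_not_controlled_le (hι : Function.Involutive ι) {w K : ℕ} {κ t β : ℝ}
    (hP : Admissible n w K κ t β) (hq : κ ≤ q) {lam : ℕ} (hlam : 1 ≤ lam)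
    (hs : 4 * (n : ℝ) ^ 2 * β ^ lam * (w : ℝ) ^ 2 ≤ 1) :
    prob (fun ω : Carving n ι => ∃ A : Assembly n, IsSolution ω A ∧ ¬ Controlled w lam A.tile) ≤
      36 * n ^ 4 * w ^ 2 * β ^ lam := by
  classical
  let s : Finset (ℕ × ℕ × ℕ × ℕ) := (Finset.range n ×ˢ Finset.range w ×ˢ Finset.range n ×ˢ
    Finset.range w).filter fun i => 1 ≤ i.2.1 ∧ i.1 + i.2.1 < n ∧ i.2.2.1 + i.2.2.2 < n
  have h := prob_exists_finset_le_const s (fun i (ω : Carving n ι) => ∃ A : Assembly n,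
    IsSolution ω A ∧
      8 * lam * ((defects (cup n i.1 (i.1 + i.2.1) i.2.2.1 (i.2.2.1 + i.2.2.2)) A.tile).card + 1) <
        (defects (rect n i.1 (i.1 + i.2.1) i.2.2.1 (i.2.2.1 + i.2.2.2)) A.tile).card)
    (C := 36 * n ^ 2 * β ^ lam) (by
      rintro ⟨x, k, y, m⟩ hi
      simp only [s, Finset.mem_filter, Finset.mem_product, Finset.mem_range] at hi
      exact prob_window_le hι hP hq hlam hs hi.2.1 hi.2.2.1 hi.2.2.2 hi.1.2.1 hi.1.2.2.2)
  refine (prob_mono ?_).trans (h.trans ?_)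
  · rintro ω ⟨A, hA, hn⟩
    simp only [Controlled, not_forall, not_le] at hn
    obtain ⟨x₁, x₂, y₁, y₂, h1, h2, h3, h4, h5, h6, h7⟩ := hn
    refine ⟨(x₁, x₂ - x₁, y₁, y₂ - y₁), ?_, A, hA, ?_⟩
    · simp only [s, Finset.mem_filter, Finset.mem_product, Finset.mem_range]
      omega
    · simp only [Nat.add_sub_cancel' h1.le, Nat.add_sub_cancel' h3]
      exact h7
  · have hcard : (s.card : ℝ) ≤ n ^ 2 * w ^ 2 := by
      have := Finset.card_filter_le (Finset.range n ×ˢ Finset.range w ×ˢ Finset.range n ×ˢ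
        Finset.range w) (fun i => 1 ≤ i.2.1 ∧ i.1 + i.2.1 < n ∧ i.2.2.1 + i.2.2.2 < n)
      simp only [Finset.card_product, Finset.card_range] at this
      calc (s.card : ℝ) ≤ ((n * (w * (n * w)) : ℕ) : ℝ) := by exact_mod_cast this
        _ = _ := by push_cast; ring
    have hβ : 0 ≤ β ^ lam := pow_nonneg hP.β_nonneg _
    calc (s.card : ℝ) * (36 * n ^ 2 * β ^ lam) ≤ (n ^ 2 * w ^ 2) * (36 * n ^ 2 * β ^ lam) := by
          gcongr
      _ = _ := by ring

end WindowEvent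

/-! ### Rigid motions of pieces -/

section Motion

/-- Rotation by `r` counterclockwise quarter turns. -/
def rotv (r : ZMod 4) (u : ℤ × ℤ) : ℤ × ℤ := u.1 • step r + u.2 • step (r + 1)

lemma rotv_add (r : ZMod 4) (u w : ℤ × ℤ) : rotv r (u + w) = rotv r u + rotv r w := by
  simp only [rotv, Prod.fst_add, Prod.snd_add, add_smul]; abel

lemma rotv_step (r d : ZMod 4) : rotv r (step d) = step (d + r) := by
  revert r d; decide

lemma rotv_zero (u : ℤ × ℤ) : rotv 0 u = u := by
  simp [rotv, step_zero, step_one]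

lemma rotv_add_one (r : ZMod 4) (u : ℤ × ℤ) : rotv (r + 1) u = rotv 1 (rotv r u) := by
  obtain ⟨a, b⟩ := u
  rcases dir_cases r with rfl | rfl | rfl | rfl <;>
  · simp only [rotv, step_zero, step_one, step_two, step_three,
      show (0:ZMod 4) + 1 = 1 from rfl, show (1:ZMod 4) + 1 = 2 from rfl,
      show (2:ZMod 4) + 1 = 3 from rfl, show (3:ZMod 4) + 1 = 0 from rfl]
    ext <;> simp

variable {n : ℕ}

/-- The rigid motion which takes the piece at `c` from its planted position to `c`. -/
def motion (A : Cell n → Tile n) (c : Cell n) : ZMod 4 × (ℤ × ℤ) :=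
  ((A c).2, co c - rotv (A c).2 (co (A c).1))

lemma motion_eq_zero_iff {A : Cell n → Tile n} {c : Cell n} {τ : ℤ × ℤ} :
    motion A c = (0, τ) ↔ (A c).2 = 0 ∧ co (A c).1 + τ = co c := by
  rw [motion, Prod.mk.injEq]
  refine and_congr_right fun h => ?_
  rw [h, rotv_zero, sub_eq_iff_eq_add, add_comm]
  exact eq_comm

/-- Pieces that touch along a common planted edge have kept their relative position, so one rigid
motion carries both. -/
lemma motion_eq_of_neighbor {A : Cell n → Tile n} {S : Finset (Cell n)} (hA : DistinctOn S A)
    {c c' : Cell n} (hc : c ∈ S) (hc' : c' ∈ S) {d : ZMod 4} (hn : IsNeighbor c d c')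
    (h : mid (side (A c) d) = mid (side (A c') (d + 2))) : motion A c' = motion A c := by
  rcases mid_eq_iff.1 h with h | ⟨h1, h2⟩
  · exact absurd (hA hc hc' (by simpa using congrArg Prod.fst h)) hn.ne
  · simp only [side, isNeighbor_iff] at h1 h2
    have h3 : (A c').2 = (A c).2 := by
      have : d + 2 - (A c).2 = d + 2 - (A c').2 := by rw [h2]; ring
      simpa using this.symm
    rw [isNeighbor_iff] at hn
    rw [motion, motion, h3, h1, hn, rotv_add, rotv_step, sub_add_cancel]
    simp

end Motion

/-! ### Quarter turns of assemblies -/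

section Turn

variable {n q : ℕ} {ι : Fin q → Fin q}

lemma co_turn (c : Cell n) : co (Jigsaw.turn n c) = rotv 1 (co c) + ((n : ℤ) - 1, 0) := by
  have h := c.2.isLt
  have : (((n - (c.2 + 1) : ℕ)) : ℤ) = (n : ℤ) - 1 - c.2 := by omega
  ext
  · simp only [co, Jigsaw.turn, Equiv.coe_fn_mk, Fin.val_rev, rotv, step_one,
      show (1:ZMod 4) + 1 = 2 from rfl, step_two, this]
    simp; ring
  · simp [co, Jigsaw.turn, rotv, step_one, show (1:ZMod 4) + 1 = 2 from rfl, step_two]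

lemma isNeighbor_turn {c c' : Cell n} {d : ZMod 4} :
    IsNeighbor (Jigsaw.turn n c) (d + 1) (Jigsaw.turn n c') ↔ IsNeighbor c d c' := by
  rw [isNeighbor_iff, isNeighbor_iff, co_turn, co_turn]
  have e : rotv 1 (co c) + ((n : ℤ) - 1, (0:ℤ)) + step (d + 1) =
      rotv 1 (co c + step d) + ((n : ℤ) - 1, (0:ℤ)) := by
    rw [rotv_add, rotv_step]; abel
  rw [e, add_left_inj]
  refine ⟨fun h => ?_, fun h => by rw [h]⟩
  generalize co c + step d = u at h
  generalize co c' = w at h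
  obtain ⟨a, b⟩ := u
  obtain ⟨a', b'⟩ := w
  simp only [rotv, step_one, show (1:ZMod 4) + 1 = 2 from rfl, step_two] at h
  simp at h
  simp [h]

lemma Assembly.tile_turn (A : Assembly n) (c : Cell n) :
    A.turn.tile (Jigsaw.turn n c) = ((A.tile c).1, (A.tile c).2 + 1) := by
  simp [Assembly.tile, Assembly.turn]

lemma motion_turn (A : Assembly n) (c : Cell n) :
    motion A.turn.tile (Jigsaw.turn n c) = ((motion A.tile c).1 + 1,
      rotv 1 (motion A.tile c).2 + ((n : ℤ) - 1, 0)) := by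
  rw [motion, Assembly.tile_turn, motion]
  refine Prod.ext rfl ?_
  simp only
  have e : rotv 1 (co c - rotv (A.tile c).2 (co (A.tile c).1)) =
      rotv 1 (co c) - rotv 1 (rotv (A.tile c).2 (co (A.tile c).1)) := by
    rw [eq_sub_iff_add_eq, ← rotv_add, sub_add_cancel]
  rw [co_turn, e, rotv_add_one]
  abel

lemma Assembly.shown_turn (A : Assembly n) {f : Labelling n q} (c : Cell n) (d : ZMod 4) :
    A.turn.shown f (Jigsaw.turn n c) (d + 1) = A.shown f c d := by
  simp [Assembly.shown, Assembly.turn]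

lemma IsSolution.turn {ω : Carving n ι} {A : Assembly n} (h : IsSolution ω A) :
    IsSolution ω A.turn := by
  intro p d p' hn
  obtain ⟨c, rfl⟩ := (Jigsaw.turn n).surjective p
  obtain ⟨c', rfl⟩ := (Jigsaw.turn n).surjective p'
  obtain ⟨d, rfl⟩ : ∃ e, d = e + 1 := ⟨d - 1, by simp⟩
  rw [isNeighbor_turn] at hn
  rw [A.shown_turn, show d + 1 + 2 = d + 2 + 1 by ring, A.shown_turn]
  exact h c d c' hn

lemma IsSolution.turn_iterate {ω : Carving n ι} {A : Assembly n} (h : IsSolution ω A) (k : ℕ) :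
    IsSolution ω (Assembly.turn^[k] A) := by
  induction k with
  | zero => exact h
  | succ k ih => rw [Function.iterate_succ_apply']; exact ih.turn

end Turn

/-! ### Cells enclosed by rigidly moved pieces -/

section Link

variable {n : ℕ}

/-- The boundary of a rectangle. -/
def rim (n x₁ x₂ y₁ y₂ : ℕ) : Finset (Cell n) :=
  (rect n x₁ x₂ y₁ y₂).filter fun c =>
    (c.1 : ℕ) = x₁ ∨ (c.1 : ℕ) = x₂ ∨ (c.2 : ℕ) = y₁ ∨ (c.2 : ℕ) = y₂

lemma mem_rim {x₁ x₂ y₁ y₂ : ℕ} {c : Cell n} :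
    c ∈ rim n x₁ x₂ y₁ y₂ ↔ (x₁ ≤ c.1 ∧ (c.1 : ℕ) ≤ x₂ ∧ y₁ ≤ c.2 ∧ (c.2 : ℕ) ≤ y₂) ∧
      ((c.1 : ℕ) = x₁ ∨ (c.1 : ℕ) = x₂ ∨ (c.2 : ℕ) = y₁ ∨ (c.2 : ℕ) = y₂) := by
  simp [rim, mem_rect]

/-- Cells which are at distance at least `r` from the boundary of the grid. -/
def Inner (r : ℕ) (c : Cell n) : Prop :=
  r ≤ c.1 ∧ (c.1 : ℕ) + r < n ∧ r ≤ c.2 ∧ (c.2 : ℕ) + r < n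

/-- Each inner cell is enclosed by a small rectangle of pieces which are moved by `M`. -/
def Anchored (v : ℕ) (M : ZMod 4 × (ℤ × ℤ)) (A : Cell n → Tile n) : Prop :=
  ∀ c : Cell n, Inner (2 * v) c → ∃ x₁ x₂ y₁ y₂ : ℕ, x₁ < c.1 ∧ (c.1 : ℕ) < x₂ ∧ y₁ < c.2 ∧
    (c.2 : ℕ) < y₂ ∧ x₂ < x₁ + 2 * v ∧ y₂ < y₁ + 2 * v ∧ x₂ < n ∧ y₂ < n ∧
    ∀ b ∈ rim n x₁ x₂ y₁ y₂, motion A b = M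

lemma Anchored.turn {v : ℕ} {M : ZMod 4 × (ℤ × ℤ)} {A : Assembly n} (h : Anchored v M A.tile) :
    Anchored v (M.1 + 1, rotv 1 M.2 + ((n : ℤ) - 1, 0)) A.turn.tile := by
  intro c hc
  obtain ⟨c, rfl⟩ := (Jigsaw.turn n).surjective c
  have e1 : ∀ c : Cell n, ((Jigsaw.turn n c).1 : ℕ) = n - (c.2 + 1) := fun c => by
    simp [Jigsaw.turn, Fin.val_rev]
  have e2 : ∀ c : Cell n, ((Jigsaw.turn n c).2 : ℕ) = c.1 := fun c => rfl
  rw [Inner, e1, e2] at hc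
  have h1 := c.1.isLt
  have h2 := c.2.isLt
  obtain ⟨x₁, x₂, y₁, y₂, g1, g2, g3, g4, g5, g6, g7, g8, g9⟩ := h c (by rw [Inner]; omega)
  refine ⟨n - (y₂ + 1), n - (y₁ + 1), x₁, x₂, ?_⟩
  rw [e1, e2]
  refine ⟨by omega, by omega, by omega, by omega, by omega, by omega, by omega, by omega, ?_⟩
  intro b hb
  obtain ⟨b, rfl⟩ := (Jigsaw.turn n).surjective b
  rw [motion_turn, g9 b ?_]
  rw [mem_rim, e1, e2] at hb
  have h3 := b.2.isLt
  rw [mem_rim]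
  omega

/-- A quarter turn adds one to the rotational part of the common motion, so at most three turns make
it a translation. -/
lemma Anchored.exists_turn {v : ℕ} {M : ZMod 4 × (ℤ × ℤ)} {A : Assembly n}
    (h : Anchored v M A.tile) :
    ∃ k < 4, ∃ τ : ℤ × ℤ, Anchored v (0, τ) (Assembly.turn^[k] A).tile := by
  obtain ⟨r, τ⟩ := M
  have h1 := h.turn
  have h2 := h1.turn
  have h3 := h2.turn
  rcases dir_cases r with rfl | rfl | rfl | rfl
  · exact ⟨0, by omega, _, h⟩
  · exact ⟨3, by omega, _, h3⟩
  · exact ⟨2, by omega, _, h2⟩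
  · exact ⟨1, by omega, _, h1⟩

end Link

/-! ### Defect-free rows and columns, and the common motion -/

section Squares

variable {n : ℕ}

lemma card_adjs_le (S : Finset (Cell n)) : (adjs S).card ≤ 2 * S.card := by
  have : (adjs S).card ≤ (S ×ˢ ({0, 1} : Finset (ZMod 4))).card := by
    refine Finset.card_le_card_of_injOn (fun e => (e.1, e.2.1)) ?_ ?_
    · intro e he
      obtain ⟨h1, -, h2, -⟩ := mem_adjs.1 he
      simp [h1, h2]
    · intro e he e' he' h
      obtain ⟨-, -, -, h1⟩ := mem_adjs.1 he
      obtain ⟨-, -, -, h2⟩ := mem_adjs.1 he'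
      simp only [Prod.mk.injEq] at h
      rw [h.1, h.2] at h1
      exact Prod.ext h.1 (Prod.ext h.2 (h1.unique h2))
  have h2 : ({0, 1} : Finset (ZMod 4)).card = 2 := by decide
  rw [Finset.card_product, h2] at this
  omega

lemma card_cup_le {x₁ x₂ y₁ y₂ s : ℕ} (hx : x₁ < x₂) (hxn : x₂ < n) (hy : y₁ ≤ y₂) (hyn : y₂ < n)
    (hxs : x₂ < x₁ + s) (hys : y₂ < y₁ + s) : (cup n x₁ x₂ y₁ y₂).card ≤ 3 * s := by
  classical
  have : NeZero n := ⟨by omega⟩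
  have h := toFinset_cupList (n := n) (x := x₁) (k := x₂ - x₁) (y := y₁) (m := y₂ - y₁)
    (by omega) (by omega)
  rw [Nat.add_sub_cancel' hx.le, Nat.add_sub_cancel' hy] at h
  rw [← h]
  refine (List.toFinset_card_le _).trans ?_
  simp only [cupList, rowList, colList, List.length_cons, List.length_append, List.length_map,
    List.length_range']
  omega

/-- A pigeonhole principle. -/
lemma exists_index_card_le {α : Type*} (D : Finset α) (f : α → ℕ) (a v C : ℕ) (hv : 0 < v)
    (hD : D.card ≤ C * v) : ∃ y, a ≤ y ∧ y < a + v ∧ (D.filter fun e => f e = y).card ≤ C := by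
  classical
  by_contra! h
  have h1 : ∑ y ∈ Finset.Ico a (a + v), (D.filter fun e => f e = y).card ≤ D.card := by
    rw [← Finset.card_biUnion]
    · exact Finset.card_le_card (Finset.biUnion_subset.2 fun _ _ => Finset.filter_subset _ _)
    · intro i _ j _ hij
      rw [Function.onFun, Finset.disjoint_left]
      intro e h1 h2
      exact hij ((Finset.mem_filter.1 h1).2.symm.trans (Finset.mem_filter.1 h2).2)
  have h2 : ∑ y ∈ Finset.Ico a (a + v), (C + 1) ≤
      ∑ y ∈ Finset.Ico a (a + v), (D.filter fun e => f e = y).card :=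
    Finset.sum_le_sum fun y hy => by
      rw [Finset.mem_Ico] at hy
      exact h y hy.1 hy.2
  rw [Finset.sum_const, Nat.card_Ico, smul_eq_mul, Nat.add_sub_cancel_left] at h2
  nlinarith

lemma neighbor_zero_iff {c c' : Cell n} :
    IsNeighbor c 0 c' ↔ (c'.1 : ℕ) = c.1 + 1 ∧ (c'.2 : ℕ) = c.2 := by
  rw [isNeighbor_iff, step_zero, co, co, Prod.mk_add_mk, Prod.mk.injEq]; omega

lemma neighbor_one_iff {c c' : Cell n} :
    IsNeighbor c 1 c' ↔ (c'.1 : ℕ) = c.1 ∧ (c'.2 : ℕ) = c.2 + 1 := by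
  rw [isNeighbor_iff, step_one, co, co, Prod.mk_add_mk, Prod.mk.injEq]; omega

/-- The square with side `2 * v` and lower left corner `(a, b)`. -/
abbrev square (n v a b : ℕ) : Finset (Cell n) := rect n a (a + 2 * v - 1) b (b + 2 * v - 1)

/-- Control is used twice. The frame of the square enlarged by `v` has at most `12 * v` cells and
`24 * v` adjacencies, so the enlarged square has at most `200 * lam * v` defects. Averaging over `v`
rows and twice over `v` columns around the small square gives three walls with at most `200 * lam`
defects each. The frame made of these walls has few defects, and so has the rectangle above it. -/
lemma Controlled.card_defects_square {v lam : ℕ} {A : Cell n → Tile n} (hv : 0 < v)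
    (hlam : 1 ≤ lam) (h : Controlled (4 * v) lam A) {a b : ℕ} (ha : v ≤ a) (ha' : a + 3 * v ≤ n)
    (hb : v ≤ b) (hb' : b + 3 * v ≤ n) : (defects (square n v a b) A).card ≤ 5000 * lam ^ 2 := by
  set S := rect n (a - v) (a + 3 * v - 1) (b - v) (b + 3 * v - 1) with hS
  have hbig : (defects S A).card ≤ 200 * lam * v := by
    have h1 := h (a - v) (a + 3 * v - 1) (b - v) (b + 3 * v - 1) (by omega) (by omega) (by omega)
      (by omega) (by omega) (by omega)
    have h2 : (defects (cup n (a - v) (a + 3 * v - 1) (b - v) (b + 3 * v - 1)) A).card ≤ 24 * v := by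
      refine (Finset.card_filter_le _ _).trans ((card_adjs_le _).trans ?_)
      have := card_cup_le (n := n) (s := 4 * v) (x₁ := a - v) (x₂ := a + 3 * v - 1) (y₁ := b - v)
        (y₂ := b + 3 * v - 1) (by omega) (by omega) (by omega) (by omega) (by omega) (by omega)
      omega
    refine h1.trans ?_
    calc _ ≤ 8 * lam * (25 * v) := Nat.mul_le_mul_left _ (by omega)
      _ = _ := by ring
  obtain ⟨y, hy1, hy2, hy⟩ := exists_index_card_le ((defects S A).filter fun e => e.2.1 = 0)
    (fun e => (e.1.2 : ℕ)) (b - v) v (200 * lam) hv ((Finset.card_filter_le _ _).trans hbig)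
  obtain ⟨x, hx1, hx2, hx⟩ := exists_index_card_le ((defects S A).filter fun e => e.2.1 = 1)
    (fun e => (e.1.1 : ℕ)) (a - v) v (200 * lam) hv ((Finset.card_filter_le _ _).trans hbig)
  obtain ⟨x', hx1', hx2', hx'⟩ := exists_index_card_le ((defects S A).filter fun e => e.2.1 = 1)
    (fun e => (e.1.1 : ℕ)) (a + 2 * v) v (200 * lam) hv ((Finset.card_filter_le _ _).trans hbig)
  have hcup : (defects (cup n x x' y (b + 2 * v - 1)) A).card ≤ 600 * lam := by
    classical
    have hsub : defects (cup n x x' y (b + 2 * v - 1)) A ⊆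
        (((defects S A).filter fun e => e.2.1 = 0).filter fun e => (e.1.2 : ℕ) = y) ∪
        ((((defects S A).filter fun e => e.2.1 = 1).filter fun e => (e.1.1 : ℕ) = x) ∪
        (((defects S A).filter fun e => e.2.1 = 1).filter fun e => (e.1.1 : ℕ) = x')) := by
      intro e he
      have hSe : e ∈ defects S A := by
        refine defects_mono (fun c hc => ?_) A he
        rw [mem_cup] at hc
        rw [hS, mem_rect]
        omega
      obtain ⟨k1, k2, k3, k4⟩ := mem_adjs.1 (mem_defects.1 he).1
      rw [mem_cup] at k1 k2
      simp only [Finset.mem_union, Finset.mem_filter, hSe, true_and]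
      rcases k3 with k3 | k3 <;> rw [k3] at k4
      · rw [neighbor_zero_iff] at k4
        left; exact ⟨k3, by omega⟩
      · rw [neighbor_one_iff] at k4
        right
        have : (e.1.1 : ℕ) = x ∨ (e.1.1 : ℕ) = x' := by omega
        exact this.imp (fun h => ⟨k3, h⟩) fun h => ⟨k3, h⟩
    have h1 := Finset.card_le_card hsub
    have h2 := Finset.card_union_le
      (((defects S A).filter fun e => e.2.1 = 0).filter fun e => (e.1.2 : ℕ) = y)
      ((((defects S A).filter fun e => e.2.1 = 1).filter fun e => (e.1.1 : ℕ) = x) ∪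
        (((defects S A).filter fun e => e.2.1 = 1).filter fun e => (e.1.1 : ℕ) = x'))
    have h3 := Finset.card_union_le
      (((defects S A).filter fun e => e.2.1 = 1).filter fun e => (e.1.1 : ℕ) = x)
      (((defects S A).filter fun e => e.2.1 = 1).filter fun e => (e.1.1 : ℕ) = x')
    omega
  have hfin := h x x' y (b + 2 * v - 1) (by omega) (by omega) (by omega) (by omega) (by omega)
    (by omega)
  have hsq : square n v a b ⊆ rect n x x' y (b + 2 * v - 1) := by
    intro c hc
    rw [mem_rect] at *
    omega
  refine (Finset.card_le_card (defects_mono hsq A)).trans (hfin.trans ?_)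
  calc 8 * lam * ((defects (cup n x x' y (b + 2 * v - 1)) A).card + 1)
      ≤ 8 * lam * (601 * lam) := Nat.mul_le_mul_left _ (by omega)
    _ ≤ _ := by nlinarith

/-- There are no defects between horizontal neighbours in the row `y` of the square. -/
def GoodRow (A : Cell n → Tile n) (v a b y : ℕ) : Prop :=
  ∀ e ∈ defects (square n v a b) A, e.2.1 = 0 → (e.1.2 : ℕ) ≠ y

def GoodCol (A : Cell n → Tile n) (v a b x : ℕ) : Prop :=
  ∀ e ∈ defects (square n v a b) A, e.2.1 = 1 → (e.1.1 : ℕ) ≠ x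

/-- Avoiding the values of a function. -/
lemma exists_index_avoid {α : Type*} (D : Finset α) (f : α → ℕ) {a k : ℕ} (h : D.card < k) :
    ∃ y, a ≤ y ∧ y < a + k ∧ ∀ e ∈ D, f e ≠ y := by
  classical
  obtain ⟨y, hy, hy'⟩ := Finset.exists_mem_notMem_of_card_lt_card
    (s := D.image f) (t := Finset.Ico a (a + k)) (by
      rw [Nat.card_Ico, Nat.add_sub_cancel_left]
      exact Finset.card_image_le.trans_lt h)
  rw [Finset.mem_Ico] at hy
  exact ⟨y, hy.1, hy.2, fun e he h => hy' (Finset.mem_image.2 ⟨e, he, h⟩)⟩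

lemma exists_goodRow {A : Cell n → Tile n} {v a b D : ℕ}
    (hD : (defects (square n v a b) A).card ≤ D) (i : ℕ) :
    ∃ y, i ≤ y ∧ y < i + (D + 1) ∧ GoodRow A v a b y := by
  obtain ⟨y, h1, h2, h3⟩ := exists_index_avoid (defects (square n v a b) A)
    (fun e => (e.1.2 : ℕ)) (a := i) (k := D + 1) (by omega)
  exact ⟨y, h1, h2, fun e he _ => h3 e he⟩

lemma exists_goodCol {A : Cell n → Tile n} {v a b D : ℕ}
    (hD : (defects (square n v a b) A).card ≤ D) (i : ℕ) :
    ∃ x, i ≤ x ∧ x < i + (D + 1) ∧ GoodCol A v a b x := by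
  obtain ⟨y, h1, h2, h3⟩ := exists_index_avoid (defects (square n v a b) A)
    (fun e => (e.1.1 : ℕ)) (a := i) (k := D + 1) (by omega)
  exact ⟨y, h1, h2, fun e he _ => h3 e he⟩

lemma GoodRow.motion_eq [NeZero n] {A : Cell n → Tile n} (hA : DistinctOn Finset.univ A)
    {v a b y : ℕ} (h : GoodRow A v a b y) (ha : a + 2 * v ≤ n) (hb : b + 2 * v ≤ n) (hy : b ≤ y)
    (hy' : y < b + 2 * v) {x : ℕ} (hx : a ≤ x) (hx' : x < a + 2 * v) :
    motion A (cell n x y) = motion A (cell n a y) := by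
  induction x, hx using Nat.le_induction with
  | base => rfl
  | succ x hx ih =>
    rw [← ih (by omega)]
    have hn := neighbor_east (n := n) (x := x) (y := y) (by omega) (by omega)
    refine motion_eq_of_neighbor hA (Finset.mem_univ _) (Finset.mem_univ _) hn ?_
    by_contra hne
    refine h (cell n x y, 0, cell n (x + 1) y) (mem_defects.2 ⟨mem_adjs.2 ⟨?_, ?_, Or.inl rfl, hn⟩,
      hne⟩) rfl (cell_snd (by omega))
    · rw [mem_rect, cell_fst (by omega), cell_snd (by omega)]; omega
    · rw [mem_rect, cell_fst (by omega), cell_snd (by omega)]; omega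

lemma GoodCol.motion_eq [NeZero n] {A : Cell n → Tile n} (hA : DistinctOn Finset.univ A)
    {v a b x : ℕ} (h : GoodCol A v a b x) (ha : a + 2 * v ≤ n) (hb : b + 2 * v ≤ n) (hx : a ≤ x)
    (hx' : x < a + 2 * v) {y : ℕ} (hy : b ≤ y) (hy' : y < b + 2 * v) :
    motion A (cell n x y) = motion A (cell n x b) := by
  induction y, hy using Nat.le_induction with
  | base => rfl
  | succ y hy ih =>
    rw [← ih (by omega)]
    have hn := neighbor_north (n := n) (x := x) (y := y) (by omega) (by omega)
    refine motion_eq_of_neighbor hA (Finset.mem_univ _) (Finset.mem_univ _) hn ?_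
    by_contra hne
    refine h (cell n x y, 1, cell n x (y + 1)) (mem_defects.2 ⟨mem_adjs.2 ⟨?_, ?_, Or.inr rfl, hn⟩,
      hne⟩) rfl (cell_fst (by omega))
    · rw [mem_rect, cell_fst (by omega), cell_snd (by omega)]; omega
    · rw [mem_rect, cell_fst (by omega), cell_snd (by omega)]; omega

/-- All the good rows and columns of a square are moved by `M`. -/
def SquareMotion [NeZero n] (A : Cell n → Tile n) (v a b : ℕ) (M : ZMod 4 × (ℤ × ℤ)) : Prop :=
  (∀ y, GoodRow A v a b y → b ≤ y → y < b + 2 * v → ∀ x, a ≤ x → x < a + 2 * v →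
    motion A (cell n x y) = M) ∧
  (∀ x, GoodCol A v a b x → a ≤ x → x < a + 2 * v → ∀ y, b ≤ y → y < b + 2 * v →
    motion A (cell n x y) = M)

/-- The motion is constant along each good row and each good column, and every good row crosses
every good column. With fewer than `2 * v` defects both kinds exist. -/
lemma exists_squareMotion [NeZero n] {A : Cell n → Tile n} (hA : DistinctOn Finset.univ A)
    {v a b : ℕ} (ha : a + 2 * v ≤ n) (hb : b + 2 * v ≤ n)
    (hD : (defects (square n v a b) A).card < 2 * v) : ∃ M, SquareMotion A v a b M := by
  obtain ⟨y₀, h1, h2, h3⟩ := exists_goodRow (le_refl (defects (square n v a b) A).card) b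
  obtain ⟨x₀, g1, g2, g3⟩ := exists_goodCol (le_refl (defects (square n v a b) A).card) a
  have hrow := fun {y} (h : GoodRow A v a b y) (k : b ≤ y) (k' : y < b + 2 * v) {x} (l : a ≤ x)
    (l' : x < a + 2 * v) => h.motion_eq hA ha hb k k' l l'
  have hcol := fun {x} (h : GoodCol A v a b x) (l : a ≤ x) (l' : x < a + 2 * v) {y} (k : b ≤ y)
    (k' : y < b + 2 * v) => h.motion_eq hA ha hb l l' k k'
  refine ⟨motion A (cell n x₀ y₀), fun y h k k' x l l' => ?_, fun x h l l' y k k' => ?_⟩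
  · rw [hrow h k k' l l', ← hrow h k k' g1 (by omega), hcol g3 g1 (by omega) k k',
      ← hcol g3 g1 (by omega) h1 (by omega)]
  · rw [hcol h l l' k k', ← hcol h l l' h1 (by omega), hrow h3 h1 (by omega) l l',
      ← hrow h3 h1 (by omega) g1 (by omega)]

/-- The two squares together have fewer than `v` defects, so one of `v` rows (or columns) crossing
both of them is good for both. Its motion is the motion of either square. -/
lemma squareMotion_step [NeZero n] {A : Cell n → Tile n} (hA : DistinctOn Finset.univ A)
    {v a b a' b' D : ℕ} {M : ZMod 4 × (ℤ × ℤ)} (h : SquareMotion A v a b M)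
    (ha : a' + 2 * v ≤ n) (hb : b' + 2 * v ≤ n)
    (h1 : (defects (square n v a b) A).card ≤ D) (h2 : (defects (square n v a' b') A).card ≤ D)
    (hD : 2 * D + 2 ≤ v) (hab : (a' = a + 1 ∧ b' = b) ∨ (a' = a ∧ b' = b + 1)) :
    SquareMotion A v a' b' M := by
  classical
  obtain ⟨M', hM'⟩ := exists_squareMotion hA ha hb (by omega)
  suffices M = M' by rwa [this]
  have hcard : (defects (square n v a b) A ∪ defects (square n v a' b') A).card < v := by
    have := Finset.card_union_le (defects (square n v a b) A) (defects (square n v a' b') A)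
    omega
  rcases hab with ⟨rfl, rfl⟩ | ⟨rfl, rfl⟩
  · obtain ⟨y, k1, k2, k3⟩ := exists_index_avoid _ (fun e => (e.1.2 : ℕ)) (a := b') hcard
    rw [← h.1 y (fun e he _ => k3 e (Finset.mem_union_left _ he)) k1 (by omega) (a + 1) (by omega)
      (by omega), ← hM'.1 y (fun e he _ => k3 e (Finset.mem_union_right _ he)) k1 (by omega) (a + 1)
      (by omega) (by omega)]
  · obtain ⟨x, k1, k2, k3⟩ := exists_index_avoid _ (fun e => (e.1.1 : ℕ)) (a := a') hcard
    rw [← h.2 x (fun e he _ => k3 e (Finset.mem_union_left _ he)) k1 (by omega) (b + 1) (by omega)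
      (by omega), ← hM'.2 x (fun e he _ => k3 e (Finset.mem_union_right _ he)) k1 (by omega) (b + 1)
      (by omega) (by omega)]

/-- Stepping from square to square shows that all squares have the same motion. A cell in the middle
of a square is enclosed by good rows and columns on its four sides. The bound on `v` is twice the
defect bound of a square, with room to spare. -/
lemma Controlled.anchored {v lam : ℕ} {A : Cell n → Tile n} (hA : DistinctOn Finset.univ A)
    (hlam : 1 ≤ lam) (hv : 10000 * lam ^ 2 + 10 ≤ v) (hn : 4 * v ≤ n)
    (h : Controlled (4 * v) lam A) : ∃ M, Anchored v M A := by
  have : NeZero n := ⟨by omega⟩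
  have hD : ∀ a b, v ≤ a → a + 3 * v ≤ n → v ≤ b → b + 3 * v ≤ n →
      (defects (square n v a b) A).card ≤ 5000 * lam ^ 2 := fun a b h1 h2 h3 h4 =>
    h.card_defects_square (by omega) hlam h1 h2 h3 h4
  obtain ⟨M, hM⟩ := exists_squareMotion hA (v := v) (a := v) (b := v) (by omega) (by omega)
    (by have := hD v v (by omega) (by omega) (by omega) (by omega); omega)
  have hrow : ∀ a, v ≤ a → a + 3 * v ≤ n → SquareMotion A v a v M := by
    intro a ha
    induction a, ha using Nat.le_induction with
    | base => intro _; exact hM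
    | succ a ha ih =>
      intro ha'
      exact squareMotion_step hA (ih (by omega)) (by omega) (by omega)
        (hD _ _ ha (by omega) (by omega) (by omega)) (hD _ _ (by omega) ha' (by omega) (by omega))
        (by omega) (Or.inl ⟨rfl, rfl⟩)
  have hall : ∀ a b, v ≤ a → a + 3 * v ≤ n → v ≤ b → b + 3 * v ≤ n → SquareMotion A v a b M := by
    intro a b ha ha' hb
    induction b, hb using Nat.le_induction with
    | base => intro _; exact hrow a ha ha'
    | succ b hb ih =>
      intro hb'
      exact squareMotion_step hA (ih (by omega)) (by omega) (by omega)
        (hD _ _ ha ha' (by omega) (by omega)) (hD _ _ ha ha' (by omega) hb')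
        (by omega) (Or.inr ⟨rfl, rfl⟩)
  refine ⟨M, fun c ⟨hc1, hc2, hc3, hc4⟩ => ?_⟩
  obtain ⟨a, ha⟩ : ∃ a, (c.1 : ℕ) = a + v := ⟨c.1 - v, by omega⟩
  obtain ⟨b, hb⟩ : ∃ b, (c.2 : ℕ) = b + v := ⟨c.2 - v, by omega⟩
  have hM' := hall a b (by omega) (by omega) (by omega) (by omega)
  have hD' := hD a b (by omega) (by omega) (by omega) (by omega)
  obtain ⟨x₁, p1, p2, p3⟩ := exists_goodCol hD' a
  obtain ⟨x₂, q1, q2, q3⟩ := exists_goodCol hD' (a + v + 1)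
  obtain ⟨y₁, r1, r2, r3⟩ := exists_goodRow hD' b
  obtain ⟨y₂, s1, s2, s3⟩ := exists_goodRow hD' (b + v + 1)
  refine ⟨x₁, x₂, y₁, y₂, by omega, by omega, by omega, by omega, by omega, by omega, by omega,
    by omega, fun f hf => ?_⟩
  rw [mem_rim] at hf
  rw [← cell_eta f]
  rcases hf.2 with h | h | h | h
  · exact hM'.2 _ (h ▸ p3) (by omega) (by omega) _ (by omega) (by omega)
  · exact hM'.2 _ (h ▸ q3) (by omega) (by omega) _ (by omega) (by omega)
  · exact hM'.1 _ (h ▸ r3) (by omega) (by omega) _ (by omega) (by omega)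
  · exact hM'.1 _ (h ▸ s3) (by omega) (by omega) _ (by omega) (by omega)

end Squares

/-! ### Exits of rays from finite sets -/

section Rays

/-- A ray leaves a finite set after at most as many steps as the set has elements. -/
lemma exists_exit (T : Finset (ℤ × ℤ)) {p : ℤ × ℤ} (hp : p ∈ T) (d : ZMod 4) :
    ∃ k : ℕ, k < T.card ∧ p + k • step d ∈ T ∧ p + (k + 1) • step d ∉ T := by
  classical
  by_contra! h
  have hall : ∀ k : ℕ, k ≤ T.card → p + k • step d ∈ T := by
    intro k
    induction k with
    | zero => intro _; simpa using hp
    | succ k ih => intro hk; exact h k (by omega) (ih (by omega))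
  have hinj : Set.InjOn (fun k : ℕ => p + k • step d) (Finset.range (T.card + 1)) := by
    intro a _ b _ hab
    simp only [add_right_inj] at hab
    rcases dir_cases d with rfl | rfl | rfl | rfl <;>
    simpa [step_zero, step_one, step_two, step_three] using hab
  have := Finset.card_le_card_of_injOn (s := Finset.range (T.card + 1)) (t := T) _ (fun k hk => by
    rw [Finset.coe_range, Set.mem_Iio] at hk
    exact hall k (by omega)) hinj
  simp at this

/-- Twice the midpoint of the edge at which a ray leaves, after `k` steps. -/
def exitMid (p : ℤ × ℤ) (d : ZMod 4) (k : ℕ) : ℤ × ℤ := p + p + (2 * k + 1) • step d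

lemma exitMid_eq (p : ℤ × ℤ) (d : ZMod 4) (k : ℕ) :
    exitMid p d k = (p + k • step d) + (p + k • step d) + step d := by
  rw [exitMid, add_smul, mul_smul, two_smul, one_smul]; abel

lemma exitMid_eq' (p : ℤ × ℤ) (d : ZMod 4) (k : ℕ) :
    exitMid p d k = (p + (k + 1) • step d) + (p + (k + 1) • step d) + step (d + 2) := by
  rw [exitMid_eq, step_add_two, add_smul, one_smul]; abel

lemma exitMid_fst (p : ℤ × ℤ) (k : ℕ) : (exitMid p 0 k).1 = 2 * p.1 + 2 * k + 1 ∧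
    (exitMid p 1 k).1 = 2 * p.1 ∧ (exitMid p 2 k).1 = 2 * p.1 - 2 * k - 1 ∧
    (exitMid p 3 k).1 = 2 * p.1 := by
  simp [exitMid, step_zero, step_one, step_two, step_three]
  refine ⟨by ring, by ring, by ring, by ring⟩

lemma exitMid_snd (p : ℤ × ℤ) (k : ℕ) : (exitMid p 0 k).2 = 2 * p.2 ∧
    (exitMid p 1 k).2 = 2 * p.2 + 2 * k + 1 ∧ (exitMid p 2 k).2 = 2 * p.2 ∧
    (exitMid p 3 k).2 = 2 * p.2 - 2 * k - 1 := by
  simp [exitMid, step_zero, step_one, step_two, step_three]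
  refine ⟨by ring, by ring, by ring, by ring⟩

lemma exitMid_dir {p : ℤ × ℤ} {d e : ZMod 4} {k l : ℕ} (h : exitMid p d k = exitMid p e l) :
    d = e := by
  have h1 := congrArg Prod.fst h
  have h2 := congrArg Prod.snd h
  obtain ⟨a0, a1, a2, a3⟩ := exitMid_fst p k
  obtain ⟨b0, b1, b2, b3⟩ := exitMid_snd p k
  obtain ⟨c0, c1, c2, c3⟩ := exitMid_fst p l
  obtain ⟨e0, e1, e2, e3⟩ := exitMid_snd p l
  rcases dir_cases d with rfl | rfl | rfl | rfl <;> rcases dir_cases e with rfl | rfl | rfl | rfl <;>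
  first
  | rfl
  | (exfalso; omega)

lemma exitMid_near {p p' : ℤ × ℤ} {d e : ZMod 4} {k l w : ℕ} (h : exitMid p d k = exitMid p' e l)
    (hk : k < w) (hl : l < w) : |p.1 - p'.1| ≤ 2 * w ∧ |p.2 - p'.2| ≤ 2 * w := by
  have h1 := congrArg Prod.fst h
  have h2 := congrArg Prod.snd h
  obtain ⟨a0, a1, a2, a3⟩ := exitMid_fst p k
  obtain ⟨b0, b1, b2, b3⟩ := exitMid_snd p k
  obtain ⟨c0, c1, c2, c3⟩ := exitMid_fst p' l
  obtain ⟨e0, e1, e2, e3⟩ := exitMid_snd p' l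
  rw [abs_le, abs_le]
  rcases dir_cases d with rfl | rfl | rfl | rfl <;> rcases dir_cases e with rfl | rfl | rfl | rfl <;>
  omega

/-- Two points have at least six exits. -/
lemma exists_six_exits {p p' : ℤ × ℤ} (hne : p ≠ p') (k k' : ZMod 4 → ℕ) :
    ∃ T : Finset (ℤ × ℤ), 6 ≤ T.card ∧ ∀ m ∈ T, ∃ d, m = exitMid p d (k d) ∨
      m = exitMid p' d (k' d) := by
  classical
  -- Some horizontal or vertical line through `p'` misses `p`. The two exits of `p'` along it differ
  -- from all exits of `p`: by the position of the line for parallel rays, and by parity for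
  -- perpendicular ones.
  have hcase : ∃ d₀ : ZMod 4, ∀ d, exitMid p d (k d) ≠ exitMid p' d₀ (k' d₀) ∧
      exitMid p d (k d) ≠ exitMid p' (d₀ + 2) (k' (d₀ + 2)) := by
    by_cases h1 : p.1 = p'.1
    · have h2 : p.2 ≠ p'.2 := fun h => hne (Prod.ext h1 h)
      refine ⟨0, fun d => ?_⟩
      obtain ⟨b0, b1, b2, b3⟩ := exitMid_snd p (k d)
      have e0 := (exitMid_snd p' (k' 0)).1
      have e2 := (exitMid_snd p' (k' 2)).2.2.1
      rw [show (0:ZMod 4) + 2 = 2 from rfl]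
      constructor <;> intro h <;> have h := congrArg Prod.snd h <;>
      rcases dir_cases d with rfl | rfl | rfl | rfl <;> omega
    · refine ⟨1, fun d => ?_⟩
      obtain ⟨b0, b1, b2, b3⟩ := exitMid_fst p (k d)
      have e0 := (exitMid_fst p' (k' 1)).2.1
      have e2 := (exitMid_fst p' (k' 3)).2.2.2
      rw [show (1:ZMod 4) + 2 = 3 from rfl]
      constructor <;> intro h <;> have h := congrArg Prod.fst h <;>
      rcases dir_cases d with rfl | rfl | rfl | rfl <;> omega
  obtain ⟨d₀, hd₀⟩ := hcase
  refine ⟨(Finset.univ.image fun d => exitMid p d (k d)) ∪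
    {exitMid p' d₀ (k' d₀), exitMid p' (d₀ + 2) (k' (d₀ + 2))}, ?_, ?_⟩
  · rw [Finset.card_union_of_disjoint, Finset.card_image_of_injective _ fun d e h => exitMid_dir h,
      Finset.card_pair, Finset.card_univ, ZMod.card]
    · exact fun h => add_two_ne d₀ (exitMid_dir h).symm
    · rw [Finset.disjoint_left]
      intro m hm hm'
      obtain ⟨d, -, rfl⟩ := Finset.mem_image.1 hm
      simp only [Finset.mem_insert, Finset.mem_singleton] at hm'
      exact hm'.elim (hd₀ d).1 (hd₀ d).2
  · intro m hm
    rcases Finset.mem_union.1 hm with hm | hm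
    · obtain ⟨d, -, rfl⟩ := Finset.mem_image.1 hm
      exact ⟨d, Or.inl rfl⟩
    · simp only [Finset.mem_insert, Finset.mem_singleton] at hm
      exact hm.elim (fun h => ⟨d₀, Or.inr h⟩) fun h => ⟨d₀ + 2, Or.inr h⟩

end Rays

/-! ### Constraints imposed by deviating pieces -/

section Interior

variable {n : ℕ}

open Classical in
/-- The cells whose pieces are not shifted by `τ`. -/
noncomputable def deviating (S : Finset (Cell n)) (τ : ℤ × ℤ) (A : Cell n → Tile n) :
    Finset (Cell n) := S.filter fun c => motion A c ≠ (0, τ)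

lemma mem_deviating {S : Finset (Cell n)} {τ : ℤ × ℤ} {A : Cell n → Tile n} {c : Cell n} :
    c ∈ deviating S τ A ↔ c ∈ S ∧ motion A c ≠ (0, τ) := by
  simp [deviating]

/-- The sides of a deviating piece touch wrong sides, when the neighbouring piece is the wrong one
or does not deviate. -/
lemma mid_ne_of_deviating {S : Finset (Cell n)} {τ : ℤ × ℤ} {A : Cell n → Tile n}
    (hA : DistinctOn S A) {c c' : Cell n} (hc : c ∈ deviating S τ A) (hc' : c' ∈ S) {d : ZMod 4}
    (hn : IsNeighbor c d c') (h : c' ∉ deviating S τ A) :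
    mid (side (A c) d) ≠ mid (side (A c') (d + 2)) := by
  rw [mem_deviating] at hc h
  intro e
  have h1 := motion_eq_of_neighbor hA hc.1 hc' hn e
  rw [not_and, not_not] at h
  exact hc.2 (h1 ▸ h hc')

/-- Each ray from a deviating piece, through the deviating pieces of the planted assembly, exits at
a touched edge. -/
lemma exists_touched_of_piece {S : Finset (Cell n)} {τ : ℤ × ℤ} {A : Cell n → Tile n}
    (hA : DistinctOn S A)
    (hint : ∀ c ∈ deviating S τ A, ∀ d, ∃ c' ∈ S, IsNeighbor c d c') {c : Cell n}
    (hc : c ∈ deviating S τ A) (e : ZMod 4) : ∃ k < (deviating S τ A).card,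
      ∃ h g, mid h = exitMid (co (A c).1) e k ∧ mid g ≠ exitMid (co (A c).1) e k ∧ rel S A h g := by
  classical
  set W := deviating S τ A with hW
  obtain ⟨k, hk, h1, h2⟩ := exists_exit (W.image fun c => co (A c).1)
    (Finset.mem_image.2 ⟨c, hc, rfl⟩) e
  obtain ⟨b, hb, hbk⟩ := Finset.mem_image.1 h1
  have hbS := (mem_deviating.1 hb).1
  set d : ZMod 4 := e + (A b).2 with hd
  obtain ⟨b', hb', hn⟩ := hint b hb d
  have hs : side (A b) d = ((A b).1, e) := by simp [side, hd]
  have hm : mid (side (A b) d) = exitMid (co (A c).1) e k := by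
    rw [hs, exitMid_eq, ← hbk]; rfl
  refine ⟨k, hk.trans_le Finset.card_image_le, side (A b) d, side (A b') (d + 2), hm, ?_,
    rel_of_neighbor hbS hb' hn⟩
  rw [← hm]
  intro h
  -- Suppose that the edge of exit is matched correctly. If the piece beyond it deviates, it
  -- continues the ray, which has just left the set; if not, it passes its motion on to `b`, which
  -- deviates.
  by_cases hbW : b' ∈ W
  · rcases mid_eq_iff.1 h.symm with h' | ⟨h', -⟩
    · exact hn.ne (hA hbS hb' (by simpa using congrArg Prod.fst h'))
    · refine h2 (Finset.mem_image.2 ⟨b', hbW, ?_⟩)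
      rw [hs, isNeighbor_iff] at h'
      simp only [side_fst] at h'
      rw [h', hbk, add_smul, one_smul, add_assoc]
  · exact mid_ne_of_deviating hA hb hb' hn hbW h.symm

/-- Each ray from a deviating cell through deviating cells exits at a touched edge. -/
lemma exists_touched_of_cell {S : Finset (Cell n)} {τ : ℤ × ℤ} {A : Cell n → Tile n}
    (hA : DistinctOn S A)
    (hint : ∀ c ∈ deviating S τ A, ∀ d, ∃ c' ∈ S, IsNeighbor c d c') {c : Cell n}
    (hc : c ∈ deviating S τ A) (d : ZMod 4) : ∃ k < (deviating S τ A).card,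
      ∃ h g, mid h = exitMid (co c - τ) d k ∧ mid g ≠ exitMid (co c - τ) d k ∧ rel S A h g := by
  classical
  set W := deviating S τ A with hW
  obtain ⟨k, hk, h1, h2⟩ := exists_exit (W.image fun c => co c)
    (Finset.mem_image.2 ⟨c, hc, rfl⟩) d
  obtain ⟨b, hb, hbk⟩ := Finset.mem_image.1 h1
  have hbS := (mem_deviating.1 hb).1
  obtain ⟨b', hb', hn⟩ := hint b hb d
  have hco : co b' = co c + (k + 1) • step d := by
    rw [isNeighbor_iff] at hn
    rw [hn, hbk, add_smul, one_smul, add_assoc]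
  have hbW : b' ∉ W := fun h => h2 (Finset.mem_image.2 ⟨b', h, hco⟩)
  have hmot : motion A b' = (0, τ) := by
    by_contra h
    exact hbW (mem_deviating.2 ⟨hb', h⟩)
  rw [motion_eq_zero_iff] at hmot
  -- The cell reached at the exit holds the piece shifted by `τ`, so its side lies on the edge of
  -- exit, shifted back.
  have hm : mid (side (A b') (d + 2)) = exitMid (co c - τ) d k := by
    rw [exitMid_eq', mid, side_fst, show (side (A b') (d + 2)).2 = d + 2 by simp [side, hmot.1]]
    rw [show co c - τ + (k + 1) • step d = co (A b').1 by
      rw [eq_sub_of_add_eq hmot.2, hco]; abel]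
  refine ⟨k, hk.trans_le Finset.card_image_le, side (A b') (d + 2), side (A b) d, hm, ?_,
    (rel S A).symm (rel_of_neighbor hbS hb' hn)⟩
  rw [← hm]
  exact mid_ne_of_deviating hA hb hb' hn hbW

/-- Two deviating pieces impose many independent constraints. -/
lemma two_mul_card_fresh_add_three_le {S R : Finset (Cell n)} {τ : ℤ × ℤ} {A : Cell n → Tile n}
    (hA : DistinctOn S A)
    (hint : ∀ c ∈ deviating S τ A, ∀ d, ∃ c' ∈ S, IsNeighbor c d c')
    (h2 : 2 ≤ (deviating S τ A).card) {K w : ℕ} (hK : 2 * (deviating S τ A).card + w ≤ K)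
    (hR : ∀ c ∈ deviating S τ A, ∃ b ∈ R, co (A b).1 + τ = co b ∧
      |(co c).1 - (co b).1| ≤ w ∧ |(co c).2 - (co b).2| ≤ w)
    {F : Finset (Cell n)} (hF : F ⊆ deviating S τ A)
    (hFR : ∀ c ∈ F, ∀ b ∈ R, Far K (co (A b).1) (co (A c).1))
    (hFF : ∀ c ∈ F, ∀ c' ∈ F, c ≠ c' → Far K (co (A c).1) (co (A c').1)) :
    2 * F.card + 3 ≤ rank S A := by
  classical
  set W := deviating S τ A with hW
  have hex := fun (c : W) (e : ZMod 4) => exists_touched_of_piece hA hint c.2 e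
  choose k hk hkt using hex
  have hex' := fun (c : W) (e : ZMod 4) => exists_touched_of_cell hA hint c.2 e
  choose l hl hlt using hex'
  let g : F × ZMod 4 → ℤ × ℤ := fun i => exitMid (co (A i.1).1) i.2 (k ⟨i.1, hF i.1.2⟩ i.2)
  have hg : Function.Injective g := by
    rintro ⟨c, e⟩ ⟨c', e'⟩ h
    have hcc : c = c' := by
      by_contra hne
      obtain ⟨n1, n2⟩ := exitMid_near h (hk _ _) (hk _ _)
      rw [← hW] at n1 n2
      rcases hFF c c.2 c' c'.2 (fun h => hne (Subtype.ext h)) with hf | hf <;> simp only at n1 n2 <;>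
        omega
    subst hcc
    exact Prod.ext rfl (exitMid_dir h)
  obtain ⟨c₁, c₂, hc₁, hc₂, hne⟩ := Finset.one_lt_card_iff.1 (show 1 < W.card by omega)
  obtain ⟨T, hT, hTm⟩ := exists_six_exits (p := co c₁ - τ) (p' := co c₂ - τ)
    (fun h => hne (co_injective (by simpa using h))) (l ⟨c₁, hc₁⟩) (l ⟨c₂, hc₂⟩)
  have hT' : ∀ m ∈ T, ∃ (c : W) (d : ZMod 4), m = exitMid (co c.1 - τ) d (l c d) := by
    intro m hm
    obtain ⟨d, h | h⟩ := hTm m hm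
    · exact ⟨⟨c₁, hc₁⟩, d, h⟩
    · exact ⟨⟨c₂, hc₂⟩, d, h⟩
  -- Exits of cells stay near the positions of the boundary pieces in the planted puzzle, and fresh
  -- pieces are far from all of these.
  have hdisj : Disjoint (Finset.univ.image g) T := by
    rw [Finset.disjoint_left]
    intro m hm hmT
    obtain ⟨⟨c, e⟩, -, rfl⟩ := Finset.mem_image.1 hm
    obtain ⟨c', d, h⟩ := hT' _ hmT
    obtain ⟨n1, n2⟩ := exitMid_near h (hk _ _) (hl _ _)
    obtain ⟨b, hb, hbτ, b1, b2⟩ := hR c' c'.2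
    have e1 := congrArg Prod.fst hbτ
    have e2 := congrArg Prod.snd hbτ
    simp only [Prod.fst_add, Prod.snd_add, Prod.fst_sub, Prod.snd_sub] at e1 e2 n1 n2
    rw [← hW, abs_le] at n1 n2
    rw [abs_le] at b1 b2
    rcases hFR c c.2 b hb with hf | hf <;> rw [lt_abs] at hf <;> omega
  have hcard := card_touched_le S A (Finset.univ.image g ∪ T) (by
    intro m hm
    rcases Finset.mem_union.1 hm with hm | hm
    · obtain ⟨⟨c, e⟩, -, rfl⟩ := Finset.mem_image.1 hm
      exact hkt ⟨c.1, hF c.2⟩ e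
    · obtain ⟨c', d, rfl⟩ := hT' _ hm
      exact hlt _ _)
  -- Four exits for each fresh piece and six for two deviating cells give `4 * F.card + 6 ≤ 2 * rank
  -- S A`.
  rw [Finset.card_union_of_disjoint hdisj, Finset.card_image_of_injective _ hg, Finset.card_univ,
    Fintype.card_prod, ZMod.card, Fintype.card_coe] at hcard
  omega

end Interior

/-! ### At most one deviating piece in a window with shifted boundary -/

section InteriorEvent

variable {n q : ℕ} {ι : Fin q → Fin q}

lemma exists_neighbor_in_rect {x k y m : ℕ} (hx : x + k < n) (hy : y + m < n) {c : Cell n}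
    (h : x < c.1 ∧ (c.1 : ℕ) < x + k ∧ y < c.2 ∧ (c.2 : ℕ) < y + m) (d : ZMod 4) :
    ∃ c' ∈ rect n x (x + k) y (y + m), IsNeighbor c d c' := by
  have : NeZero n := ⟨by omega⟩
  obtain ⟨a, ha⟩ : ∃ a, (c.1 : ℕ) = a + 1 := ⟨c.1 - 1, by omega⟩
  obtain ⟨b, hb⟩ : ∃ b, (c.2 : ℕ) = b + 1 := ⟨c.2 - 1, by omega⟩
  have hc : c = cell n (a + 1) (b + 1) := by rw [← ha, ← hb, cell_eta]
  rcases dir_cases d with rfl | rfl | rfl | rfl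
  · refine ⟨cell n (a + 1 + 1) (b + 1), ?_, hc ▸ neighbor_east (by omega) (by omega)⟩
    rw [mem_rect, cell_fst (by omega), cell_snd (by omega)]; omega
  · refine ⟨cell n (a + 1) (b + 1 + 1), ?_, hc ▸ neighbor_north (by omega) (by omega)⟩
    rw [mem_rect, cell_fst (by omega), cell_snd (by omega)]; omega
  · refine ⟨cell n a (b + 1), ?_, hc ▸ neighbor_west (by omega) (by omega)⟩
    rw [mem_rect, cell_fst (by omega), cell_snd (by omega)]; omega
  · refine ⟨cell n (a + 1) b, ?_, hc ▸ neighbor_south (by omega) (by omega)⟩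
    rw [mem_rect, cell_fst (by omega), cell_snd (by omega)]; omega

lemma mem_rim_or_interior {x k y m : ℕ} {c : Cell n} (hc : c ∈ rect n x (x + k) y (y + m)) :
    c ∈ rim n x (x + k) y (y + m) ∨
      (x < c.1 ∧ (c.1 : ℕ) < x + k ∧ y < c.2 ∧ (c.2 : ℕ) < y + m) := by
  rw [mem_rect] at hc
  rw [mem_rim]
  omega

open Classical in
lemma rim_union_block [NeZero n] {x k y m : ℕ} (hk : 1 ≤ k) (hm : 1 ≤ m) (hx : x + k < n)
    (hy : y + m < n) : rim n x (x + k) y (y + m) ∪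
      (blockList n (x + 1) (k - 1) (y + 1) (m - 1)).toFinset = rect n x (x + k) y (y + m) := by
  ext c
  rw [Finset.mem_union, List.mem_toFinset, mem_rim, mem_rect, mem_blockList (by omega) (by omega)]
  omega

open Classical in
lemma isSweep_rim [NeZero n] {x k y m : ℕ} (hk : 1 ≤ k) (hm : 1 ≤ m) (hx : x + k < n)
    (hy : y + m < n) : IsSweep (fun c => x + k - c.1) (rim n x (x + k) y (y + m))
      (blockList n (x + 1) (k - 1) (y + 1) (m - 1)) := by
  have := isSweep_block (n := n) (x1 := x) hx (by omega) (m - 1) y (rim n x (x + k) y (y + m))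
    (by omega)
  rw [show x + k - x - 1 = k - 1 by omega] at this
  refine this ?_ ?_ ?_
  · intro x' y' h1 h2 h3 h4
    rw [mem_rim, cell_fst (by omega), cell_snd (by omega)]; omega
  · intro x' h1 h2
    rw [mem_rim, cell_fst (by omega), cell_snd (by omega)]; omega
  · intro y' h1 h2
    rw [mem_rim, mem_rim, cell_fst (by omega), cell_snd (by omega), cell_fst (by omega),
      cell_snd (by omega)]
    omega

lemma card_rect_le (n x k y m : ℕ) :
    (rect n x (x + k) y (y + m)).card ≤ (k + 1) * (m + 1) := by
  have h : (rect n x (x + k) y (y + m)).card ≤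
      (Finset.Icc x (x + k) ×ˢ Finset.Icc y (y + m)).card := by
    refine Finset.card_le_card_of_injOn (fun c => ((c.1 : ℕ), (c.2 : ℕ))) ?_ ?_
    · intro c hc
      rw [Finset.mem_coe, mem_rect] at hc
      simp only [Finset.coe_product, Set.mem_prod, Finset.mem_coe, Finset.mem_Icc]
      omega
    · intro c _ c' _ h
      simp only [Prod.mk.injEq] at h
      exact Prod.ext (Fin.ext h.1) (Fin.ext h.2)
  rw [Finset.card_product, Nat.card_Icc, Nat.card_Icc] at h
  convert h using 2 <;> omega

open Classical in
lemma card_rim_add_length_le [NeZero n] {x k y m : ℕ} (hk : 1 ≤ k) (hm : 1 ≤ m) (hx : x + k < n)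
    (hy : y + m < n) : (rim n x (x + k) y (y + m)).card +
      (blockList n (x + 1) (k - 1) (y + 1) (m - 1)).length ≤ (k + 1) * (m + 1) := by
  obtain ⟨h1, h2⟩ := (isSweep_rim (n := n) hk hm hx hy).nodup
  rw [← List.toFinset_card_of_nodup h1, ← Finset.card_union_of_disjoint, rim_union_block hk hm hx hy]
  · exact card_rect_le n x k y m
  · rw [Finset.disjoint_left]
    intro c hc hc'
    exact h2 c (by simpa using hc') hc

-- The boundary pieces are dictated by `τ`, so only the inside is summed over. Besides the two
-- constraints that pay for each fresh piece there are at least three more, each of which gains `κ⁻¹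
-- * t⁻¹`. The third power beats the number of windows, which is `n ^ 2` up to polylogarithmic
-- factors.
open Classical in
lemma prob_deviating_le (hι : Function.Involutive ι) {w K : ℕ} {κ t β : ℝ}
    (hP : Admissible n w K κ t β) (hq : κ ≤ q) (hK : 2 * w ^ 2 + w ≤ K) (τ : ℤ × ℤ)
    {x k y m : ℕ} (hk : 1 ≤ k) (hm : 1 ≤ m) (hx : x + k < n) (hy : y + m < n) (hkw : k < w)
    (hmw : m < w) :
    prob (fun ω : Carving n ι => ∃ A : Assembly n, IsSolution ω A ∧
      (∀ b ∈ rim n x (x + k) y (y + m), motion A.tile b = (0, τ)) ∧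
      2 ≤ (deviating (rect n x (x + k) y (y + m)) τ A.tile).card) ≤ 3 * (κ⁻¹ * t⁻¹) ^ 3 := by
  have : NeZero n := ⟨by omega⟩
  have ht := hP.t_pos
  have hκ0 : 0 < κ := by linarith [hP.one_le]
  set γ : ℝ := κ⁻¹ * t⁻¹ with hγ
  have hγ0 : 0 ≤ γ := by positivity
  have hγ1 : γ ≤ 1 := by
    refine le_trans ?_ hP.β_le
    rw [hγ, ← div_eq_mul_inv, div_le_iff₀ ht, mul_comm]
    exact hP.inv_le
  set S := rect n x (x + k) y (y + m) with hS
  set R := rim n x (x + k) y (y + m) with hR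
  set l := blockList n (x + 1) (k - 1) (y + 1) (m - 1) with hl
  have hRS : R ∪ l.toFinset = S := rim_union_block hk hm hx hy
  have hRsub : R ⊆ S := Finset.filter_subset _ _
  have hsweep := isSweep_rim (n := n) hk hm hx hy
  obtain ⟨hnd, hdis⟩ := hsweep.nodup
  have hlen : R.card + l.length ≤ w ^ 2 := by
    refine (card_rim_add_length_le hk hm hx hy).trans ?_
    rw [pow_two]; exact Nat.mul_le_mul hkw hmw
  have hScard : S.card ≤ w ^ 2 := by
    refine (card_rect_le n x k y m).trans ?_
    rw [pow_two]; exact Nat.mul_le_mul hkw hmw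
  by_cases hex : ∀ b ∈ R, ∃ p : Cell n, co p + τ = co b
  swap
  · refine (prob_mono (F := fun _ => False) ?_).trans (prob_false.le.trans (by positivity))
    rintro ω ⟨A, -, h, -⟩
    exact hex fun b hb => ⟨_, (motion_eq_zero_iff.1 (h b hb)).2⟩
  -- On the boundary this is the only placement with motion `(0, τ)`. The value elsewhere does not
  -- matter.
  let A₀ : Cell n → Tile n := fun c => (if h : ∃ p : Cell n, co p + τ = co c then h.choose else c, 0)
  have hA₀ : ∀ b ∈ R, co (A₀ b).1 + τ = co b := fun b hb => by
    simp only [A₀, dif_pos (hex b hb)]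
    exact (hex b hb).choose_spec
  have hA₀d : DistinctOn R A₀ := by
    intro a ha b hb h
    refine co_injective ?_
    rw [← hA₀ a ha, ← hA₀ b hb]
    simp only at h
    rw [h]
  obtain ⟨Q, hQ⟩ : ∃ Q : (Cell n → Tile n) → Prop, ∀ A', Q A' ↔ 2 ≤ (deviating S τ A').card :=
    ⟨_, fun _ => Iff.rfl⟩
  have h1 := prob_exists_filling_le (n := n) hι hκ0 hq Q
    l R A₀ hnd hdis
  rw [hRS] at h1
  refine (prob_mono ?_).trans (h1.trans ?_)
  · rintro ω ⟨A, hA, h, h2⟩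
    obtain ⟨A', hag, hA'⟩ : ∃ A' : Cell n → Tile n, (∀ c ∈ S, A' c = A.tile c) ∧
        ∀ c, c ∉ S → A' c = A₀ c :=
      ⟨fun c => if c ∈ S then A.tile c else A₀ c, fun c hc => if_pos hc, fun c hc => if_neg hc⟩
    refine ⟨A', ?_, ?_, ?_, ?_⟩
    · intro c hc
      by_cases hcS : c ∈ S
      · have hcR : c ∈ R := by
          rw [← hRS, Finset.mem_union, List.mem_toFinset] at hcS
          exact hcS.resolve_right hc
        rw [hag c hcS]
        have h3 := motion_eq_zero_iff.1 (h c hcR)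
        refine Prod.ext (co_injective ?_) h3.1
        have := hA₀ c hcR
        rw [← h3.2] at this
        exact (add_right_cancel this).symm
      · exact hA' c hcS
    · exact (A.distinctOn_tile _).congr fun c hc => (hag c hc).symm
    · intro c hc c' hc' d hd
      rw [hag c hc, hag c' hc']
      exact hA.fitsOn _ c hc c' hc' d hd
    · have : deviating S τ A' = deviating S τ A.tile := by
        refine Finset.filter_congr fun c hc => ?_
        rw [motion, motion, hag c hc]
      rwa [hQ, this]
  · have hle : fillSum l R A₀ (fun A' => if Q A' then κ⁻¹ ^ rank S A' else 0)
        ≤ fillSum l R A₀ (fun A' => γ ^ 3 * weight K t l R A') := by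
      refine fillSum_mono l _ _ hnd hdis hA₀d fun A' hA' hd => ?_
      have hw0 := weight_nonneg (K := K) ht.le l R A'
      split_ifs with h2
      swap
      · positivity
      rw [hQ] at h2
      rw [hRS] at hd
      have hAR : ∀ b ∈ R, A' b = A₀ b := fun b hb => hA' b fun h => hdis b h hb
      have hmotR : ∀ b ∈ R, motion A' b = (0, τ) := fun b hb => by
        rw [motion_eq_zero_iff, hAR b hb]
        exact ⟨rfl, hA₀ b hb⟩
      have hWin : ∀ c ∈ deviating S τ A', x < c.1 ∧ (c.1 : ℕ) < x + k ∧ y < c.2 ∧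
          (c.2 : ℕ) < y + m := fun c hc => by
        rw [mem_deviating] at hc
        exact (mem_rim_or_interior hc.1).resolve_left fun h => hc.2 (hmotR c h)
      have hWcard : (deviating S τ A').card ≤ w ^ 2 := (Finset.card_filter_le _ _).trans hScard
      obtain ⟨w1, w2⟩ := weight_eq hP.two_le t _ A' l R hsweep
      have hF : 2 * (freshCells K l R A').card + 3 ≤ rank S A' := by
        refine two_mul_card_fresh_add_three_le (R := R) (w := w) (K := K) hd ?_ h2 (by omega) ?_ ?_ ?_ ?_
        · intro c hc d
          exact exists_neighbor_in_rect hx hy (hWin c hc) d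
        · intro c hc
          obtain ⟨i1, i2, i3, i4⟩ := hWin c hc
          have hbR : cell n x c.2 ∈ R := by
            rw [hR, mem_rim, cell_fst (by omega), cell_snd (by omega)]; omega
          refine ⟨_, hbR, (motion_eq_zero_iff.1 (hmotR _ hbR)).2, ?_⟩
          rw [co_cell (by omega) (by omega), co]
          simp only [abs_le]
          omega
        · intro c hc
          have hcl := freshCells_subset K A' l R hc
          rw [mem_deviating, ← hRS]
          refine ⟨Finset.mem_union_right _ hcl, fun hmot => ?_⟩
          have hfr := (fresh_of_mem_freshCells l R c hc).1
          rw [List.mem_toFinset, hl, mem_blockList (by omega) (by omega)] at hcl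
          have hbR : cell n x c.2 ∈ R := by
            rw [hR, mem_rim, cell_fst (by omega), cell_snd (by omega)]; omega
          have h3 := hfr _ hbR
          have h4 := (motion_eq_zero_iff.1 (hmotR _ hbR)).2
          have h5 := (motion_eq_zero_iff.1 hmot).2
          rw [co_cell (by omega) (by omega)] at h4
          have e1 := congrArg Prod.fst h4
          have e2 := congrArg Prod.snd h4
          have e3 := congrArg Prod.fst h5
          have e4 := congrArg Prod.snd h5
          simp only [Prod.fst_add, Prod.snd_add] at e1 e2 e3 e4
          have e5 : (co c).1 = ((c.1 : ℕ) : ℤ) := rfl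
          have e6 : (co c).2 = ((c.2 : ℕ) : ℤ) := rfl
          rcases h3 with h3 | h3 <;> rw [lt_abs] at h3 <;> omega
        · exact fun c hc b hb => (fresh_of_mem_freshCells l R c hc).1 b hb
        · exact fun c hc => (fresh_of_mem_freshCells l R c hc).2
      -- The shifted boundary has no defects, so all constraints come from the sweep.
      have hrR : rank R A' = 0 := by
        have h3 := rank_le_card_defects R A'
        have h4 : defects R A' = ∅ := by
          rw [Finset.eq_empty_iff_forall_notMem]
          intro e he
          obtain ⟨he1, he2⟩ := mem_defects.1 he
          obtain ⟨a1, a2, -, a4⟩ := mem_adjs.1 he1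
          obtain ⟨b1, b2⟩ := motion_eq_zero_iff.1 (hmotR _ a1)
          obtain ⟨b3, b4⟩ := motion_eq_zero_iff.1 (hmotR _ a2)
          refine he2 (mid_eq_iff.2 (Or.inr ⟨?_, ?_⟩))
          · rw [isNeighbor_iff] at a4 ⊢
            simp only [src, tgt, side, b1, sub_zero]
            rw [eq_sub_of_add_eq b4, a4, eq_sub_of_add_eq b2]
            abel
          · simp [src, tgt, side, b1, b3]
        rw [h4] at h3
        simpa using h3
      rw [hRS] at w1 w2
      have hrk : rank S A' = cc R A' - cc S A' := by
        have a1 := cc_anti (Finset.empty_subset R) A'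
        have a2 := cc_anti hRsub A'
        rw [rank] at hrR ⊢
        omega
      rw [← hrk] at w1 w2
      calc κ⁻¹ ^ rank S A' ≤ ((4 * n ^ 2 : ℕ) : ℝ)⁻¹ ^ (freshCells K l R A').card *
              t ^ (rank S A' - 2 * (freshCells K l R A').card) *
                (1 ^ (2 * (freshCells K l R A').card) *
                γ ^ (rank S A' - 2 * (freshCells K l R A').card)) := by
              refine pow_le_of_split ?_ hκ0 ?_ ?_ w1
              · have : 0 < n := by omega
                positivity
              · refine hP.sq_le.trans ?_
                gcongr
                · exact hP.β_nonneg
                · exact hP.β_le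
              · rw [hγ]; field_simp; exact le_rfl
        _ = weight K t l R A' * γ ^ (rank S A' - 2 * (freshCells K l R A').card) := by
              rw [w2, one_pow, one_mul]
        _ ≤ weight K t l R A' * γ ^ 3 := by
              gcongr _ * ?_
              exact pow_le_pow_of_le_one hγ0 hγ1 (by omega)
        _ = _ := mul_comm _ _
    refine hle.trans ?_
    rw [fillSum_const_mul, mul_comm]
    refine mul_le_mul_of_nonneg_right ?_ (by positivity)
    have hrem : ∀ c ∈ l, 1 ≤ x + k - (c.1 : ℕ) ∧ x + k - (c.1 : ℕ) ≤ w := by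
      intro c hc
      rw [hl, mem_blockList (by omega) (by omega)] at hc
      omega
    refine ((fillSum_weight_le hP.two_le ht hP.t_le (w ^ 2) w le_rfl le_rfl _ l R A₀ hsweep hA₀d
      hlen hrem).1).trans ?_
    refine one_add_pow_le_three (by positivity) (le_trans ?_ hP.small)
    have hll : (l.length : ℝ) ≤ (w : ℝ) ^ 2 := by
      have : l.length ≤ w ^ 2 := by omega
      exact_mod_cast this
    calc _ ≤ _ * (w : ℝ) ^ 2 := by gcongr
      _ = _ := by ring

/-- Within each rectangle whose boundary is shifted by `τ`, at most one piece deviates. -/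
def Rigid (v : ℕ) (τ : ℤ × ℤ) (A : Cell n → Tile n) : Prop :=
  ∀ x₁ x₂ y₁ y₂ : ℕ, x₁ < x₂ → x₂ < n → y₁ < y₂ → y₂ < n → x₂ < x₁ + v → y₂ < y₁ + v →
    (∀ b ∈ rim n x₁ x₂ y₁ y₂, motion A b = (0, τ)) →
    (deviating (rect n x₁ x₂ y₁ y₂) τ A).card ≤ 1

/-- The shifts by less than `r` in each coordinate. -/
noncomputable def shifts (r : ℕ) : Finset (ℤ × ℤ) := Finset.Ioo (-(r : ℤ)) r ×ˢ Finset.Ioo (-(r : ℤ)) r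

lemma card_shifts_le (r : ℕ) : (shifts r).card ≤ 4 * r ^ 2 := by
  rw [shifts, Finset.card_product, Int.card_Ioo]
  have : ((r : ℤ) - -(r : ℤ) - 1).toNat ≤ 2 * r := by omega
  nlinarith

lemma prob_not_rigid_le (hι : Function.Involutive ι) {w K : ℕ} {κ t β : ℝ}
    (hP : Admissible n w K κ t β) (hq : κ ≤ q) (hK : 2 * w ^ 2 + w ≤ K) :
    prob (fun ω : Carving n ι => ∃ A : Assembly n, IsSolution ω A ∧
      ∃ τ ∈ shifts w, ¬ Rigid w τ A.tile) ≤ 12 * n ^ 2 * w ^ 4 * (κ⁻¹ * t⁻¹) ^ 3 := by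
  classical
  let s : Finset ((ℤ × ℤ) × ℕ × ℕ × ℕ × ℕ) := (shifts w ×ˢ Finset.range n ×ˢ Finset.range w ×ˢ
    Finset.range n ×ˢ Finset.range w).filter fun i => 1 ≤ i.2.2.1 ∧ 1 ≤ i.2.2.2.2 ∧
      i.2.1 + i.2.2.1 < n ∧ i.2.2.2.1 + i.2.2.2.2 < n
  have h := prob_exists_finset_le_const s (fun i (ω : Carving n ι) => ∃ A : Assembly n,
    IsSolution ω A ∧ (∀ b ∈ rim n i.2.1 (i.2.1 + i.2.2.1) i.2.2.2.1 (i.2.2.2.1 + i.2.2.2.2),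
        motion A.tile b = (0, i.1)) ∧
      2 ≤ (deviating (rect n i.2.1 (i.2.1 + i.2.2.1) i.2.2.2.1 (i.2.2.2.1 + i.2.2.2.2)) i.1
        A.tile).card) (C := 3 * (κ⁻¹ * t⁻¹) ^ 3) (by
      rintro ⟨τ, x, k, y, m⟩ hi
      simp only [s, Finset.mem_filter, Finset.mem_product, Finset.mem_range] at hi
      exact prob_deviating_le hι hP hq hK τ hi.2.1 hi.2.2.1 hi.2.2.2.1 hi.2.2.2.2 hi.1.2.2.1
        hi.1.2.2.2.2)
  refine (prob_mono ?_).trans (h.trans ?_)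
  · rintro ω ⟨A, hA, τ, hτ, hn⟩
    simp only [Rigid, not_forall, not_le] at hn
    obtain ⟨x₁, x₂, y₁, y₂, h1, h2, h3, h4, h5, h6, h7, h8⟩ := hn
    refine ⟨(τ, x₁, x₂ - x₁, y₁, y₂ - y₁), ?_, A, hA, ?_⟩
    · simp only [s, Finset.mem_filter, Finset.mem_product, Finset.mem_range]
      exact ⟨⟨hτ, by omega, by omega, by omega, by omega⟩, by omega, by omega, by omega, by omega⟩
    · simp only [Nat.add_sub_cancel' h1.le, Nat.add_sub_cancel' h3.le]
      exact ⟨h7, h8⟩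
  · have hcard : (s.card : ℝ) ≤ 4 * w ^ 2 * (n ^ 2 * w ^ 2) := by
      have h1 : s.card ≤ (shifts w).card * (n * (w * (n * w))) := by
        refine (Finset.card_filter_le _ _).trans (le_of_eq ?_)
        simp only [Finset.card_product, Finset.card_range]
      have h2 := h1.trans (Nat.mul_le_mul_right _ (card_shifts_le w))
      calc (s.card : ℝ) ≤ ((4 * w ^ 2 * (n * (w * (n * w))) : ℕ) : ℝ) := by exact_mod_cast h2
        _ = _ := by push_cast; ring
    have ht := hP.t_pos
    have hκ0 : 0 < κ := by linarith [hP.one_le]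
    calc (s.card : ℝ) * (3 * (κ⁻¹ * t⁻¹) ^ 3) ≤
        (4 * w ^ 2 * (n ^ 2 * w ^ 2)) * (3 * (κ⁻¹ * t⁻¹) ^ 3) := by gcongr
      _ = _ := by ring

end InteriorEvent

/-! ### Exchanging duplicates in the inner part -/

section Shown

variable {n q : ℕ} {ι : Fin q → Fin q}

/-- On the inner cells, a rigid solution shows the planted carving, shifted. -/
lemma Anchored.shown_eq (hι : Function.Involutive ι) {ω : Carving n ι} {A : Assembly n}
    (hA : IsSolution ω A) {v w : ℕ} (hw : 2 * v ≤ w) {τ : ℤ × ℤ} (h : Anchored v (0, τ) A.tile)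
    (hR : Rigid w τ A.tile) {c : Cell n} (hc : Inner (2 * v) c) :
    ∃ p : Cell n, co p + τ = co c ∧ ∀ d, A.shown ω.1 c d = ω.1 p d := by
  obtain ⟨x₁, x₂, y₁, y₂, g1, g2, g3, g4, g5, g6, g7, g8, g9⟩ := h c hc
  have hcard := hR x₁ x₂ y₁ y₂ (by omega) g7 (by omega) g8 (by omega) (by omega) g9
  by_cases hm : motion A.tile c = (0, τ)
  · obtain ⟨h1, h2⟩ := motion_eq_zero_iff.1 hm
    refine ⟨_, h2, fun d => ?_⟩
    rw [A.shown_eq]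
    simp [Carving.jig, side, h1]
  have hcW : c ∈ deviating (rect n x₁ x₂ y₁ y₂) τ A.tile :=
    mem_deviating.2 ⟨by rw [mem_rect]; omega, hm⟩
  -- As `c` is the only deviating cell of the rectangle, its four neighbours are shifted by `τ`, and
  -- the sides they turn to `c` determine the four jigs shown there.
  have hnb : ∀ d, ∃ c', IsNeighbor c d c' ∧ motion A.tile c' = (0, τ) := by
    intro d
    obtain ⟨c', hc', hn⟩ := exists_neighbor_in_rect (n := n) (x := x₁) (k := x₂ - x₁) (y := y₁)
      (m := y₂ - y₁) (by omega) (by omega) (c := c) (by omega) d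
    rw [Nat.add_sub_cancel' (by omega), Nat.add_sub_cancel' (by omega)] at hc'
    refine ⟨c', hn, ?_⟩
    by_contra hne
    exact hn.ne (Finset.card_le_one.1 hcard _ hcW _ (mem_deviating.2 ⟨hc', hne⟩))
  -- The position `co c - τ` lies in the grid, because it is between those of the pieces at the
  -- eastern and western neighbours.
  have hp : ∃ p : Cell n, co p + τ = co c := by
    obtain ⟨e, he, hme⟩ := hnb 0
    obtain ⟨f, hf, hmf⟩ := hnb 2
    obtain ⟨-, he'⟩ := motion_eq_zero_iff.1 hme
    obtain ⟨-, hf'⟩ := motion_eq_zero_iff.1 hmf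
    rw [isNeighbor_iff] at he hf
    rw [he, step_zero] at he'
    rw [hf, step_two] at hf'
    set pe := (A.tile e).1
    set pf := (A.tile f).1
    have h1 := pe.1.isLt
    have e1 := congrArg Prod.fst he'
    have e2 := congrArg Prod.snd he'
    have f1 := congrArg Prod.fst hf'
    simp only [co, Prod.fst_add, Prod.snd_add] at e1 e2 f1
    have hlt : (pf.1 : ℕ) + 1 < n := by omega
    refine ⟨(⟨pf.1 + 1, hlt⟩, pe.2), Prod.ext ?_ ?_⟩
    · simp only [co, Prod.fst_add]; push_cast; omega
    · simp only [co, Prod.snd_add]; omega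
  obtain ⟨p, hp⟩ := hp
  refine ⟨p, hp, fun d => ?_⟩
  obtain ⟨c', hn, hm'⟩ := hnb d
  obtain ⟨h1, h2⟩ := motion_eq_zero_iff.1 hm'
  have hpn : IsNeighbor p d (A.tile c').1 := by
    rw [isNeighbor_iff] at hn ⊢
    rw [eq_sub_of_add_eq h2, hn, eq_sub_of_add_eq hp]; abel
  have k1 := hA c d c' hn
  have k2 : ω.1 (A.tile c').1 (d + 2) = ι (ω.1 p d) := ω.2 p d _ hpn
  have k3 : A.shown ω.1 c' (d + 2) = ω.1 (A.tile c').1 (d + 2) := by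
    rw [A.shown_eq]; simp [Carving.jig, side, h1]
  exact hι.injective (by rw [← k1, k3, k2])

/-- The corners of the enclosing rectangles come from planted positions within the grid. Inner cells
near two opposite corners of the grid thus bound `τ` from above and from below. -/
lemma Anchored.mem_shifts {A : Assembly n} {v : ℕ} {τ : ℤ × ℤ} (h : Anchored v (0, τ) A.tile)
    (hn : 4 * v < n) : τ ∈ shifts (2 * v) := by
  have key : ∀ c : Cell n, Inner (2 * v) c → ∃ x₁ x₂ y₁ y₂ : ℕ, x₁ < c.1 ∧ (c.1 : ℕ) < x₂ ∧
      y₁ < c.2 ∧ (c.2 : ℕ) < y₂ ∧ τ.1 ≤ x₁ ∧ τ.2 ≤ y₁ ∧ (x₂ : ℤ) < n + τ.1 ∧ (y₂ : ℤ) < n + τ.2 := by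
    intro c hc
    obtain ⟨x₁, x₂, y₁, y₂, g1, g2, g3, g4, g5, g6, g7, g8, g9⟩ := h c hc
    have : NeZero n := ⟨by omega⟩
    obtain ⟨-, k1⟩ := motion_eq_zero_iff.1 (g9 (cell n x₁ y₁) (by
      rw [mem_rim, cell_fst (by omega), cell_snd (by omega)]; omega))
    obtain ⟨-, k2⟩ := motion_eq_zero_iff.1 (g9 (cell n x₂ y₂) (by
      rw [mem_rim, cell_fst (by omega), cell_snd (by omega)]; omega))
    rw [co_cell (by omega) (by omega)] at k1 k2
    have a1 := congrArg Prod.fst k1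
    have a2 := congrArg Prod.snd k1
    have a3 := congrArg Prod.fst k2
    have a4 := congrArg Prod.snd k2
    simp only [co, Prod.fst_add, Prod.snd_add] at a1 a2 a3 a4
    have b1 := (A.tile (cell n x₂ y₂)).1.1.isLt
    have b2 := (A.tile (cell n x₂ y₂)).1.2.isLt
    exact ⟨x₁, x₂, y₁, y₂, g1, g2, g3, g4, by omega, by omega, by omega, by omega⟩
  have : NeZero n := ⟨by omega⟩
  obtain ⟨x₁, x₂, y₁, y₂, g1, g2, g3, g4, g5, g6, g7, g8⟩ := key (cell n (2 * v) (2 * v)) (by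
    rw [Inner, cell_fst (by omega), cell_snd (by omega)]; omega)
  obtain ⟨x₁', x₂', y₁', y₂', k1, k2, k3, k4, k5, k6, k7, k8⟩ :=
    key (cell n (n - 1 - 2 * v) (n - 1 - 2 * v)) (by
    rw [Inner, cell_fst (by omega), cell_snd (by omega)]; omega)
  rw [cell_fst (by omega)] at g1 g2 k1 k2
  rw [cell_snd (by omega)] at g3 g4 k3 k4
  simp only [shifts, Finset.mem_product, Finset.mem_Ioo]
  omega

open Classical in
/-- Exchange the piece lying at the cell `c` with the piece `p`. -/
noncomputable def Assembly.exchange (A : Assembly n) (c p : Cell n) : Assembly n where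
  pos := (Equiv.swap p (A.pos.symm c)).trans A.pos
  -- The piece from `c` takes over the former cell of `p`. With its own rotation it looks like the
  -- unrotated `p`, so the rotation of `p` has to be added.
  rot := fun x => if x = p then 0 else if x = A.pos.symm c then A.rot p + A.rot (A.pos.symm c)
    else A.rot x

lemma Assembly.exchange_tile_self (A : Assembly n) (c p : Cell n) :
    (A.exchange c p).tile c = (p, 0) := by
  simp [Assembly.tile, Assembly.exchange]

lemma Assembly.exchange_tile_of_ne (A : Assembly n) {c p b : Cell n} (h1 : b ≠ c)
    (h2 : A.pos.symm b ≠ p) : (A.exchange c p).tile b = A.tile b := by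
  have h3 : A.pos.symm b ≠ A.pos.symm c := fun h => h1 (A.pos.symm.injective h)
  simp [Assembly.tile, Assembly.exchange, Equiv.swap_apply_of_ne_of_ne h2 h3, h2, h3]

lemma Assembly.exchange_shown (A : Assembly n) {c p : Cell n} {f : Labelling n q}
    (h : ∀ d, A.shown f c d = f p d) : (A.exchange c p).shown f = A.shown f := by
  funext b d
  have hs : ∀ A : Assembly n, ∀ b d, A.shown f b d = f (A.tile b).1 (d - (A.tile b).2) :=
    fun _ _ _ => rfl
  by_cases hbc : b = c
  · subst hbc
    rw [h, hs, A.exchange_tile_self]; simp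
  by_cases hbp : A.pos.symm b = p
  · have hne : p ≠ A.pos.symm c := fun h' => hbc (A.pos.symm.injective (hbp.trans h'))
    have ht : (A.exchange c p).tile b = (A.pos.symm c, A.rot p + A.rot (A.pos.symm c)) := by
      simp [Assembly.tile, Assembly.exchange, hbp, hne.symm]
    rw [hs, ht]
    simp only [Assembly.shown, hbp] at h ⊢
    rw [← h (d - A.rot p)]
    congr 1; ring
  · rw [hs, A.exchange_tile_of_ne hbc hbp]; rfl

/-- Exchanging duplicates, we can put the pieces which are shown in the right places. -/
lemma exists_motion_of_shown (I : Finset (Cell n)) (f : Labelling n q) (τ : ℤ × ℤ) (g : Labelling n q)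
    (h : ∀ c ∈ I, ∃ p : Cell n, co p + τ = co c ∧ ∀ d, g c d = f p d) :
    ∀ (N : ℕ) (A : Assembly n), A.shown f = g → (deviating I τ A.tile).card ≤ N →
      ∃ A' : Assembly n, A'.shown f = g ∧ ∀ c ∈ I, motion A'.tile c = (0, τ) := by
  intro N
  induction N with
  | zero =>
    intro A hA hc
    refine ⟨A, hA, fun c hcI => ?_⟩
    by_contra hne
    have := Finset.card_pos.2 ⟨c, mem_deviating.2 ⟨hcI, hne⟩⟩
    omega
  | succ N ih =>
    intro A hA hc
    by_cases hex : ∃ c ∈ I, motion A.tile c ≠ (0, τ)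
    · obtain ⟨c, hcI, hne⟩ := hex
      obtain ⟨p, hp, hpd⟩ := h c hcI
      refine ih (A.exchange c p) ((A.exchange_shown fun d => by rw [hA, hpd]).trans hA) ?_
      -- The exchange repairs `c` and disturbs no correct cell of `I`: the former cell of `p` was
      -- not correct, since `p` belongs at `c`.
      have hlt : deviating I τ (A.exchange c p).tile ⊂ deviating I τ A.tile := by
        have hgood : motion (A.exchange c p).tile c = (0, τ) := by
          rw [motion_eq_zero_iff, A.exchange_tile_self]
          exact ⟨rfl, hp⟩
        refine (Finset.ssubset_iff_of_subset ?_).2 ⟨c, mem_deviating.2 ⟨hcI, hne⟩, fun h' =>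
          (mem_deviating.1 h').2 hgood⟩
        intro b hb
        rw [mem_deviating] at hb ⊢
        refine ⟨hb.1, fun hmb => hb.2 ?_⟩
        have hbc : b ≠ c := by rintro rfl; exact hb.2 hgood
        have hbp : A.pos.symm b ≠ p := by
          intro e
          have := (motion_eq_zero_iff.1 hmb).2
          rw [Assembly.tile, e, hp] at this
          exact hbc (co_injective this.symm)
        rw [motion, A.exchange_tile_of_ne hbc hbp]
        exact hmb
      have := Finset.card_lt_card hlt
      omega
    · push Not at hex
      exact ⟨A, hA, hex⟩

end Shown

/-! ### Similarity and rotations of what is shown -/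

section Similar

variable {n q : ℕ} {ι : Fin q → Fin q}

/-- A labelling of the grid after a quarter turn. -/
def turnLabelling (f : Labelling n q) : Labelling n q :=
  fun p d => f ((Jigsaw.turn n).symm p) (d - 1)

lemma Assembly.shown_turn_eq (A : Assembly n) (f : Labelling n q) :
    A.turn.shown f = turnLabelling (A.shown f) := by
  funext p d
  obtain ⟨c, rfl⟩ := (Jigsaw.turn n).surjective p
  obtain ⟨d, rfl⟩ : ∃ e, d = e + 1 := ⟨d - 1, by simp⟩
  rw [A.shown_turn]
  simp [turnLabelling]

lemma Assembly.shown_turn_iterate (A : Assembly n) (f : Labelling n q) (k : ℕ) :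
    (Assembly.turn^[k] A).shown f = turnLabelling^[k] (A.shown f) := by
  induction k with
  | zero => rfl
  | succ k ih =>
    rw [Function.iterate_succ_apply', Function.iterate_succ_apply', Assembly.shown_turn_eq, ih]

lemma turnLabelling_four (f : Labelling n q) : turnLabelling^[4] f = f := by
  funext p d
  simp only [Function.iterate_succ_apply, Function.iterate_zero_apply, turnLabelling,
    Jigsaw.turn, Equiv.coe_fn_symm_mk, Fin.rev_rev]
  congr 1
  revert d; decide

lemma turnLabelling_mul_four (f : Labelling n q) (m : ℕ) : turnLabelling^[4 * m] f = f := by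
  rw [Function.iterate_mul]
  exact Function.iterate_fixed (turnLabelling_four f) m

lemma turnLabelling_mod (f : Labelling n q) (k : ℕ) :
    turnLabelling^[k % 4] f = turnLabelling^[k] f := by
  conv_rhs => rw [← Nat.mod_add_div k 4, Function.iterate_add_apply, turnLabelling_mul_four]

/-- If each solution shows the planted carving up to a rotation, then all solutions are similar. -/
lemma allSolutionsSimilar_of_shown {ω : Carving n ι}
    (h : ∀ A, IsSolution ω A → ∃ k < 4, (Assembly.turn^[k] A).shown ω.1 = ω.1) :
    AllSolutionsSimilar ω := by
  intro A B hA hB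
  obtain ⟨k, hk, h1⟩ := h A hA
  obtain ⟨l, hl, h2⟩ := h B hB
  refine ⟨(4 - l + k) % 4, Nat.mod_lt _ (by omega), ?_⟩
  rw [Assembly.shown_turn_iterate] at *
  rw [turnLabelling_mod, Function.iterate_add_apply, h1]
  conv_lhs => rw [← h2]
  rw [← Function.iterate_add_apply, Nat.sub_add_cancel hl.le, turnLabelling_four]

end Similar

/-! ### Touched edges next to shifted pieces -/

section Touched

variable {n : ℕ}

/-- The edge with twice the midpoint `m` is related to another edge. -/
def Touched (S : Finset (Cell n)) (A : Cell n → Tile n) (m : ℤ × ℤ) : Prop :=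
  ∃ h g, mid h = m ∧ mid g ≠ m ∧ rel S A h g

lemma touched_of_ne {S : Finset (Cell n)} {A : Cell n → Tile n} {c c' : Cell n} (hc : c ∈ S)
    (hc' : c' ∈ S) {d : ZMod 4} (hn : IsNeighbor c d c')
    (h : mid (side (A c) d) ≠ mid (side (A c') (d + 2))) :
    Touched S A (mid (side (A c) d)) ∧ Touched S A (mid (side (A c') (d + 2))) :=
  have hr := rel_of_neighbor hc hc' hn
  ⟨⟨_, _, rfl, h.symm, hr⟩, ⟨_, _, rfl, h, (rel S A).symm hr⟩⟩

/-- The touching sides of the pieces at `c` and `b` lie on different edges, and both edges are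
touched. The one at `b` is the edge that a shifted piece at `c` would have there. -/
lemma touched_of_motion_ne {S : Finset (Cell n)} {A : Cell n → Tile n} (hA : DistinctOn S A)
    {c b : Cell n} (hc : c ∈ S) (hb : b ∈ S) {d : ZMod 4} (hn : IsNeighbor c d b) {τ : ℤ × ℤ}
    (hcm : motion A c ≠ (0, τ)) (hbm : motion A b = (0, τ)) :
    Touched S A (co c - τ + (co c - τ) + step d) ∧ Touched S A (mid (side (A c) d)) := by
  have hne : mid (side (A c) d) ≠ mid (side (A b) (d + 2)) := fun e =>
    hcm (hbm ▸ (motion_eq_of_neighbor hA hc hb hn e).symm)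
  obtain ⟨h1, h2⟩ := touched_of_ne hc hb hn hne
  refine ⟨?_, h1⟩
  obtain ⟨k1, k2⟩ := motion_eq_zero_iff.1 hbm
  have e : mid (side (A b) (d + 2)) = co c - τ + (co c - τ) + step d := by
    rw [isNeighbor_iff] at hn
    rw [mid, side_fst, show (side (A b) (d + 2)).2 = d + 2 by simp [side, k1],
      eq_sub_of_add_eq k2, hn, step_add_two]
    abel
  rwa [← e]

lemma mid_near (x : Tile n) (d : ZMod 4) : |(mid (side x d)).1 - 2 * (co x.1).1| ≤ 1 ∧
    |(mid (side x d)).2 - 2 * (co x.1).2| ≤ 1 := by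
  obtain ⟨h1, h2⟩ := step_abs_le (side x d).2
  rw [abs_le] at *
  simp only [mid, side_fst, Prod.fst_add, Prod.snd_add]
  rw [abs_le]
  omega

/-- A lower bound for the rank from the touched edges near `u` and at two pieces which are far from
`u` and from each other. -/
lemma card_le_two_mul_rank {S : Finset (Cell n)} {A : Cell n → Tile n} {u : ℤ × ℤ}
    {O : Finset (ℤ × ℤ)} (hO : ∀ s ∈ O, |s.1| ≤ 3 ∧ |s.2| ≤ 3 ∧ Touched S A (u + u + s))
    {x y : Tile n} {DX DY : Finset (ZMod 4)} (hX : ∀ d ∈ DX, Touched S A (mid (side x d)))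
    (hY : ∀ d ∈ DY, Touched S A (mid (side y d))) (hux : DX.Nonempty → Far 4 u (co x.1))
    (huy : DY.Nonempty → Far 4 u (co y.1))
    (hxy : DX.Nonempty → DY.Nonempty → Far 4 (co x.1) (co y.1)) :
    O.card + DX.card + DY.card ≤ 2 * rank S A := by
  classical
  have hinj : ∀ x : Tile n, Function.Injective fun d => mid (side x d) := fun x d e h => by
    have h' : mid ((x.1, d - x.2) : Tile n) = mid ((x.1, e - x.2) : Tile n) := h
    simpa using mid_same_piece h'
  have h := card_touched_le S A (O.image (fun s => u + u + s) ∪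
    (DX.image (fun d => mid (side x d)) ∪ DY.image (fun d => mid (side y d)))) (by
      intro m hm
      simp only [Finset.mem_union, Finset.mem_image] at hm
      rcases hm with ⟨s, hs, rfl⟩ | ⟨d, hd, rfl⟩ | ⟨d, hd, rfl⟩
      exacts [(hO s hs).2.2, hX d hd, hY d hd])
  rw [Finset.card_union_of_disjoint, Finset.card_union_of_disjoint,
    Finset.card_image_of_injective _ (hinj x), Finset.card_image_of_injective _ (hinj y),
    Finset.card_image_of_injective _ (add_right_injective _)] at h
  · omega
  · rw [Finset.disjoint_left]
    intro m hm hm'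
    obtain ⟨d, hd, rfl⟩ := Finset.mem_image.1 hm
    obtain ⟨e, he, heq⟩ := Finset.mem_image.1 hm'
    obtain ⟨a1, a2⟩ := mid_near x d
    obtain ⟨b1, b2⟩ := mid_near y e
    rw [heq] at b1 b2
    have hf := hxy ⟨d, hd⟩ ⟨e, he⟩
    rw [abs_le] at a1 a2 b1 b2
    rcases hf with hf | hf <;> rw [lt_abs] at hf <;> omega
  · rw [Finset.disjoint_left]
    intro m hm hm'
    obtain ⟨s, hs, rfl⟩ := Finset.mem_image.1 hm
    obtain ⟨s1, s2, -⟩ := hO s hs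
    rw [abs_le] at s1 s2
    rcases Finset.mem_union.1 hm' with hm' | hm'
    · obtain ⟨e, he, heq⟩ := Finset.mem_image.1 hm'
      obtain ⟨b1, b2⟩ := mid_near x e
      rw [heq] at b1 b2
      simp only [Prod.fst_add, Prod.snd_add] at b1 b2
      rw [abs_le] at b1 b2
      rcases hux ⟨e, he⟩ with hf | hf <;> rw [lt_abs] at hf <;> omega
    · obtain ⟨e, he, heq⟩ := Finset.mem_image.1 hm'
      obtain ⟨b1, b2⟩ := mid_near y e
      rw [heq] at b1 b2
      simp only [Prod.fst_add, Prod.snd_add] at b1 b2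
      rw [abs_le] at b1 b2
      rcases huy ⟨e, he⟩ with hf | hf <;> rw [lt_abs] at hf <;> omega

end Touched

/-! ### Union bounds over one or two pieces -/

section LocalProbability

variable {n q : ℕ} {ι : Fin q → Fin q}

/-- The event prescribes the pieces on `S`, so it concerns a single placement and no union bound is
needed. -/
lemma prob_exists_solution_le (hι : Function.Involutive ι) {κ : ℝ} (hκ : 1 ≤ κ) (hq : κ ≤ q)
    (S : Finset (Cell n)) (Q : Assembly n → Prop) (ρ : ℕ) (hQ : ∀ A, Q A → ρ ≤ rank S A.tile)
    (hdet : ∀ A A', Q A → Q A' → ∀ c ∈ S, A.tile c = A'.tile c) :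
    prob (fun ω : Carving n ι => ∃ A, IsSolution ω A ∧ Q A) ≤ κ⁻¹ ^ ρ := by
  by_cases hex : ∃ A, Q A
  · obtain ⟨A₀, hA₀⟩ := hex
    refine (prob_mono ?_).trans ((prob_fitsOn_le hι (by linarith) hq S A₀.tile).trans
      (pow_le_pow_of_le_one (by positivity) (inv_le_one_of_one_le₀ hκ) (hQ A₀ hA₀)))
    rintro ω ⟨A, hA, hQA⟩ c hc c' hc' d hd
    rw [← hdet A A₀ hQA hA₀ c hc, ← hdet A A₀ hQA hA₀ c' hc']
    exact hA.fitsOn S c hc c' hc' d hd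
  · refine (prob_mono (F := fun _ => False) ?_).trans (prob_false.le.trans (by positivity))
    rintro ω ⟨A, -, hQA⟩
    exact hex ⟨A, hQA⟩

open Classical in
lemma sum_ite_le {α : Type*} [Fintype α] (s : Finset α) (F : α → Prop) {M : ℕ}
    (hM : (Finset.univ.filter fun y => ¬ F y).card ≤ M) {a : ℝ} (ha : 0 ≤ a) :
    ∑ y ∈ s, a ^ (if F y then 1 else 0) ≤ s.card * a + M := by
  have h1 : ∀ y ∈ s, a ^ (if F y then 1 else 0) ≤ a + if ¬ F y then 1 else 0 := by
    intro y _
    by_cases hF : F y <;> simp [hF, ha]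
  refine (Finset.sum_le_sum h1).trans ?_
  rw [Finset.sum_add_distrib, Finset.sum_const, nsmul_eq_mul, Finset.sum_boole]
  have h2 : ((s.filter fun y => ¬ F y).card : ℝ) ≤ M := by
    exact_mod_cast (Finset.card_le_card (Finset.filter_subset_filter _ (Finset.subset_univ s))).trans hM
  linarith

open Classical in
/-- A union bound over the pieces placed at two cells. -/
lemma prob_exists_pair_le (hι : Function.Involutive ι) {κ : ℝ} (hκ : 1 ≤ κ) (hq : κ ≤ q)
    (S : Finset (Cell n)) (Q : Assembly n → Prop) (c c₁ : Cell n) (T : Finset (Tile n)) (ρ M : ℕ)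
    (FX : Tile n → Prop) (FY : Tile n → Tile n → Prop)
    (hX : (Finset.univ.filter fun x => ¬ FX x).card ≤ M)
    (hY : ∀ x, (Finset.univ.filter fun y => ¬ FY x y).card ≤ M)
    (hT : ∀ A, Q A → A.tile c ∈ T ∧ A.tile c₁ ∈ T)
    (hQ : ∀ A, Q A → ρ + ((if FX (A.tile c) then 1 else 0) +
      (if FY (A.tile c) (A.tile c₁) then 1 else 0)) ≤ rank S A.tile)
    (hdet : ∀ A A', Q A → Q A' → A.tile c = A'.tile c → A.tile c₁ = A'.tile c₁ →
      ∀ b ∈ S, A.tile b = A'.tile b) :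
    prob (fun ω : Carving n ι => ∃ A, IsSolution ω A ∧ Q A) ≤
      κ⁻¹ ^ ρ * (T.card * κ⁻¹ + M) ^ 2 := by
  have hκ0 : 0 ≤ κ⁻¹ := by positivity
  have h1 : prob (fun ω : Carving n ι => ∃ A, IsSolution ω A ∧ Q A) ≤
      ∑ x ∈ T, ∑ y ∈ T, prob (fun ω : Carving n ι => ∃ A, IsSolution ω A ∧
        (Q A ∧ A.tile c = x ∧ A.tile c₁ = y)) := by
    refine le_trans (prob_mono ?_) ((prob_exists_finset_le T (fun x (ω : Carving n ι) =>
      ∃ y ∈ T, ∃ A, IsSolution ω A ∧ (Q A ∧ A.tile c = x ∧ A.tile c₁ = y))).trans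
        (Finset.sum_le_sum fun x _ => prob_exists_finset_le T _))
    rintro ω ⟨A, hA, hQA⟩
    exact ⟨_, (hT A hQA).1, _, (hT A hQA).2, A, hA, hQA, rfl, rfl⟩
  refine h1.trans ?_
  have h2 : ∀ x ∈ T, ∀ y ∈ T, prob (fun ω : Carving n ι => ∃ A, IsSolution ω A ∧
      (Q A ∧ A.tile c = x ∧ A.tile c₁ = y)) ≤
      κ⁻¹ ^ ρ * (κ⁻¹ ^ (if FX x then 1 else 0) * κ⁻¹ ^ (if FY x y then 1 else 0)) := by
    intro x _ y _
    rw [← pow_add, ← pow_add]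
    refine prob_exists_solution_le hι hκ hq S _ _ ?_ ?_
    · rintro A ⟨hA, rfl, rfl⟩
      exact hQ A hA
    · rintro A A' ⟨hA, e1, e2⟩ ⟨hA', e1', e2'⟩
      exact hdet A A' hA hA' (e1.trans e1'.symm) (e2.trans e2'.symm)
  refine (Finset.sum_le_sum fun x hx => Finset.sum_le_sum fun y hy => h2 x hx y hy).trans ?_
  simp only [← Finset.mul_sum]
  refine mul_le_mul_of_nonneg_left ?_ (by positivity)
  have h3 : ∀ x ∈ T, κ⁻¹ ^ (if FX x then 1 else 0) * ∑ y ∈ T, κ⁻¹ ^ (if FY x y then 1 else 0) ≤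
      κ⁻¹ ^ (if FX x then 1 else 0) * (T.card * κ⁻¹ + M) := fun x _ =>
    mul_le_mul_of_nonneg_left (sum_ite_le T (FY x) (hY x) hκ0) (by positivity)
  refine (Finset.sum_le_sum h3).trans ?_
  rw [← Finset.sum_mul, pow_two]
  exact mul_le_mul_of_nonneg_right (sum_ite_le T FX hX hκ0) (by positivity)

end LocalProbability

/-! ### The first break of a line parallel to the boundary -/

section Corners

variable {n q : ℕ} {ι : Fin q → Fin q}

/-- The cells at distance less than `r` from the boundary. -/
noncomputable def outer (n r : ℕ) : Finset (Cell n) := by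
  classical exact Finset.univ.filter fun c => ¬ Inner r c

lemma mem_outer {r : ℕ} {c : Cell n} : c ∈ outer n r ↔ ¬ Inner r c := by simp [outer]

/-- The cell `c` is the first one along the side with outer normal `D` where the assembly deviates
from the shift by `τ`, and it has a successor `c₁`. -/
def BreakMiddle (r : ℕ) (τ : ℤ × ℤ) (D : ZMod 4) (c : Cell n) (A : Assembly n) : Prop :=
  ∃ b l c₁ b₁, IsNeighbor c (D + 2) b ∧ IsNeighbor c (D + 3) l ∧ IsNeighbor c (D + 1) c₁ ∧
    IsNeighbor c₁ (D + 2) b₁ ∧ motion A.tile b = (0, τ) ∧ motion A.tile l = (0, τ) ∧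
    motion A.tile b₁ = (0, τ) ∧ motion A.tile c ≠ (0, τ) ∧ (A.tile c).1 ∈ outer n r ∧
    (A.tile c₁).1 ∈ outer n r

/-- The variant at the start of a line, where no predecessor is available. Its weaker bound suffices
since it is only needed close to the corners of the grid. -/
def BreakFirst (r : ℕ) (τ : ℤ × ℤ) (D : ZMod 4) (c : Cell n) (A : Assembly n) : Prop :=
  ∃ b c₁ b₁, IsNeighbor c (D + 2) b ∧ IsNeighbor c (D + 1) c₁ ∧
    IsNeighbor c₁ (D + 2) b₁ ∧ motion A.tile b = (0, τ) ∧
    motion A.tile b₁ = (0, τ) ∧ motion A.tile c ≠ (0, τ) ∧ (A.tile c).1 ∈ outer n r ∧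
    (A.tile c₁).1 ∈ outer n r

/-- The variant at the end of a line, where there is no successor. -/
def BreakLast (r : ℕ) (τ : ℤ × ℤ) (D : ZMod 4) (c : Cell n) (A : Assembly n) : Prop :=
  ∃ b l, IsNeighbor c (D + 2) b ∧ IsNeighbor c (D + 3) l ∧ motion A.tile b = (0, τ) ∧
    motion A.tile l = (0, τ) ∧ motion A.tile c ≠ (0, τ) ∧ (A.tile c).1 ∈ outer n r

lemma tile_eq_of_motion {A A' : Assembly n} {τ : ℤ × ℤ} {b : Cell n}
    (h : motion A.tile b = (0, τ)) (h' : motion A'.tile b = (0, τ)) : A.tile b = A'.tile b := by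
  obtain ⟨h1, h2⟩ := motion_eq_zero_iff.1 h
  obtain ⟨h3, h4⟩ := motion_eq_zero_iff.1 h'
  exact Prod.ext (co_injective (add_right_cancel (h2.trans h4.symm))) (h1.trans h3.symm)

/-- The touched edges at a deviating cell with a successor. -/
lemma touched_successor {S : Finset (Cell n)} {A : Cell n → Tile n} (hA : DistinctOn S A)
    {τ : ℤ × ℤ} {D : ZMod 4} {c c₁ b₁ : Cell n} (hc : c ∈ S) (hc₁ : c₁ ∈ S) (hb₁ : b₁ ∈ S)
    (hn : IsNeighbor c (D + 1) c₁) (hn₁ : IsNeighbor c₁ (D + 2) b₁)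
    (hm₁ : motion A b₁ = (0, τ)) (hm : motion A c ≠ (0, τ)) :
    (∃ s, (s = step (D + 1) ∨ s = step (D + 1) + step (D + 1) + step (D + 2)) ∧
      Touched S A (co c - τ + (co c - τ) + s)) ∧
    (Far 4 (co c - τ) (co (A c₁).1) → Touched S A (mid (side (A c₁) (D + 2)))) ∧
    (Far 4 (co (A c).1) (co (A c₁).1) → Touched S A (mid (side (A c₁) (D + 3)))) := by
  have hco : co c₁ = co c + step (D + 1) := hn
  refine ⟨?_, ?_, ?_⟩
  -- A third touched edge close to `co c - τ` exists in any case: between `c` and a shifted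
  -- successor, or else below a deviating successor.
  · by_cases h : motion A c₁ = (0, τ)
    · exact ⟨_, Or.inl rfl, (touched_of_motion_ne hA hc hc₁ hn hm h).1⟩
    · refine ⟨_, Or.inr rfl, ?_⟩
      have := (touched_of_motion_ne hA hc₁ hb₁ hn₁ h hm₁).1
      rw [hco] at this
      convert this using 1
      abel
  · intro hf
    refine (touched_of_motion_ne hA hc₁ hb₁ hn₁ (fun h => ?_) hm₁).2
    have h2 := (motion_eq_zero_iff.1 h).2
    rw [eq_sub_of_add_eq h2, hco] at hf
    obtain ⟨h3, h4⟩ := step_abs_le (D + 1)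
    rw [abs_le] at h3 h4
    rcases hf with hf | hf <;>
    · simp only [Prod.fst_add, Prod.snd_add, Prod.fst_sub, Prod.snd_sub] at hf
      rw [lt_abs] at hf
      omega
  · intro hf
    have h2 : mid (side (A c) (D + 1)) ≠ mid (side (A c₁) (D + 1 + 2)) := by
      intro e
      obtain ⟨a1, a2⟩ := mid_near (A c) (D + 1)
      obtain ⟨a3, a4⟩ := mid_near (A c₁) (D + 1 + 2)
      rw [← e] at a3 a4
      rw [abs_le] at a1 a2 a3 a4
      rcases hf with hf | hf <;> rw [lt_abs] at hf <;> omega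
    have := (touched_of_ne hc hc₁ hn h2).2
    rwa [show D + 1 + 2 = D + 3 by ring] at this

open Classical in
/-- Few pieces are close to `u` or `v`. -/
lemma card_near_pair_le (u v : ℤ × ℤ) :
    (Finset.univ.filter fun y : Tile n => ¬ (Far 4 u (co y.1) ∧ Far 4 v (co y.1))).card ≤ 648 := by
  have h : (Finset.univ.filter fun y : Tile n => ¬ (Far 4 u (co y.1) ∧ Far 4 v (co y.1))) ⊆
      (Finset.univ.filter fun y : Tile n => ¬ Far 4 u (co y.1)) ∪
      (Finset.univ.filter fun y : Tile n => ¬ Far 4 v (co y.1)) := by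
    intro y hy
    simp only [Finset.mem_union, Finset.mem_filter, Finset.mem_univ, true_and] at hy ⊢
    tauto
  have h1 := (Finset.card_le_card h).trans (Finset.card_union_le _ _)
  -- At most `9 ^ 2` cells, in four rotations, are close to either point, and `648 = 2 * 4 * 9 ^ 2`.
  have h2 := card_not_far_le (n := n) 4 u
  have h3 := card_not_far_le (n := n) 4 v
  omega

lemma offsets_card : ∀ D s : _, (s = step (D + 1) ∨ s = step (D + 1) + step (D + 1) + step (D + 2)) →
    ({step (D + 2), s} : Finset (ℤ × ℤ)).card = 2 ∧
    ({step (D + 2), step (D + 3), s} : Finset (ℤ × ℤ)).card = 3 ∧ |s.1| ≤ 3 ∧ |s.2| ≤ 3 := by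
  rintro D s (rfl | rfl) <;> revert D <;> decide

lemma card_pair_dirs : ∀ D : ZMod 4, ({D + 2, D + 3} : Finset (ZMod 4)).card = 2 := by decide

lemma card_pair_steps : ∀ D : ZMod 4, ({step (D + 2), step (D + 3)} : Finset (ℤ × ℤ)).card = 2 := by
  decide

lemma step_abs_le_three (d : ZMod 4) : |(step d).1| ≤ 3 ∧ |(step d).2| ≤ 3 :=
  ⟨(step_abs_le d).1.trans (by norm_num), (step_abs_le d).2.trans (by norm_num)⟩

/-- The pieces in the outer part, with their rotations. -/
noncomputable def outerTiles (n r : ℕ) : Finset (Tile n) := outer n r ×ˢ Finset.univ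

-- There are three touched edges at the break, and two more for each of the pieces at `c` and `c₁`
-- that lies far away. Halving the number and rounding up, the rank is at least two, plus one for
-- each far piece. So a far piece, of which there are `(outerTiles n r).card` at most, costs a
-- factor `κ⁻¹`, and there are at most `648` near ones.
open Classical in
lemma prob_breakMiddle_le (hι : Function.Involutive ι) {κ : ℝ} (hκ : 1 ≤ κ) (hq : κ ≤ q)
    (r : ℕ) (τ : ℤ × ℤ) (D : ZMod 4) (c : Cell n) :
    prob (fun ω : Carving n ι => ∃ A, IsSolution ω A ∧ BreakMiddle r τ D c A) ≤
      κ⁻¹ ^ 2 * ((outerTiles n r).card * κ⁻¹ + 648) ^ 2 := by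
  by_cases hex : ∃ b l c₁ b₁ : Cell n, IsNeighbor c (D + 2) b ∧ IsNeighbor c (D + 3) l ∧
      IsNeighbor c (D + 1) c₁ ∧ IsNeighbor c₁ (D + 2) b₁
  swap
  · refine (prob_mono (F := fun _ => False) ?_).trans (prob_false.le.trans (by positivity))
    rintro ω ⟨A, -, b, l, c₁, b₁, h1, h2, h3, h4, -⟩
    exact hex ⟨b, l, c₁, b₁, h1, h2, h3, h4⟩
  obtain ⟨b, l, c₁, b₁, n1, n2, n3, n4⟩ := hex
  have key : ∀ A : Assembly n, BreakMiddle r τ D c A → motion A.tile b = (0, τ) ∧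
      motion A.tile l = (0, τ) ∧ motion A.tile b₁ = (0, τ) ∧ motion A.tile c ≠ (0, τ) ∧
      (A.tile c).1 ∈ outer n r ∧ (A.tile c₁).1 ∈ outer n r := by
    rintro A ⟨b', l', c₁', b₁', m1, m2, m3, m4, h⟩
    obtain rfl := n1.unique m1
    obtain rfl := n2.unique m2
    obtain rfl := n3.unique m3
    obtain rfl := n4.unique m4
    exact h
  refine (prob_exists_pair_le hι hκ hq {b, l, c, c₁, b₁} (BreakMiddle r τ D c) c c₁
    (outerTiles n r) 2 648 (fun x => Far 4 (co c - τ) (co x.1) ∧ Far 4 (co c - τ) (co x.1))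
    (fun x y => Far 4 (co c - τ) (co y.1) ∧ Far 4 (co x.1) (co y.1)) ?_ ?_ ?_ ?_ ?_).trans
    (le_of_eq (by push_cast; ring))
  · convert card_near_pair_le (n := n) (co c - τ) (co c - τ)
  · intro x
    convert card_near_pair_le (n := n) (co c - τ) (co x.1)
  · intro A hA
    obtain ⟨-, -, -, -, h5, h6⟩ := key A hA
    exact ⟨by simpa [outerTiles] using h5, by simpa [outerTiles] using h6⟩
  · intro A hA
    obtain ⟨h1, h2, h3, h4, -, -⟩ := key A hA
    set S : Finset (Cell n) := {b, l, c, c₁, b₁} with hS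
    have hd := A.distinctOn_tile S
    have mb : b ∈ S := by simp [hS]
    have ml : l ∈ S := by simp [hS]
    have mc : c ∈ S := by simp [hS]
    have mc₁ : c₁ ∈ S := by simp [hS]
    have mb₁ : b₁ ∈ S := by simp [hS]
    obtain ⟨t1, s1⟩ := touched_of_motion_ne hd mc mb n1 h4 h1
    obtain ⟨t2, s2⟩ := touched_of_motion_ne hd mc ml n2 h4 h2
    obtain ⟨⟨s, hs, t3⟩, u1, u2⟩ := touched_successor hd mc mc₁ mb₁ n3 n4 h3 h4
    obtain ⟨-, o2, o3, o4⟩ := offsets_card D s hs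
    have hO : ∀ s' ∈ ({step (D + 2), step (D + 3), s} : Finset (ℤ × ℤ)), |s'.1| ≤ 3 ∧ |s'.2| ≤ 3 ∧
        Touched S A.tile (co c - τ + (co c - τ) + s') := by
      intro s' hs'
      simp only [Finset.mem_insert, Finset.mem_singleton] at hs'
      rcases hs' with rfl | rfl | rfl
      · exact ⟨(step_abs_le_three _).1, (step_abs_le_three _).2, t1⟩
      · exact ⟨(step_abs_le_three _).1, (step_abs_le_three _).2, t2⟩
      · exact ⟨o3, o4, t3⟩
    have hcard := card_pair_dirs D
    have hXt : ∀ d ∈ ({D + 2, D + 3} : Finset (ZMod 4)), Touched S A.tile (mid (side (A.tile c) d)) := by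
      intro d hd
      simp only [Finset.mem_insert, Finset.mem_singleton] at hd
      rcases hd with rfl | rfl
      exacts [s1, s2]
    have hYt : (Far 4 (co c - τ) (co (A.tile c₁).1) ∧ Far 4 (co (A.tile c).1) (co (A.tile c₁).1)) →
        ∀ d ∈ ({D + 2, D + 3} : Finset (ZMod 4)), Touched S A.tile (mid (side (A.tile c₁) d)) := by
      intro hf d hd
      simp only [Finset.mem_insert, Finset.mem_singleton] at hd
      rcases hd with rfl | rfl
      exacts [u1 hf.1, u2 hf.2]
    have hem : ∀ x : Tile n, ∀ d ∈ (∅ : Finset (ZMod 4)), Touched S A.tile (mid (side x d)) := by simp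
    have hne : ¬ (∅ : Finset (ZMod 4)).Nonempty := by simp
    split_ifs with hx hy hy
    · have := card_le_two_mul_rank hO hXt (hYt hy) (fun _ => hx.1) (fun _ => hy.1) fun _ _ => hy.2
      omega
    · have := card_le_two_mul_rank hO hXt (hem (A.tile c₁)) (fun _ => hx.1)
        (fun h => absurd h hne) (fun _ h => absurd h hne)
      omega
    · have := card_le_two_mul_rank hO (hem (A.tile c)) (hYt hy) (fun h => absurd h hne)
        (fun _ => hy.1) (fun h => absurd h hne)
      omega
    · have := card_le_two_mul_rank hO (hem (A.tile c)) (hem (A.tile c₁)) (fun h => absurd h hne)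
        (fun h => absurd h hne) (fun h => absurd h hne)
      omega
  · intro A A' hA hA' e1 e2 x hx
    obtain ⟨h1, h2, h3, -⟩ := key A hA
    obtain ⟨k1, k2, k3, -⟩ := key A' hA'
    simp only [Finset.mem_insert, Finset.mem_singleton] at hx
    rcases hx with rfl | rfl | rfl | rfl | rfl
    exacts [tile_eq_of_motion h1 k1, tile_eq_of_motion h2 k2, e1, e2, tile_eq_of_motion h3 k3]

-- Without a predecessor there remain two touched edges at the break and one at the first piece if
-- it is far, besides the two at a far successor. The rank is still at least one plus the number of
-- far pieces.
open Classical in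
lemma prob_breakFirst_le (hι : Function.Involutive ι) {κ : ℝ} (hκ : 1 ≤ κ) (hq : κ ≤ q)
    (r : ℕ) (τ : ℤ × ℤ) (D : ZMod 4) (c : Cell n) :
    prob (fun ω : Carving n ι => ∃ A, IsSolution ω A ∧ BreakFirst r τ D c A) ≤
      κ⁻¹ * ((outerTiles n r).card * κ⁻¹ + 648) ^ 2 := by
  by_cases hex : ∃ b c₁ b₁ : Cell n, IsNeighbor c (D + 2) b ∧
      IsNeighbor c (D + 1) c₁ ∧ IsNeighbor c₁ (D + 2) b₁
  swap
  · refine (prob_mono (F := fun _ => False) ?_).trans (prob_false.le.trans (by positivity))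
    rintro ω ⟨A, -, b, c₁, b₁, h1, h3, h4, -⟩
    exact hex ⟨b, c₁, b₁, h1, h3, h4⟩
  obtain ⟨b, c₁, b₁, n1, n3, n4⟩ := hex
  have key : ∀ A : Assembly n, BreakFirst r τ D c A → motion A.tile b = (0, τ) ∧
      motion A.tile b₁ = (0, τ) ∧ motion A.tile c ≠ (0, τ) ∧
      (A.tile c).1 ∈ outer n r ∧ (A.tile c₁).1 ∈ outer n r := by
    rintro A ⟨b', c₁', b₁', m1, m3, m4, h⟩
    obtain rfl := n1.unique m1
    obtain rfl := n3.unique m3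
    obtain rfl := n4.unique m4
    exact h
  refine (prob_exists_pair_le hι hκ hq {b, c, c₁, b₁} (BreakFirst r τ D c) c c₁
    (outerTiles n r) 1 648 (fun x => Far 4 (co c - τ) (co x.1) ∧ Far 4 (co c - τ) (co x.1))
    (fun x y => Far 4 (co c - τ) (co y.1) ∧ Far 4 (co x.1) (co y.1)) ?_ ?_ ?_ ?_ ?_).trans
    (le_of_eq (by push_cast; ring))
  · convert card_near_pair_le (n := n) (co c - τ) (co c - τ)
  · intro x
    convert card_near_pair_le (n := n) (co c - τ) (co x.1)
  · intro A hA
    obtain ⟨-, -, -, h5, h6⟩ := key A hA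
    exact ⟨by simpa [outerTiles] using h5, by simpa [outerTiles] using h6⟩
  · intro A hA
    obtain ⟨h1, h3, h4, -, -⟩ := key A hA
    set S : Finset (Cell n) := {b, c, c₁, b₁} with hS
    have hd := A.distinctOn_tile S
    have mb : b ∈ S := by simp [hS]
    have mc : c ∈ S := by simp [hS]
    have mc₁ : c₁ ∈ S := by simp [hS]
    have mb₁ : b₁ ∈ S := by simp [hS]
    obtain ⟨t1, s1⟩ := touched_of_motion_ne hd mc mb n1 h4 h1
    obtain ⟨⟨s, hs, t3⟩, u1, u2⟩ := touched_successor hd mc mc₁ mb₁ n3 n4 h3 h4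
    obtain ⟨o1, -, o3, o4⟩ := offsets_card D s hs
    have hO : ∀ s' ∈ ({step (D + 2), s} : Finset (ℤ × ℤ)), |s'.1| ≤ 3 ∧ |s'.2| ≤ 3 ∧
        Touched S A.tile (co c - τ + (co c - τ) + s') := by
      intro s' hs'
      simp only [Finset.mem_insert, Finset.mem_singleton] at hs'
      rcases hs' with rfl | rfl
      · exact ⟨(step_abs_le_three _).1, (step_abs_le_three _).2, t1⟩
      · exact ⟨o3, o4, t3⟩
    have hcard := card_pair_dirs D
    have hcard1 : ({D + 2} : Finset (ZMod 4)).card = 1 := Finset.card_singleton _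
    have hXt : ∀ d ∈ ({D + 2} : Finset (ZMod 4)), Touched S A.tile (mid (side (A.tile c) d)) := by
      intro d hd
      rw [Finset.mem_singleton.1 hd]
      exact s1
    have hYt : (Far 4 (co c - τ) (co (A.tile c₁).1) ∧ Far 4 (co (A.tile c).1) (co (A.tile c₁).1)) →
        ∀ d ∈ ({D + 2, D + 3} : Finset (ZMod 4)), Touched S A.tile (mid (side (A.tile c₁) d)) := by
      intro hf d hd
      simp only [Finset.mem_insert, Finset.mem_singleton] at hd
      rcases hd with rfl | rfl
      exacts [u1 hf.1, u2 hf.2]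
    have hem : ∀ x : Tile n, ∀ d ∈ (∅ : Finset (ZMod 4)), Touched S A.tile (mid (side x d)) := by simp
    have hne : ¬ (∅ : Finset (ZMod 4)).Nonempty := by simp
    split_ifs with hx hy hy
    · have := card_le_two_mul_rank hO hXt (hYt hy) (fun _ => hx.1) (fun _ => hy.1) fun _ _ => hy.2
      omega
    · have := card_le_two_mul_rank hO hXt (hem (A.tile c₁)) (fun _ => hx.1)
        (fun h => absurd h hne) (fun _ h => absurd h hne)
      omega
    · have := card_le_two_mul_rank hO (hem (A.tile c)) (hYt hy) (fun h => absurd h hne)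
        (fun _ => hy.1) (fun h => absurd h hne)
      omega
    · have := card_le_two_mul_rank hO (hem (A.tile c)) (hem (A.tile c₁)) (fun h => absurd h hne)
        (fun h => absurd h hne) (fun h => absurd h hne)
      omega
  · intro A A' hA hA' e1 e2 x hx
    obtain ⟨h1, h3, -⟩ := key A hA
    obtain ⟨k1, k3, -⟩ := key A' hA'
    simp only [Finset.mem_insert, Finset.mem_singleton] at hx
    rcases hx with rfl | rfl | rfl | rfl
    exacts [tile_eq_of_motion h1 k1, e1, e2, tile_eq_of_motion h3 k3]

open Classical in
lemma prob_breakLast_le (hι : Function.Involutive ι) {κ : ℝ} (hκ : 1 ≤ κ) (hq : κ ≤ q)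
    (r : ℕ) (τ : ℤ × ℤ) (D : ZMod 4) (c : Cell n) :
    prob (fun ω : Carving n ι => ∃ A, IsSolution ω A ∧ BreakLast r τ D c A) ≤
      κ⁻¹ * ((outerTiles n r).card * κ⁻¹ + 648) ^ 2 := by
  by_cases hex : ∃ b l : Cell n, IsNeighbor c (D + 2) b ∧ IsNeighbor c (D + 3) l
  swap
  · refine (prob_mono (F := fun _ => False) ?_).trans (prob_false.le.trans (by positivity))
    rintro ω ⟨A, -, b, l, h1, h2, -⟩
    exact hex ⟨b, l, h1, h2⟩
  obtain ⟨b, l, n1, n2⟩ := hex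
  have key : ∀ A : Assembly n, BreakLast r τ D c A → motion A.tile b = (0, τ) ∧
      motion A.tile l = (0, τ) ∧ motion A.tile c ≠ (0, τ) ∧ (A.tile c).1 ∈ outer n r := by
    rintro A ⟨b', l', m1, m2, h⟩
    obtain rfl := n1.unique m1
    obtain rfl := n2.unique m2
    exact h
  -- Only one piece is free, so the cell `c` is listed twice. The condition `x ≠ y` makes the second
  -- copy contribute no constraint.
  refine (prob_exists_pair_le hι hκ hq {b, l, c} (BreakLast r τ D c) c c
    (outerTiles n r) 1 648 (fun x => Far 4 (co c - τ) (co x.1) ∧ Far 4 (co c - τ) (co x.1))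
    (fun x y => x ≠ y) ?_ ?_ ?_ ?_ ?_).trans (le_of_eq (by push_cast; ring))
  · convert card_near_pair_le (n := n) (co c - τ) (co c - τ)
  · intro x
    have : (Finset.univ.filter fun y => ¬ (x ≠ y)) ⊆ {x} := by
      intro y hy
      simpa [eq_comm] using hy
    have h1 : (Finset.univ.filter fun y => ¬ (x ≠ y)).card ≤ 648 :=
      ((Finset.card_le_card this).trans (Finset.card_singleton x).le).trans (by norm_num)
    convert h1
  · intro A hA
    obtain ⟨-, -, -, h5⟩ := key A hA
    exact ⟨by simpa [outerTiles] using h5, by simpa [outerTiles] using h5⟩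
  · intro A hA
    obtain ⟨h1, h2, h4, -⟩ := key A hA
    set S : Finset (Cell n) := {b, l, c} with hS
    have hd := A.distinctOn_tile S
    have mb : b ∈ S := by simp [hS]
    have ml : l ∈ S := by simp [hS]
    have mc : c ∈ S := by simp [hS]
    obtain ⟨t1, s1⟩ := touched_of_motion_ne hd mc mb n1 h4 h1
    obtain ⟨t2, -⟩ := touched_of_motion_ne hd mc ml n2 h4 h2
    have hO : ∀ s' ∈ ({step (D + 2), step (D + 3)} : Finset (ℤ × ℤ)), |s'.1| ≤ 3 ∧ |s'.2| ≤ 3 ∧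
        Touched S A.tile (co c - τ + (co c - τ) + s') := by
      intro s' hs'
      simp only [Finset.mem_insert, Finset.mem_singleton] at hs'
      rcases hs' with rfl | rfl
      · exact ⟨(step_abs_le_three _).1, (step_abs_le_three _).2, t1⟩
      · exact ⟨(step_abs_le_three _).1, (step_abs_le_three _).2, t2⟩
    have o1 := card_pair_steps D
    have hcard1 : ({D + 2} : Finset (ZMod 4)).card = 1 := Finset.card_singleton _
    have hXt : ∀ d ∈ ({D + 2} : Finset (ZMod 4)), Touched S A.tile (mid (side (A.tile c) d)) := by
      intro d hd
      rw [Finset.mem_singleton.1 hd]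
      exact s1
    have hem : ∀ x : Tile n, ∀ d ∈ (∅ : Finset (ZMod 4)), Touched S A.tile (mid (side x d)) := by simp
    have hne : ¬ (∅ : Finset (ZMod 4)).Nonempty := by simp
    rw [if_neg (show ¬ (A.tile c ≠ A.tile c) from fun h => h rfl)]
    split_ifs with hx
    · have := card_le_two_mul_rank hO hXt (hem (A.tile c)) (fun _ => hx.1)
        (fun h => absurd h hne) (fun _ h => absurd h hne)
      omega
    · have := card_le_two_mul_rank hO (hem (A.tile c)) (hem (A.tile c)) (fun h => absurd h hne)
        (fun h => absurd h hne) (fun h => absurd h hne)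
      omega
  · intro A A' hA hA' e1 e2 x hx
    obtain ⟨h1, h2, -⟩ := key A hA
    obtain ⟨k1, k2, -⟩ := key A' hA'
    simp only [Finset.mem_insert, Finset.mem_singleton] at hx
    rcases hx with rfl | rfl | rfl
    exacts [tile_eq_of_motion h1 k1, tile_eq_of_motion h2 k2, e1]

end Corners

/-! ### Extending the shift to the boundary of the grid -/

section Growth

variable {n q : ℕ} {ι : Fin q → Fin q}

/-- The cells whose coordinates are both close to the boundary. -/
def corners (n r : ℕ) : Finset (Cell n) :=
  Finset.univ.filter fun c => ((c.1 : ℕ) ≤ r ∨ n ≤ c.1 + r + 1) ∧ ((c.2 : ℕ) ≤ r ∨ n ≤ c.2 + r + 1)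

lemma mem_corners {r : ℕ} {c : Cell n} : c ∈ corners n r ↔
    ((c.1 : ℕ) ≤ r ∨ n ≤ c.1 + r + 1) ∧ ((c.2 : ℕ) ≤ r ∨ n ≤ c.2 + r + 1) := by
  simp [corners]

/-- The numbers below `n` close to one of the ends. -/
lemma card_ends_le (n a b : ℕ) :
    (Finset.univ.filter fun x : Fin n => (x : ℕ) < a ∨ n ≤ x + b).card ≤ a + b := by
  have h : (Finset.univ.filter fun x : Fin n => (x : ℕ) < a ∨ n ≤ x + b).map Fin.valEmbedding ⊆
      Finset.range a ∪ Finset.Ico (n - b) n := by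
    intro x
    simp only [Finset.mem_map, Finset.mem_filter, Finset.mem_univ, true_and, Finset.mem_union,
      Finset.mem_range, Finset.mem_Ico, Fin.valEmbedding_apply]
    rintro ⟨y, hy, rfl⟩
    have := y.isLt
    omega
  have h1 := (Finset.card_le_card h).trans (Finset.card_union_le _ _)
  rw [Finset.card_map, Finset.card_range, Nat.card_Ico] at h1
  omega

lemma card_corners_le (n r : ℕ) : (corners n r).card ≤ (2 * r + 2) ^ 2 := by
  have h : corners n r ⊆
      (Finset.univ.filter fun x : Fin n => (x : ℕ) < r + 1 ∨ n ≤ x + (r + 1)) ×ˢ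
      (Finset.univ.filter fun x : Fin n => (x : ℕ) < r + 1 ∨ n ≤ x + (r + 1)) := by
    intro c hc
    rw [mem_corners] at hc
    simp only [Finset.mem_product, Finset.mem_filter, Finset.mem_univ, true_and]
    omega
  refine (Finset.card_le_card h).trans ?_
  rw [Finset.card_product, ← pow_two]
  exact Nat.pow_le_pow_left ((card_ends_le n (r + 1) (r + 1)).trans (by omega)) 2

lemma card_outer_le (n r : ℕ) : (outer n r).card ≤ 4 * r * n := by
  have h : outer n r ⊆
      (Finset.univ.filter fun x : Fin n => (x : ℕ) < r ∨ n ≤ x + r) ×ˢ Finset.univ ∪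
      Finset.univ ×ˢ (Finset.univ.filter fun x : Fin n => (x : ℕ) < r ∨ n ≤ x + r) := by
    intro c hc
    rw [mem_outer, Inner] at hc
    simp only [Finset.mem_union, Finset.mem_product, Finset.mem_filter, Finset.mem_univ, true_and,
      and_true]
    omega
  refine (Finset.card_le_card h).trans ((Finset.card_union_le _ _).trans ?_)
  have h1 := Nat.mul_le_mul_right n (card_ends_le n r r)
  rw [Finset.card_product, Finset.card_product, Finset.card_univ, Fintype.card_fin]
  linarith

/-- Near the boundary, no line along the boundary breaks the shift by `τ`. -/
def Unbroken (r : ℕ) (τ : ℤ × ℤ) (A : Assembly n) : Prop :=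
  ∀ D : ZMod 4, (∀ c ∈ outer n r, ¬ BreakMiddle (2 * r) τ D c A) ∧
    ∀ c ∈ corners n r, ¬ BreakFirst (2 * r) τ D c A ∧ ¬ BreakLast (2 * r) τ D c A

open Classical in
/-- Pieces near the boundary stay near the boundary if all inner cells are shifted by `τ`. -/
lemma piece_mem_outer {r : ℕ} {τ : ℤ × ℤ} {A : Assembly n} (hτ : τ ∈ shifts r)
    (hI : ∀ c, Inner r c → motion A.tile c = (0, τ)) {c : Cell n} (hc : c ∈ outer n r) :
    (A.tile c).1 ∈ outer n (2 * r) := by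
  rw [mem_outer] at hc ⊢
  intro h
  set p := (A.tile c).1 with hp
  have : NeZero n := ⟨by have := p.1.isLt; omega⟩
  simp only [shifts, Finset.mem_product, Finset.mem_Ioo] at hτ
  rw [Inner] at h
  -- A piece planted deep inside would have its shifted position in an inner cell; that cell holds
  -- it already, so it is not at `c`.
  obtain ⟨x, hx⟩ : ∃ x : ℕ, (x : ℤ) = (p.1 : ℕ) + τ.1 := ⟨((p.1 : ℕ) + τ.1).toNat, by omega⟩
  obtain ⟨y, hy⟩ : ∃ y : ℕ, (y : ℤ) = (p.2 : ℕ) + τ.2 := ⟨((p.2 : ℕ) + τ.2).toNat, by omega⟩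
  have hxn : x < n := by omega
  have hyn : y < n := by omega
  have hI' : Inner r (cell n x y) := by
    rw [Inner, cell_fst hxn, cell_snd hyn]; omega
  have h2 := (motion_eq_zero_iff.1 (hI _ hI')).2
  have h3 : co p + τ = co (cell n x y) := by
    rw [co_cell hxn hyn, hx, hy]; rfl
  have h4 : (A.tile (cell n x y)).1 = p := co_injective (add_right_cancel (h2.trans h3.symm))
  have h5 : cell n x y = c := A.pos.symm.injective h4
  exact hc (h5 ▸ hI')

/-- If one line along the boundary is shifted, so is the next one. -/
lemma Unbroken.line {r : ℕ} {τ : ℤ × ℤ} {A : Assembly n} (hU : Unbroken r τ A) (hτ : τ ∈ shifts r)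
    (hI : ∀ c, Inner r c → motion A.tile c = (0, τ)) (D e b : ZMod 4) (he : e = D + 1)
    (hb : b = D + 2) {m : ℕ} (hm : 1 ≤ m) (f g : ℕ → Cell n)
    (hf : ∀ i < m, IsNeighbor (f i) e (f (i + 1))) (hg : ∀ i ≤ m, IsNeighbor (f i) b (g i))
    (hg' : ∀ i ≤ m, motion A.tile (g i) = (0, τ)) (ho : ∀ i ≤ m, f i ∈ outer n r)
    (h0 : f 0 ∈ corners n r) (h1 : f m ∈ corners n r) :
    ∀ i ≤ m, motion A.tile (f i) = (0, τ) := by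
  subst he hb
  have hp : ∀ i ≤ m, (A.tile (f i)).1 ∈ outer n (2 * r) := fun i hi => piece_mem_outer hτ hI (ho i hi)
  -- At the first failure all cells before it are shifted: this is a break at the start, in the
  -- middle or at the end of the line.
  intro i
  induction i with
  | zero =>
    intro _
    by_contra hne
    exact ((hU D).2 _ h0).1 ⟨g 0, f 1, g 1, hg 0 (by omega), hf 0 (by omega), hg 1 hm,
      hg' 0 (by omega), hg' 1 hm, hne, hp 0 (by omega), hp 1 hm⟩
  | succ i ih =>
    intro hi
    have hl : IsNeighbor (f (i + 1)) (D + 3) (f i) := by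
      have := (hf i (by omega)).symm
      rwa [show D + 1 + 2 = D + 3 by ring] at this
    by_contra hne
    by_cases him : i + 1 = m
    · rw [← him] at h1
      exact ((hU D).2 _ h1).2 ⟨g (i + 1), f i, hg _ hi, hl, hg' _ hi, ih (by omega), hne, hp _ hi⟩
    · exact (hU D).1 _ (ho _ hi) ⟨g (i + 1), f i, f (i + 1 + 1), g (i + 1 + 1), hg _ hi, hl,
        hf _ (by omega), hg _ (by omega), hg' _ hi, ih (by omega), hg' _ (by omega), hne, hp _ hi,
        hp _ (by omega)⟩

/-- If the shift is unbroken near the boundary, then the whole assembly is shifted. -/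
lemma Unbroken.motion_eq {r : ℕ} {τ : ℤ × ℤ} {A : Assembly n} (hU : Unbroken r τ A)
    (hτ : τ ∈ shifts r) (hn : 2 * r + 2 ≤ n)
    (hI : ∀ c, Inner r c → motion A.tile c = (0, τ)) (c : Cell n) : motion A.tile c = (0, τ) := by
  have : NeZero n := ⟨by omega⟩
  have hcell : ∀ {x₁ x₂ y₁ y₂ x y : ℕ}, (∀ c ∈ rect n x₁ x₂ y₁ y₂, motion A.tile c = (0, τ)) →
      x < n → y < n → x₁ ≤ x → x ≤ x₂ → y₁ ≤ y → y ≤ y₂ → motion A.tile (cell n x y) = (0, τ) := by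
    intro x₁ x₂ y₁ y₂ x y h hx hy h1 h2 h3 h4
    refine h _ ?_
    rw [mem_rect, cell_fst hx, cell_snd hy]
    omega
  have hout : ∀ {x y : ℕ}, x < n → y < n → (x < r ∨ n ≤ x + r ∨ y < r ∨ n ≤ y + r) →
      cell n x y ∈ outer n r := by
    intro x y hx hy h
    rw [mem_outer, Inner, cell_fst hx, cell_snd hy]
    omega
  have hcor : ∀ {x y : ℕ}, x < n → y < n → (x ≤ r ∨ n ≤ x + r + 1) → (y ≤ r ∨ n ≤ y + r + 1) →
      cell n x y ∈ corners n r := by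
    intro x y hx hy h h'
    rw [mem_corners, cell_fst hx, cell_snd hy]
    exact ⟨h, h'⟩
  -- The shifted rectangle grows by full columns to the east and to the west, then by full rows of
  -- the grid to the north and to the south. The ends of each new line belong to `corners`.
  have east : ∀ k ≤ r, ∀ c ∈ rect n r (n - 1 - r + k) r (n - 1 - r), motion A.tile c = (0, τ) := by
    intro k
    induction k with
    | zero =>
      intro _ c hc
      rw [mem_rect] at hc
      exact hI c (by rw [Inner]; omega)
    | succ k ih =>
      intro hk c hc
      rw [mem_rect] at hc
      by_cases hx : (c.1 : ℕ) ≤ n - 1 - r + k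
      · exact ih (by omega) c (by rw [mem_rect]; omega)
      have := hU.line hτ hI 0 1 2 rfl rfl (m := n - 1 - 2 * r) (by omega)
        (fun i => cell n (n - 1 - r + k + 1) (r + i)) (fun i => cell n (n - 1 - r + k) (r + i))
        (fun i hi => neighbor_north (by omega) (by omega))
        (fun i hi => neighbor_west (by omega) (by omega))
        (fun i hi => hcell (ih (by omega)) (by omega) (by omega) (by omega) (by omega) (by omega)
          (by omega)) (fun i hi => hout (by omega) (by omega) (by omega))
        (hcor (by omega) (by omega) (by omega) (by omega))
        (hcor (by omega) (by omega) (by omega) (by omega)) (c.2 - r) (by omega)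
      have e1 : n - 1 - r + k + 1 = (c.1 : ℕ) := by omega
      have e2 : r + (c.2 - r) = (c.2 : ℕ) := by omega
      simpa only [e1, e2, cell_eta] using this
  have west : ∀ k ≤ r, ∀ c ∈ rect n (r - k) (n - 1) r (n - 1 - r), motion A.tile c = (0, τ) := by
    intro k
    induction k with
    | zero =>
      intro _ c hc
      rw [mem_rect] at hc
      exact east r le_rfl c (by rw [mem_rect]; omega)
    | succ k ih =>
      intro hk c hc
      rw [mem_rect] at hc
      by_cases hx : r - k ≤ c.1
      · exact ih (by omega) c (by rw [mem_rect]; omega)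
      have := hU.line hτ hI 2 3 0 rfl rfl (m := n - 1 - 2 * r) (by omega)
        (fun i => cell n (r - (k + 1)) (n - 1 - r - i))
        (fun i => cell n (r - (k + 1) + 1) (n - 1 - r - i))
        (fun i hi => by
          obtain ⟨j, hj⟩ : ∃ j, n - 1 - r - i = j + 1 := ⟨n - 1 - r - i - 1, by omega⟩
          have hj' : n - 1 - r - (i + 1) = j := by omega
          simp only [hj, hj']
          exact neighbor_south (by omega) (by omega))
        (fun i hi => neighbor_east (by omega) (by omega))
        (fun i hi => hcell (ih (by omega)) (by omega) (by omega) (by omega) (by omega) (by omega)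
          (by omega)) (fun i hi => hout (by omega) (by omega) (by omega))
        (hcor (by omega) (by omega) (by omega) (by omega))
        (hcor (by omega) (by omega) (by omega) (by omega)) (n - 1 - r - c.2) (by omega)
      have e1 : r - (k + 1) = (c.1 : ℕ) := by omega
      have e2 : n - 1 - r - (n - 1 - r - c.2) = (c.2 : ℕ) := by omega
      simpa only [e1, e2, cell_eta] using this
  have north : ∀ k ≤ r, ∀ c ∈ rect n 0 (n - 1) r (n - 1 - r + k), motion A.tile c = (0, τ) := by
    intro k
    induction k with
    | zero =>
      intro _ c hc
      rw [mem_rect] at hc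
      exact west r le_rfl c (by rw [mem_rect]; omega)
    | succ k ih =>
      intro hk c hc
      rw [mem_rect] at hc
      by_cases hx : (c.2 : ℕ) ≤ n - 1 - r + k
      · exact ih (by omega) c (by rw [mem_rect]; omega)
      have := hU.line hτ hI 1 2 3 rfl rfl (m := n - 1) (by omega)
        (fun i => cell n (n - 1 - i) (n - 1 - r + k + 1)) (fun i => cell n (n - 1 - i) (n - 1 - r + k))
        (fun i hi => by
          obtain ⟨j, hj⟩ : ∃ j, n - 1 - i = j + 1 := ⟨n - 1 - i - 1, by omega⟩
          have hj' : n - 1 - (i + 1) = j := by omega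
          simp only [hj, hj']
          exact neighbor_west (by omega) (by omega))
        (fun i hi => neighbor_south (by omega) (by omega))
        (fun i hi => hcell (ih (by omega)) (by omega) (by omega) (by omega) (by omega) (by omega)
          (by omega)) (fun i hi => hout (by omega) (by omega) (by omega))
        (hcor (by omega) (by omega) (by omega) (by omega))
        (hcor (by omega) (by omega) (by omega) (by omega)) (n - 1 - c.1) (by omega)
      have e1 : n - 1 - (n - 1 - c.1) = (c.1 : ℕ) := by omega
      have e2 : n - 1 - r + k + 1 = (c.2 : ℕ) := by omega
      simpa only [e1, e2, cell_eta] using this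
  have south : ∀ k ≤ r, ∀ c ∈ rect n 0 (n - 1) (r - k) (n - 1), motion A.tile c = (0, τ) := by
    intro k
    induction k with
    | zero =>
      intro _ c hc
      rw [mem_rect] at hc
      exact north r le_rfl c (by rw [mem_rect]; omega)
    | succ k ih =>
      intro hk c hc
      rw [mem_rect] at hc
      by_cases hx : r - k ≤ c.2
      · exact ih (by omega) c (by rw [mem_rect]; omega)
      have := hU.line hτ hI 3 0 1 rfl rfl (m := n - 1) (by omega)
        (fun i => cell n i (r - (k + 1))) (fun i => cell n i (r - (k + 1) + 1))
        (fun i hi => neighbor_east (by omega) (by omega))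
        (fun i hi => neighbor_north (by omega) (by omega))
        (fun i hi => hcell (ih (by omega)) (by omega) (by omega) (by omega) (by omega) (by omega)
          (by omega)) (fun i hi => hout (by omega) (by omega) (by omega))
        (hcor (by omega) (by omega) (by omega) (by omega))
        (hcor (by omega) (by omega) (by omega) (by omega)) c.1 (by omega)
      have e2 : r - (k + 1) = (c.2 : ℕ) := by omega
      simpa only [e2, cell_eta] using this
  exact south r le_rfl c (by rw [mem_rect]; omega)

/-- A shift of the whole grid is trivial. -/
lemma eq_planted_of_motion {A : Assembly n} {τ : ℤ × ℤ} (hn : 1 ≤ n)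
    (h : ∀ c, motion A.tile c = (0, τ)) : A = planted n := by
  have : NeZero n := ⟨by omega⟩
  have h1 : ∀ c, A.rot c = 0 := by
    intro c
    have := (motion_eq_zero_iff.1 (h (A.pos c))).1
    simpa [Assembly.tile] using this
  have h2 : ∀ c, co c + τ = co (A.pos c) := by
    intro c
    have := (motion_eq_zero_iff.1 (h (A.pos c))).2
    simpa [Assembly.tile] using this
  -- Two opposite corner cells stay inside the grid under the translation.
  have h3 : τ = 0 := by
    have e1 := h2 (cell n 0 0)
    have e2 := h2 (cell n (n - 1) (n - 1))
    have b1 := (A.pos (cell n (n - 1) (n - 1))).1.isLt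
    have b2 := (A.pos (cell n (n - 1) (n - 1))).2.isLt
    rw [co_cell (by omega) (by omega)] at e1 e2
    have a1 := congrArg Prod.fst e1
    have a2 := congrArg Prod.snd e1
    have a3 := congrArg Prod.fst e2
    have a4 := congrArg Prod.snd e2
    simp only [co, Prod.fst_add, Prod.snd_add] at a1 a2 a3 a4
    exact Prod.ext (by simp; omega) (by simp; omega)
  ext c
  · rw [show A.pos c = c from co_injective (by rw [← h2, h3, add_zero])]; rfl
  · rw [show A.pos c = c from co_injective (by rw [← h2, h3, add_zero])]; rfl
  · exact h1 c

-- Breaks in the middle may occur at order `r * n` cells, and those at the ends of a line at order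
-- `r ^ 2` cells only, which makes up for the missing factor `κ⁻¹`.
open Classical in
lemma prob_broken_le (hι : Function.Involutive ι) {κ : ℝ} (hκ : 1 ≤ κ) (hq : κ ≤ q) (r : ℕ) :
    prob (fun ω : Carving n ι => ∃ A, IsSolution ω A ∧ ∃ τ ∈ shifts r, ¬ Unbroken r τ A) ≤
      (4 * r ^ 2) * (4 * ((4 * r * n) * (κ⁻¹ ^ 2 * (32 * r * n * κ⁻¹ + 648) ^ 2) +
        (2 * r + 2) ^ 2 * (2 * (κ⁻¹ * (32 * r * n * κ⁻¹ + 648) ^ 2)))) := by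
  have hκ0 : 0 < κ⁻¹ := by positivity
  set B : ℝ := 32 * r * n * κ⁻¹ + 648 with hB
  have hB0 : (0 : ℝ) ≤ ((outerTiles n (2 * r)).card * κ⁻¹ + 648) := by positivity
  have hBB : ((outerTiles n (2 * r)).card * κ⁻¹ + 648 : ℝ) ≤ B := by
    have h : ((outerTiles n (2 * r)).card : ℝ) ≤ 32 * r * n := by
      have h1 := card_outer_le n (2 * r)
      have h2 : (outerTiles n (2 * r)).card = (outer n (2 * r)).card * 4 := by
        rw [outerTiles, Finset.card_product]; rfl
      have h3 : (outerTiles n (2 * r)).card ≤ 32 * r * n := by rw [h2]; linarith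
      exact_mod_cast h3
    rw [hB]
    gcongr
  have hB2 := pow_le_pow_left₀ hB0 hBB 2
  have hD : ∀ (τ : ℤ × ℤ) (D : ZMod 4),
      prob (fun ω : Carving n ι => (∃ c ∈ outer n r, ∃ A, IsSolution ω A ∧
        BreakMiddle (2 * r) τ D c A) ∨ ∃ c ∈ corners n r, (∃ A, IsSolution ω A ∧
        BreakFirst (2 * r) τ D c A) ∨ ∃ A, IsSolution ω A ∧ BreakLast (2 * r) τ D c A) ≤
      (4 * r * n) * (κ⁻¹ ^ 2 * B ^ 2) + (2 * r + 2) ^ 2 * (2 * (κ⁻¹ * B ^ 2)) := by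
    intro τ D
    refine (prob_or_le _ _).trans (add_le_add ?_ ?_)
    · refine (prob_exists_finset_le_const _ _ fun c _ =>
        (prob_breakMiddle_le hι hκ hq (2 * r) τ D c).trans
          (mul_le_mul_of_nonneg_left hB2 (by positivity))).trans ?_
      refine mul_le_mul_of_nonneg_right ?_ (by positivity)
      exact_mod_cast card_outer_le n r
    · refine (prob_exists_finset_le_const _ _ fun c _ => (prob_or_le _ _).trans (add_le_add
        ((prob_breakFirst_le hι hκ hq (2 * r) τ D c).trans
          (mul_le_mul_of_nonneg_left hB2 hκ0.le))
        ((prob_breakLast_le hι hκ hq (2 * r) τ D c).trans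
          (mul_le_mul_of_nonneg_left hB2 hκ0.le)))).trans ?_
      rw [← two_mul]
      refine mul_le_mul_of_nonneg_right ?_ (by positivity)
      exact_mod_cast card_corners_le n r
  have h1 : prob (fun ω : Carving n ι => ∃ A, IsSolution ω A ∧ ∃ τ ∈ shifts r, ¬ Unbroken r τ A) ≤
      prob (fun ω : Carving n ι => ∃ τ ∈ shifts r, ∃ D ∈ (Finset.univ : Finset (ZMod 4)),
        (∃ c ∈ outer n r, ∃ A, IsSolution ω A ∧
        BreakMiddle (2 * r) τ D c A) ∨ ∃ c ∈ corners n r, (∃ A, IsSolution ω A ∧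
        BreakFirst (2 * r) τ D c A) ∨ ∃ A, IsSolution ω A ∧ BreakLast (2 * r) τ D c A) := by
    refine prob_mono ?_
    rintro ω ⟨A, hA, τ, hτ, hU⟩
    refine ⟨τ, hτ, ?_⟩
    by_contra hne
    push Not at hne
    refine hU fun D => ?_
    obtain ⟨k1, k2⟩ := hne D (Finset.mem_univ _)
    exact ⟨fun c hc => k1 c hc A hA, fun c hc => ⟨(k2 c hc).1 A hA, (k2 c hc).2 A hA⟩⟩
  have h2 : prob (fun ω : Carving n ι => ∃ A, IsSolution ω A ∧ ∃ τ ∈ shifts r, ¬ Unbroken r τ A) ≤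
      (shifts r).card * (((Finset.univ : Finset (ZMod 4)).card : ℕ) * ((4 * r * n) * (κ⁻¹ ^ 2 * B ^ 2) + (2 * r + 2) ^ 2 * (2 * (κ⁻¹ * B ^ 2)))) :=
    h1.trans (prob_exists_finset_le_const _ _ fun τ _ =>
      prob_exists_finset_le_const _ _ fun D _ => hD τ D)
  refine h2.trans ?_
  have h4 : ((Finset.univ : Finset (ZMod 4)).card : ℕ) = 4 := rfl
  rw [h4]
  push_cast
  refine mul_le_mul_of_nonneg_right ?_ (by positivity)
  exact_mod_cast card_shifts_le r

end Growth

/-! ### All solutions are similar when there are many types -/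

section Uniqueness

variable {n q : ℕ} {ι : Fin q → Fin q}

lemma shifts_mono {r s : ℕ} (h : r ≤ s) : shifts r ⊆ shifts s := by
  intro τ hτ
  simp only [shifts, Finset.mem_product, Finset.mem_Ioo] at hτ ⊢
  omega

lemma planted_shown (f : Labelling n q) : (planted n).shown f = f := by
  funext c d
  simp [Assembly.shown, planted]

open Classical in
/-- If all solutions are controlled, rigid and unbroken, then they are similar. -/
lemma allSolutionsSimilar_of_controlled (hι : Function.Involutive ι) {ω : Carving n ι} {v lam : ℕ}
    (hlam : 1 ≤ lam) (hv : 10000 * lam ^ 2 + 10 ≤ v) (hn : 4 * v + 2 ≤ n)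
    (hC : ∀ A, IsSolution ω A → Controlled (4 * v) lam A.tile)
    (hR : ∀ A : Assembly n, IsSolution ω A → ∀ τ ∈ shifts (4 * v), Rigid (4 * v) τ A.tile)
    (hU : ∀ A : Assembly n, IsSolution ω A → ∀ τ ∈ shifts (2 * v), Unbroken (2 * v) τ A) :
    AllSolutionsSimilar ω := by
  refine allSolutionsSimilar_of_shown fun A hA => ?_
  obtain ⟨M, hM⟩ := Controlled.anchored (A.distinctOn_tile _) hlam hv (by omega) (hC A hA)
  obtain ⟨k, hk, τ, hB⟩ := hM.exists_turn
  refine ⟨k, hk, ?_⟩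
  set B := Assembly.turn^[k] A
  have hBs : IsSolution ω B := hA.turn_iterate k
  have hτ : τ ∈ shifts (2 * v) := hB.mem_shifts (by omega)
  have hRB := hR B hBs τ (shifts_mono (by omega) hτ)
  -- Exchanging duplicates turns `B` into a solution `A'` that shows the same and is shifted on all
  -- inner cells.
  obtain ⟨A', hA', hm⟩ := exists_motion_of_shown (Finset.univ.filter fun c => Inner (2 * v) c) ω.1 τ
    (B.shown ω.1) (fun c hc => hB.shown_eq hι hBs (by omega) hRB (Finset.mem_filter.1 hc).2) _ B rfl
    le_rfl
  have hAs : IsSolution ω A' := by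
    rw [IsSolution, hA']
    exact hBs
  have hI : ∀ c, Inner (2 * v) c → motion A'.tile c = (0, τ) := fun c hc =>
    hm c (Finset.mem_filter.2 ⟨Finset.mem_univ _, hc⟩)
  have hP := eq_planted_of_motion (by omega) ((hU A' hAs τ hτ).motion_eq hτ (by omega) hI)
  rw [← hA', hP, planted_shown]

lemma prob_not_allSolutionsSimilar_le (hι : Function.Involutive ι) {v K lam : ℕ} {κ t β : ℝ}
    (hP : Admissible n (4 * v) K κ t β) (hq : κ ≤ q) (hK : 2 * (4 * v) ^ 2 + 4 * v ≤ K)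
    (hlam : 1 ≤ lam) (hv : 10000 * lam ^ 2 + 10 ≤ v) (hn : 4 * v + 2 ≤ n)
    (hs : 4 * (n : ℝ) ^ 2 * β ^ lam * ((4 * v : ℕ) : ℝ) ^ 2 ≤ 1) :
    prob (fun ω : Carving n ι => ¬ AllSolutionsSimilar ω) ≤
      36 * n ^ 4 * ((4 * v : ℕ) : ℝ) ^ 2 * β ^ lam +
      (12 * n ^ 2 * ((4 * v : ℕ) : ℝ) ^ 4 * (κ⁻¹ * t⁻¹) ^ 3 +
      (4 * ((2 * v : ℕ) : ℝ) ^ 2) * (4 * ((4 * (2 * v : ℕ) * n) *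
        (κ⁻¹ ^ 2 * (32 * (2 * v : ℕ) * n * κ⁻¹ + 648) ^ 2) +
        (2 * (2 * v : ℕ) + 2) ^ 2 * (2 * (κ⁻¹ * (32 * (2 * v : ℕ) * n * κ⁻¹ + 648) ^ 2))))) := by
  refine le_trans (prob_mono ?_) ((prob_or_le _ _).trans (add_le_add
    (prob_not_controlled_le hι hP hq hlam hs) ((prob_or_le _ _).trans (add_le_add
    (prob_not_rigid_le hι hP hq hK) (prob_broken_le hι hP.one_le hq (2 * v))))))
  intro ω hω
  by_contra hne
  push Not at hne
  obtain ⟨h1, h2, h3⟩ := hne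
  exact hω (allSolutionsSimilar_of_controlled hι hlam hv hn h1 h2 h3)

/-- Logarithmic growth. -/
lemma exists_log_bound {L : ℝ} (hL : 0 < L) : ∃ lam : ℕ → ℕ,
    (∀ n : ℕ, 1 ≤ lam n) ∧ (∀ n : ℕ, 10 * Real.log n ≤ L * lam n) ∧
    Tendsto (fun n : ℕ => ((10000 * lam n ^ 2 + 10 : ℕ) : ℝ) ^ 32 / n) atTop (𝓝 0) := by
  -- With `L = -log β` this gives `β ^ lam ≤ n ^ (-10)`, enough for the choices in a frame and for
  -- the number of windows.
  refine ⟨fun n => ⌈10 * Real.log n / L⌉₊ + 1, fun n => Nat.le_add_left _ _, fun n => ?_, ?_⟩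
  · have h := Nat.le_ceil (10 * Real.log n / L)
    rw [div_le_iff₀ hL] at h
    push_cast
    nlinarith
  · set C : ℝ := 10000 * (10 / L + 2) ^ 2 + 10 with hC
    have h0 : Tendsto (fun n : ℕ => C ^ 32 * (Real.log n ^ 64 / n)) atTop (𝓝 0) := by
      have h1 := (Real.isLittleO_pow_log_id_atTop (n := 64)).tendsto_div_nhds_zero
      simpa using (h1.comp tendsto_natCast_atTop_atTop).const_mul (C ^ 32)
    refine squeeze_zero' (Eventually.of_forall fun n => by positivity) ?_ h0
    filter_upwards [(Real.tendsto_log_atTop.comp tendsto_natCast_atTop_atTop).eventually_ge_atTop 1]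
      with n hn
    simp only [Function.comp_apply] at hn
    rw [← mul_div_assoc]
    gcongr
    have h2 : (⌈10 * Real.log n / L⌉₊ : ℝ) < 10 * Real.log n / L + 1 :=
      Nat.ceil_lt_add_one (by positivity)
    have h3 : (⌈10 * Real.log n / L⌉₊ : ℝ) + 1 ≤ (10 / L + 2) * Real.log n := by
      have : 10 * Real.log n / L = 10 / L * Real.log n := by ring
      nlinarith
    calc ((10000 * (⌈10 * Real.log n / L⌉₊ + 1) ^ 2 + 10 : ℕ) : ℝ) ^ 32
        ≤ (10000 * ((10 / L + 2) * Real.log n) ^ 2 + 10 * Real.log n ^ 2) ^ 32 := by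
          push_cast
          gcongr
          nlinarith
      _ = C ^ 32 * Real.log n ^ 64 := by rw [hC]; ring

lemma pow_le_of_log {β : ℝ} (h0 : 0 < β) {n lam : ℕ} (hn : 0 < n)
    (h : 10 * Real.log n ≤ -Real.log β * lam) : β ^ lam ≤ ((n : ℝ) ^ 10)⁻¹ := by
  have hn' : (0 : ℝ) < n := by exact_mod_cast hn
  rw [← Real.log_le_log_iff (by positivity) (by positivity), Real.log_inv, Real.log_pow,
    Real.log_pow]
  push_cast
  linarith

/-- The threshold enters here: for `κ = (2 + ε) n` and `β = 2 / (2 + ε)`, the two constraints of a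
fresh piece exactly balance its `4 * n ^ 2` choices, up to `β ^ 2`. In `t` the exponent `9` is made
up of `6` for the number of nearby pieces, `1` for the length of a row and `2` for the number of
cells. -/
lemma admissible_of_le {n v : ℕ} {ε : ℝ} (hε : 0 < ε) (hv : 1 ≤ v) (hn : 1 ≤ n)
    (h : 10 ^ 9 * (v : ℝ) ^ 9 ≤ 2 / (2 + ε) * n) :
    Admissible n (4 * v) (100 * v ^ 2) ((2 + ε) * n) ((10 ^ 9 * (v : ℝ) ^ 9)⁻¹) (2 / (2 + ε)) := by
  have hv' : (1 : ℝ) ≤ v := by exact_mod_cast hv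
  have hn' : (1 : ℝ) ≤ n := by exact_mod_cast hn
  refine ⟨by nlinarith, by nlinarith, by positivity, ?_, ?_, by positivity, ?_, ?_, ?_⟩
  · refine inv_le_one_of_one_le₀ ?_
    have := one_le_pow₀ hv' (n := 9)
    linarith
  · push_cast
    have h1 : (2 * (100 * (v : ℝ) ^ 2) + 1) ≤ 201 * v ^ 2 := by nlinarith
    have h2 : ((4 * (v : ℝ)) ^ 2 * (4 * (2 * (100 * (v : ℝ) ^ 2) + 1) ^ 2) + 1) ≤ 2585665 * (v : ℝ) ^ 6 := by
      have h3 : (2 * (100 * (v : ℝ) ^ 2) + 1) ^ 2 ≤ (201 * v ^ 2) ^ 2 := by gcongr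
      have h4 := one_le_pow₀ hv' (n := 6)
      calc ((4 * (v : ℝ)) ^ 2 * (4 * (2 * (100 * (v : ℝ) ^ 2) + 1) ^ 2) + 1)
          ≤ ((4 * (v : ℝ)) ^ 2 * (4 * (201 * (v : ℝ) ^ 2) ^ 2) + (v : ℝ) ^ 6) := by gcongr
        _ = 2585665 * (v : ℝ) ^ 6 := by ring
    calc ((4 * (v : ℝ)) ^ 2 * (4 * (2 * (100 * (v : ℝ) ^ 2) + 1) ^ 2) + 1) *
          (10 ^ 9 * (v : ℝ) ^ 9)⁻¹ * (1 + 2 * (4 * v)) * (4 * v) ^ 2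
        ≤ (2585665 * v ^ 6) * (10 ^ 9 * (v : ℝ) ^ 9)⁻¹ * (9 * v) * (4 * v) ^ 2 := by
          gcongr
          linarith
      _ = (2585665 * 144 / 10 ^ 9) * (v ^ 9 * ((v : ℝ) ^ 9)⁻¹) := by
          rw [mul_inv]; ring
      _ ≤ 1 := by
          rw [mul_inv_cancel₀ (by positivity)]
          norm_num
  · rw [div_le_one (by linarith)]
    linarith
  · refine le_of_eq ?_
    push_cast
    field_simp
    ring
  · rw [inv_le_comm₀ (by positivity) (by positivity), mul_inv, inv_inv, inv_div]
    calc 10 ^ 9 * (v : ℝ) ^ 9 * ((2 + ε) / 2) ≤ 2 / (2 + ε) * n * ((2 + ε) / 2) := by gcongr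
      _ = n := by field_simp
      _ ≤ (2 + ε) * n := by nlinarith

/-- For `κ ≥ n`, each of the three error terms is at most a power of `v` divided by `n`; the
exponent and the constant are generous. -/
lemma error_terms_le {n v : ℕ} {κ b : ℝ} (hv : 1 ≤ v) (hn : 1 ≤ n) (hκ : (n : ℝ) ≤ κ)
    (hb : b ≤ ((n : ℝ) ^ 10)⁻¹) :
    36 * n ^ 4 * ((4 * v : ℕ) : ℝ) ^ 2 * b +
      (12 * n ^ 2 * ((4 * v : ℕ) : ℝ) ^ 4 * (κ⁻¹ * ((10 ^ 9 * (v : ℝ) ^ 9)⁻¹)⁻¹) ^ 3 +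
      (4 * ((2 * v : ℕ) : ℝ) ^ 2) * (4 * ((4 * (2 * v : ℕ) * n) *
        (κ⁻¹ ^ 2 * (32 * (2 * v : ℕ) * n * κ⁻¹ + 648) ^ 2) +
        (2 * (2 * v : ℕ) + 2) ^ 2 * (2 * (κ⁻¹ * (32 * (2 * v : ℕ) * n * κ⁻¹ + 648) ^ 2)))))
    ≤ 10 ^ 40 * ((v : ℝ) ^ 32 / n) := by
  have hv' : (1 : ℝ) ≤ v := by exact_mod_cast hv
  have hn' : (1 : ℝ) ≤ n := by exact_mod_cast hn
  have hκn : κ⁻¹ ≤ (n : ℝ)⁻¹ := inv_anti₀ (by linarith) hκ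
  have hκ0 : 0 ≤ κ⁻¹ := inv_nonneg.2 (by linarith)
  set m : ℝ := (n : ℝ)⁻¹ with hm
  have hm0 : 0 < m := by positivity
  have hm1 : m ≤ 1 := inv_le_one_of_one_le₀ hn'
  have hnm : (n : ℝ) * m = 1 := mul_inv_cancel₀ (by positivity)
  rw [div_eq_mul_inv, ← hm, inv_inv]
  push_cast
  rw [← inv_pow, ← hm] at hb
  have t1 : 36 * (n : ℝ) ^ 4 * (4 * v) ^ 2 * b ≤ 576 * (v ^ 32 * m) := by
    calc 36 * (n : ℝ) ^ 4 * (4 * v) ^ 2 * b ≤ 36 * (n : ℝ) ^ 4 * (4 * v) ^ 2 * m ^ 10 := by gcongr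
      _ = 576 * v ^ 2 * ((n * m) ^ 4 * m ^ 6) := by ring
      _ ≤ 576 * v ^ 32 * (1 * m) := by
          rw [hnm, one_pow]
          gcongr
          · norm_num
          · exact pow_le_of_le_one hm0.le hm1 (by norm_num)
      _ = 576 * (v ^ 32 * m) := by ring
  have t2 : 12 * (n : ℝ) ^ 2 * (4 * v) ^ 4 * (κ⁻¹ * (10 ^ 9 * v ^ 9)) ^ 3 ≤
      3072 * 10 ^ 27 * (v ^ 32 * m) := by
    calc 12 * (n : ℝ) ^ 2 * (4 * v) ^ 4 * (κ⁻¹ * (10 ^ 9 * v ^ 9)) ^ 3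
        ≤ 12 * (n : ℝ) ^ 2 * (4 * v) ^ 4 * (m * (10 ^ 9 * v ^ 9)) ^ 3 := by gcongr
      _ = 3072 * 10 ^ 27 * (v ^ 31 * m * (n * m) ^ 2) := by ring
      _ ≤ 3072 * 10 ^ 27 * (v ^ 32 * m) := by
          rw [hnm, one_pow, mul_one]
          gcongr
          norm_num
  have t3 : (4 * (2 * (v : ℝ)) ^ 2) * (4 * ((4 * (2 * v) * n) *
        (κ⁻¹ ^ 2 * (32 * (2 * v) * n * κ⁻¹ + 648) ^ 2) +
        (2 * (2 * v) + 2) ^ 2 * (2 * (κ⁻¹ * (32 * (2 * v) * n * κ⁻¹ + 648) ^ 2)))) ≤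
      64 * 80 * 712 ^ 2 * (v ^ 32 * m) := by
    have hB : 32 * (2 * (v : ℝ)) * n * κ⁻¹ + 648 ≤ 712 * v := by
      calc 32 * (2 * (v : ℝ)) * n * κ⁻¹ + 648 ≤ 32 * (2 * (v : ℝ)) * n * m + 648 * v := by
            gcongr
            linarith
        _ = 64 * v * (n * m) + 648 * v := by ring
        _ = 712 * v := by rw [hnm]; ring
    have hB0 : 0 ≤ 32 * (2 * (v : ℝ)) * n * κ⁻¹ + 648 := by positivity
    calc (4 * (2 * (v : ℝ)) ^ 2) * (4 * ((4 * (2 * v) * n) *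
        (κ⁻¹ ^ 2 * (32 * (2 * v) * n * κ⁻¹ + 648) ^ 2) +
        (2 * (2 * v) + 2) ^ 2 * (2 * (κ⁻¹ * (32 * (2 * v) * n * κ⁻¹ + 648) ^ 2))))
        ≤ (4 * (2 * (v : ℝ)) ^ 2) * (4 * ((4 * (2 * v) * n) * (m ^ 2 * (712 * v) ^ 2) +
          (6 * v) ^ 2 * (2 * (m * (712 * v) ^ 2)))) := by
          gcongr
          linarith
      _ = 64 * 712 ^ 2 * (8 * v ^ 5 * m * (n * m) + 72 * v ^ 6 * m) := by ring
      _ ≤ 64 * 712 ^ 2 * (8 * v ^ 32 * m * 1 + 72 * v ^ 32 * m) := by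
          rw [hnm]
          gcongr
          · norm_num
          · norm_num
      _ = 64 * 80 * 712 ^ 2 * (v ^ 32 * m) := by ring
  have hX : (0 : ℝ) ≤ v ^ 32 * m := by positivity
  refine (add_le_add t1 (add_le_add t2 t3)).trans ?_
  nlinarith

/-- With more than `(2 + ε) n` types of jigs, all solutions are similar with high probability. -/
theorem exists_prob_not_similar_bound {ε : ℝ} (hε : 0 < ε) : ∃ f : ℕ → ℝ, Tendsto f atTop (𝓝 0) ∧
    ∀ᶠ n : ℕ in atTop, ∀ (q : ℕ) (ι : Fin q → Fin q), Function.Involutive ι →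
      (2 + ε) * (n : ℝ) ≤ q → prob (fun ω : Carving n ι => ¬ AllSolutionsSimilar ω) ≤ f n := by
  have hβ0 : (0 : ℝ) < 2 / (2 + ε) := by positivity
  have hβ1 : 2 / (2 + ε) < 1 := by
    rw [div_lt_one (by linarith)]
    linarith
  obtain ⟨lam, h1, h2, h3⟩ := exists_log_bound (neg_pos.2 (Real.log_neg hβ0 hβ1))
  refine ⟨fun n => 10 ^ 40 * (((10000 * lam n ^ 2 + 10 : ℕ) : ℝ) ^ 32 / n),
    by simpa using h3.const_mul (10 ^ 40), ?_⟩
  have hsmall := h3.eventually_le_const (show 0 < (2 / (2 + ε)) / 10 ^ 9 by positivity)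
  filter_upwards [hsmall, eventually_ge_atTop 1] with n hn hn1 q ι hι hq
  have hn' : (1 : ℝ) ≤ n := by exact_mod_cast hn1
  set v : ℕ := 10000 * lam n ^ 2 + 10 with hv
  clear_value v
  have hv1 : 1 ≤ v := by omega
  have hv' : (1 : ℝ) ≤ v := by exact_mod_cast hv1
  rw [div_le_iff₀ (by positivity)] at hn
  have hn9 : 10 ^ 9 * (v : ℝ) ^ 32 ≤ 2 / (2 + ε) * n := by
    have := mul_le_mul_of_nonneg_left hn (show (0 : ℝ) ≤ 10 ^ 9 by norm_num)
    refine this.trans (le_of_eq ?_)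
    ring
  have hvv : 10 ^ 9 * (v : ℝ) ^ 9 ≤ 2 / (2 + ε) * n := by
    refine le_trans ?_ hn9
    gcongr
    norm_num
  have hvn : 10 ^ 9 * (v : ℝ) ≤ n := by
    calc 10 ^ 9 * (v : ℝ) ≤ 10 ^ 9 * (v : ℝ) ^ 9 := by
          gcongr
          exact le_self_pow₀ hv' (by norm_num)
      _ ≤ _ := hvv
      _ ≤ 1 * n := by gcongr
      _ = n := one_mul _
  have hvn' : 10 ^ 9 * v ≤ n := by exact_mod_cast hvn
  have hb := pow_le_of_log hβ0 hn1 (h2 n)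
  have hκ : (n : ℝ) ≤ (2 + ε) * n := by nlinarith
  have hK : 2 * (4 * v) ^ 2 + 4 * v ≤ 100 * v ^ 2 := by nlinarith
  have hbound := fun h => prob_not_allSolutionsSimilar_le hι (admissible_of_le hε hv1 hn1 hvv) hq hK
    (h1 n) hv.ge (by omega) h
  refine (hbound ?_).trans (error_terms_le hv1 hn1 hκ hb)
  push_cast
  calc 4 * (n : ℝ) ^ 2 * (2 / (2 + ε)) ^ lam n * (4 * v) ^ 2
      ≤ 4 * (n : ℝ) ^ 2 * ((n : ℝ) ^ 10)⁻¹ * (n : ℝ) ^ 2 := by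
        gcongr
        linarith
    _ = 4 * ((n : ℝ) ^ 6)⁻¹ := by field_simp
    _ ≤ 1 := by
        have h4 : (4 : ℝ) ≤ n := by linarith
        have h5 : (4 : ℝ) ≤ (n : ℝ) ^ 6 := h4.trans (le_self_pow₀ hn' (by norm_num))
        rw [← div_eq_mul_inv]
        exact div_le_one_of_le₀ h5 (by positivity)

end Uniqueness

/-! ### Duplicate and symmetric pieces -/

section Duplicates

variable {n q : ℕ} {ι : Fin q → Fin q}

open Classical in
/-- Change the jigs along one edge. -/
noncomputable def updateLabelling (ι : Fin q → Fin q) (f : Labelling n q) (a : Tile n) (v : Fin q) :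
    Labelling n q :=
  fun p d => if (p, d) = a then v else if mid (p, d) = mid a then ι v else f p d

lemma fits_updateLabelling (hι : Function.Involutive ι) {f : Labelling n q} (hf : Fits ι f)
    (a : Tile n) (v : Fin q) : Fits ι (updateLabelling ι f a v) := by
  intro p d p' hn
  have hmid := mid_neighbor hn
  have hne : ((p', d + 2) : Tile n) ≠ (p, d) := fun h => hn.ne (congrArg Prod.fst h).symm
  unfold updateLabelling
  rw [hmid]
  by_cases h1 : ((p, d) : Tile n) = a
  · subst h1
    simp [hne]
  by_cases h2 : mid ((p, d) : Tile n) = mid a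
  · have h3 : ((p', d + 2) : Tile n) = a := by
      rcases mid_fiber hmid (hmid.trans h2) with h | h | h
      exacts [absurd h hne, absurd h h1, h]
    simp only [h1, h2, h3, if_true, if_false]
    exact (hι v).symm
  · have h3 : ((p', d + 2) : Tile n) ≠ a := fun h => h2 (by rw [← hmid, h])
    simp only [h1, h2, h3, if_false]
    exact hf p d p' hn

/-- Change the jigs along one edge of a carving. -/
noncomputable def Carving.update (hι : Function.Involutive ι) (ω : Carving n ι) (a : Tile n)
    (v : Fin q) : Carving n ι :=
  ⟨updateLabelling ι ω.1 a v, fits_updateLabelling hι ω.2 a v⟩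

lemma Carving.update_jig_self (hι : Function.Involutive ι) (ω : Carving n ι) (a : Tile n)
    (v : Fin q) : (ω.update hι a v).jig a = v := by
  simp [Carving.update, Carving.jig, updateLabelling]

lemma Carving.update_jig_of_ne (hι : Function.Involutive ι) (ω : Carving n ι) {a b : Tile n}
    (v : Fin q) (h : mid a ≠ mid b) : (ω.update hι a v).jig b = ω.jig b := by
  have h1 : b ≠ a := by rintro rfl; exact h rfl
  simp [Carving.update, Carving.jig, updateLabelling, h.symm, h1]

lemma Carving.update_update (hι : Function.Involutive ι) (ω : Carving n ι) (a : Tile n)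
    (v : Fin q) : (ω.update hι a v).update hι a (ω.jig a) = ω := by
  refine Subtype.ext (funext fun p => funext fun d => ?_)
  by_cases h1 : ((p, d) : Tile n) = a
  · subst h1
    exact (ω.update hι _ v).update_jig_self hι _ _
  by_cases h2 : mid ((p, d) : Tile n) = mid a
  · simp only [Carving.update, updateLabelling, h1, h2, if_true, if_false]
    rcases mid_eq_iff.1 h2.symm with h | ⟨h, h'⟩
    · exact absurd h.symm h1
    · have := ω.2 a.1 a.2 p h
      simp only at h'
      rw [h']
      exact this.symm
  · simp [Carving.update, updateLabelling, h1, h2]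

/-- Resampling the jig at `a` loses no information: its old value equals the jig at `b`, which is
unchanged. So each carving of the left event yields `q` carvings in `E`, without repetition. -/
lemma prob_eq_jig_le (hι : Function.Involutive ι) (hq : 0 < q) (E : Carving n ι → Prop)
    {a b : Tile n} (hab : mid a ≠ mid b) (hE : ∀ ω v, E ω → E (ω.update hι a v)) :
    prob (fun ω : Carving n ι => ω.jig a = ω.jig b ∧ E ω) ≤ (q : ℝ)⁻¹ * prob E := by
  have hinj : Function.Injective (fun x : {ω : Carving n ι // ω.jig a = ω.jig b ∧ E ω} × Fin q =>
      (⟨x.1.1.update hι a x.2, hE _ _ x.1.2.2⟩ : {ω : Carving n ι // E ω})) := by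
    rintro ⟨⟨ω, h1, h2⟩, v⟩ ⟨⟨ω', h1', h2'⟩, v'⟩ h
    simp only [Subtype.mk.injEq] at h
    have hv : v = v' := by
      rw [← ω.update_jig_self hι a v, h, ω'.update_jig_self hι a v']
    have hj : ω.jig a = ω'.jig a := by
      rw [h1, h1', ← ω.update_jig_of_ne hι v hab, h, ω'.update_jig_of_ne hι v' hab]
    have hω : ω = ω' := by
      rw [← ω.update_update hι a v, h, hj, ω'.update_update]
    simp [hv, hω]
  have hc := Nat.card_le_card_of_injective _ hinj
  rw [Nat.card_prod, Nat.card_fin] at hc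
  have hc' : (Nat.card {ω : Carving n ι // ω.jig a = ω.jig b ∧ E ω} : ℝ) * q ≤
      Nat.card {ω : Carving n ι // E ω} := by exact_mod_cast hc
  have hq' : (0 : ℝ) < q := by exact_mod_cast hq
  unfold prob
  rw [← mul_div_assoc]
  gcongr
  rw [inv_mul_eq_div, le_div_iff₀ hq']
  exact hc'

open Classical in
/-- The probability that several independent pairs of jigs agree. -/
lemma prob_forall_eq_jig_le (hι : Function.Involutive ι) (hq : 0 < q) {α : Type*} (s : Finset α)
    (a b : α → Tile n) (h1 : ∀ i ∈ s, ∀ j ∈ s, mid (a i) ≠ mid (b j))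
    (h2 : ∀ i ∈ s, ∀ j ∈ s, i ≠ j → mid (a i) ≠ mid (a j)) :
    prob (fun ω : Carving n ι => ∀ i ∈ s, ω.jig (a i) = ω.jig (b i)) ≤ ((q : ℝ)⁻¹) ^ s.card := by
  induction s using Finset.induction_on with
  | empty => simpa using prob_le_one _
  | insert i s hi ih =>
    have ih := ih (fun i hi j hj => h1 i (Finset.mem_insert_of_mem hi) j (Finset.mem_insert_of_mem hj))
      (fun i hi j hj => h2 i (Finset.mem_insert_of_mem hi) j (Finset.mem_insert_of_mem hj))
    rw [Finset.card_insert_of_notMem hi, pow_succ']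
    refine le_trans ?_ (mul_le_mul_of_nonneg_left ih (by positivity))
    refine le_trans (prob_mono fun ω h => ?_) (prob_eq_jig_le hι hq
      (fun ω => ∀ i ∈ s, ω.jig (a i) = ω.jig (b i)) (a := a i) (b := b i)
      (h1 i (Finset.mem_insert_self _ _) i (Finset.mem_insert_self _ _)) ?_)
    · exact ⟨h i (Finset.mem_insert_self _ _), fun j hj => h j (Finset.mem_insert_of_mem hj)⟩
    · intro ω v h j hj
      have hj' := Finset.mem_insert_of_mem (b := i) hj
      have hi' := Finset.mem_insert_self i s
      have hij : i ≠ j := by rintro rfl; exact hi hj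
      rw [ω.update_jig_of_ne hι v (h2 i hi' j hj' hij), ω.update_jig_of_ne hι v (h1 i hi' j hj')]
      exact h j hj

/-- The piece `p`, rotated by `r`, looks like the piece `p'`. -/
def Duplicate (ω : Carving n ι) (p p' : Cell n) (r : ZMod 4) : Prop :=
  ∀ d, ω.1 p' d = ω.1 p (d - r)

lemma prob_duplicate_far_le (hι : Function.Involutive ι) (hq : 0 < q) {p p' : Cell n} (r : ZMod 4)
    (hne : p ≠ p') (hn : ∀ d, ¬ IsNeighbor p' d p) :
    prob (fun ω : Carving n ι => Duplicate ω p p' r) ≤ ((q : ℝ)⁻¹) ^ 4 := by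
  refine (prob_mono fun ω h => ?_).trans (prob_forall_eq_jig_le hι hq (Finset.univ : Finset (ZMod 4))
    (fun d => (p', d)) (fun d => (p, d - r)) ?_ ?_)
  · exact fun d _ => h d
  · intro i _ j _ h
    rcases mid_eq_iff.1 h with h | ⟨h, -⟩
    · exact hne (congrArg Prod.fst h).symm
    · exact hn _ h
  · exact fun i _ j _ hij h => hij (mid_same_piece h)

/-- The common edge is left out, so that the three remaining edges of `p'` are not edges of `p` and
can be resampled independently. -/
lemma prob_duplicate_neighbor_le (hι : Function.Involutive ι) (hq : 0 < q) {p p' : Cell n}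
    (r D : ZMod 4) (hn : IsNeighbor p D p') :
    prob (fun ω : Carving n ι => Duplicate ω p p' r) ≤ ((q : ℝ)⁻¹) ^ 3 := by
  have hcard : ∀ D : ZMod 4, (Finset.univ.erase D).card = 3 := by decide
  rw [← hcard (D + 2)]
  refine (prob_mono fun ω h => ?_).trans (prob_forall_eq_jig_le hι hq (Finset.univ.erase (D + 2))
    (fun d => (p', d)) (fun d => (p, d - r)) ?_ ?_)
  · exact fun d _ => h d
  · intro i hi j _ h
    rcases mid_eq_iff.1 h with h | ⟨h, -⟩
    · exact hn.ne (congrArg Prod.fst h).symm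
    · refine Finset.ne_of_mem_erase hi (step_injective ?_)
      have h1 := hn.symm
      rw [isNeighbor_iff] at h h1
      exact add_left_cancel (h.symm.trans h1)
  · exact fun i _ j _ hij h => hij (mid_same_piece h)

/-- Two opposite directions serve for a quarter turn, two consecutive ones for a half turn. -/
lemma exists_disjoint_dirs : ∀ r : ZMod 4, r ≠ 0 → ∃ s : Finset (ZMod 4), s.card = 2 ∧
    ∀ i ∈ s, ∀ j ∈ s, i ≠ j - r := by decide

lemma prob_symmetric_le (hι : Function.Involutive ι) (hq : 0 < q) (p : Cell n) {r : ZMod 4}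
    (hr : r ≠ 0) :
    prob (fun ω : Carving n ι => Duplicate ω p p r) ≤ ((q : ℝ)⁻¹) ^ 2 := by
  obtain ⟨s, hs, h⟩ := exists_disjoint_dirs r hr
  rw [← hs]
  refine (prob_mono fun ω h => ?_).trans (prob_forall_eq_jig_le hι hq s
    (fun d => (p, d)) (fun d => (p, d - r)) ?_ ?_)
  · exact fun d _ => h d
  · exact fun i hi j hj e => h i hi j hj (mid_same_piece e)
  · exact fun i _ j _ hij h => hij (mid_same_piece h)

/-- There are no duplicate pieces and no rotationally symmetric pieces. -/
def NoDuplicates (ω : Carving n ι) : Prop :=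
  ∀ p p' r, Duplicate ω p p' r → p = p' ∧ r = 0

-- Of the order of `n ^ 4` pairs of separate pieces each need four coincidences. Adjacent pairs and
-- symmetric pieces number `O(n ^ 2)` and need at least two.
open Classical in
lemma prob_not_noDuplicates_le (hι : Function.Involutive ι) (hq : 0 < q) :
    prob (fun ω : Carving n ι => ¬ NoDuplicates ω) ≤
      4 * (n * (q : ℝ)⁻¹) ^ 4 + 20 * (n * (q : ℝ)⁻¹) ^ 2 := by
  have hq1 : (q : ℝ)⁻¹ ≤ 1 := inv_le_one_of_one_le₀ (by exact_mod_cast hq)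
  have hq0 : 0 ≤ (q : ℝ)⁻¹ := by positivity
  have hzero : prob (fun _ : Carving n ι => False) = 0 := prob_false
  have hfar : prob (fun ω : Carving n ι => ∃ x ∈ (Finset.univ : Finset (Cell n × Cell n × ZMod 4)),
      (x.1 ≠ x.2.1 ∧ ∀ d, ¬ IsNeighbor x.2.1 d x.1) ∧ Duplicate ω x.1 x.2.1 x.2.2) ≤
      4 * (n * (q : ℝ)⁻¹) ^ 4 := by
    refine (prob_exists_finset_le_const (C := ((q : ℝ)⁻¹) ^ 4) _ _ fun x _ => ?_).trans (le_of_eq ?_)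
    · by_cases h : x.1 ≠ x.2.1 ∧ ∀ d, ¬ IsNeighbor x.2.1 d x.1
      · exact (prob_mono fun ω hω => hω.2).trans (prob_duplicate_far_le hι hq x.2.2 h.1 h.2)
      · exact (prob_mono (F := fun _ => False) fun ω hω => h hω.1).trans (hzero.le.trans (by positivity))
    · simp only [Finset.card_univ, Fintype.card_prod, Fintype.card_fin, ZMod.card]
      push_cast
      ring
  have hnb : prob (fun ω : Carving n ι => ∃ x ∈ (Finset.univ : Finset (Cell n × ZMod 4 × ZMod 4)),
      ∃ p', IsNeighbor p' x.2.1 x.1 ∧ Duplicate ω p' x.1 x.2.2) ≤ 16 * (n * (q : ℝ)⁻¹) ^ 2 := by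
    refine (prob_exists_finset_le_const (C := ((q : ℝ)⁻¹) ^ 2) _ _ fun x _ => ?_).trans (le_of_eq ?_)
    · by_cases h : ∃ p', IsNeighbor p' x.2.1 x.1
      · obtain ⟨p', hp'⟩ := h
        refine (prob_mono (F := fun ω => Duplicate ω p' x.1 x.2.2) ?_).trans
          ((prob_duplicate_neighbor_le hι hq x.2.2 x.2.1 hp').trans
            (pow_le_pow_of_le_one hq0 hq1 (by norm_num)))
        rintro ω ⟨p'', h1, h2⟩
        obtain rfl := h1.symm.unique hp'.symm
        exact h2
      · exact (prob_mono (F := fun _ => False) fun ω ⟨p', h1, _⟩ => h ⟨p', h1⟩).trans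
          (hzero.le.trans (by positivity))
    · simp only [Finset.card_univ, Fintype.card_prod, Fintype.card_fin, ZMod.card]
      push_cast
      ring
  have hsym : prob (fun ω : Carving n ι => ∃ x ∈ (Finset.univ : Finset (Cell n × ZMod 4)),
      x.2 ≠ 0 ∧ Duplicate ω x.1 x.1 x.2) ≤ 4 * (n * (q : ℝ)⁻¹) ^ 2 := by
    refine (prob_exists_finset_le_const (C := ((q : ℝ)⁻¹) ^ 2) _ _ fun x _ => ?_).trans (le_of_eq ?_)
    · by_cases h : x.2 ≠ 0
      · exact (prob_mono fun ω hω => hω.2).trans (prob_symmetric_le hι hq x.1 h)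
      · exact (prob_mono (F := fun _ => False) fun ω hω => h hω.1).trans (hzero.le.trans (by positivity))
    · simp only [Finset.card_univ, Fintype.card_prod, Fintype.card_fin, ZMod.card]
      push_cast
      ring
  refine (prob_mono ?_).trans (((prob_or_le _ _).trans (add_le_add hfar ((prob_or_le _ _).trans
    (add_le_add hnb hsym)))).trans (by linarith))
  intro ω hω
  by_contra hne
  push Not at hne
  obtain ⟨h1, h2, h3⟩ := hne
  refine hω fun p p' r hd => ?_
  have hpp : p = p' := by
    by_contra hpp
    by_cases hex : ∃ d, IsNeighbor p' d p
    · obtain ⟨d, hd'⟩ := hex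
      exact h2 (p', d + 2, r) (Finset.mem_univ _) p hd'.symm hd
    · push Not at hex
      exact h1 (p, p', r) (Finset.mem_univ _) ⟨hpp, hex⟩ hd
  refine ⟨hpp, ?_⟩
  subst hpp
  by_contra hr
  exact h3 (p, r) (Finset.mem_univ _) hr hd

lemma Assembly.ext_tile {A B : Assembly n} (h : ∀ c, A.tile c = B.tile c) : A = B := by
  have h1 : A.pos = B.pos := by
    have : A.pos.symm = B.pos.symm := Equiv.ext fun c => congrArg Prod.fst (h c)
    rw [← A.pos.symm_symm, this, Equiv.symm_symm]
  have h2 : A.rot = B.rot := by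
    funext p
    have := congrArg Prod.snd (h (A.pos p))
    simp only [Assembly.tile] at this
    rw [← h1] at this
    simpa using this
  cases A; cases B
  simp only at h1 h2
  rw [h1, h2]

lemma NoDuplicates.eq_of_shown_eq {ω : Carving n ι} (h : NoDuplicates ω) {A B : Assembly n}
    (hAB : A.shown ω.1 = B.shown ω.1) : A = B := by
  refine Assembly.ext_tile fun c => ?_
  have hd : Duplicate ω (A.tile c).1 (B.tile c).1 ((A.tile c).2 - (B.tile c).2) := by
    intro d
    have := congrFun (congrFun hAB c) (d + (B.tile c).2)
    simp only [Assembly.shown, Assembly.tile] at this ⊢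
    rw [add_sub_cancel_right] at this
    rw [← this]
    exact congrArg _ (by ring)
  obtain ⟨h1, h2⟩ := h _ _ _ hd
  exact Prod.ext h1 (sub_eq_zero.1 h2)

lemma isSolution_planted (ω : Carving n ι) : IsSolution ω (planted n) := by
  rw [IsSolution, planted_shown]
  exact ω.2

lemma NoDuplicates.uniqueUpToRotation {ω : Carving n ι} (h : NoDuplicates ω)
    (hs : AllSolutionsSimilar ω) : UniqueUpToRotation ω := by
  intro A hA
  obtain ⟨k, hk, h1⟩ := hs (planted n) A (isSolution_planted ω) hA
  exact ⟨k, hk, (h.eq_of_shown_eq h1).symm⟩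

end Duplicates

/-! ### Kinds of pieces -/

section Pieces

/-- The jigs of a piece, in a given orientation. -/
def Piece (q : ℕ) : Type := ZMod 4 → Fin q

instance (q : ℕ) : Finite (Piece q) := inferInstanceAs (Finite (ZMod 4 → Fin q))

lemma card_piece (q : ℕ) : Nat.card (Piece q) = q ^ 4 := by
  show Nat.card (ZMod 4 → Fin q) = q ^ 4
  rw [Nat.card_fun, Nat.card_fin, Nat.card_zmod]

/-- Pieces can be rotated. -/
instance (q : ℕ) : AddAction (ZMod 4) (Piece q) where
  vadd r f := fun d => f (d - r)
  zero_vadd f := funext fun d => congrArg f (sub_zero d)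
  add_vadd r s f := funext fun d => congrArg f (sub_add_eq_sub_sub d r s)

/-- The jigs of a piece, up to rotation. -/
abbrev PieceClass (q : ℕ) : Type := AddAction.orbitRel.Quotient (ZMod 4) (Piece q)

/-- The directions `0` and `1` meet every orbit of a nonzero rotation, so an invariant piece is
determined by its jigs there. -/
lemma card_fixedBy_le {q : ℕ} {r : ZMod 4} (hr : r ≠ 0) :
    Nat.card (AddAction.fixedBy (Piece q) r) ≤ q ^ 2 := by
  have h : Function.Injective (fun f : AddAction.fixedBy (Piece q) r => (f.1 0, f.1 1)) := by
    rintro ⟨f, hf⟩ ⟨g, hg⟩ h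
    simp only [Prod.mk.injEq] at h
    have hf' : ∀ d, f (d - r) = f d := fun d => congrFun hf d
    have hg' : ∀ d, g (d - r) = g d := fun d => congrFun hg d
    have key : ∀ r : ZMod 4, r ≠ 0 → ∀ d : ZMod 4, d = 0 ∨ d = 1 ∨ d - r = 0 ∨ d - r = 1 ∨
      d - r - r = 0 ∨ d - r - r = 1 := by decide
    refine Subtype.ext (funext fun d => ?_)
    rcases key r hr d with rfl | rfl | e | e | e | e
    · exact h.1
    · exact h.2
    · show f d = g d
      rw [← hf', ← hg', e]; exact h.1
    · show f d = g d
      rw [← hf', ← hg', e]; exact h.2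
    · show f d = g d
      rw [← hf', ← hg', ← hf', ← hg', e]; exact h.1
    · show f d = g d
      rw [← hf', ← hg', ← hf', ← hg', e]; exact h.2
  have := Nat.card_le_card_of_injective _ h
  rwa [Nat.card_prod, Nat.card_fin, ← pow_two] at this

/-- The number of kinds of pieces. -/
lemma four_mul_card_pieceClass_le (q : ℕ) : 4 * Nat.card (PieceClass q) ≤ q ^ 4 + 3 * q ^ 2 := by
  classical
  have := Fintype.ofFinite (Piece q)
  have := Fintype.ofFinite (PieceClass q)
  -- Burnside's lemma: the identity fixes all `q ^ 4` pieces, and each of the other three rotations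
  -- at most `q ^ 2`.
  have h := AddAction.sum_card_fixedBy_eq_card_orbits_mul_card_addGroup (ZMod 4) (Piece q)
  rw [ZMod.card, ← Nat.card_eq_fintype_card] at h
  rw [mul_comm, ← h, ← Finset.add_sum_erase _ _ (Finset.mem_univ (0 : ZMod 4))]
  refine add_le_add ?_ ?_
  · rw [← Nat.card_eq_fintype_card, ← card_piece]
    exact Finite.card_subtype_le _
  · refine (Finset.sum_le_card_nsmul _ _ (q ^ 2) fun r hr => ?_).trans (le_of_eq ?_)
    · rw [← Nat.card_eq_fintype_card]
      exact card_fixedBy_le (Finset.ne_of_mem_erase hr)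
    · rw [Finset.card_erase_of_mem (Finset.mem_univ _), Finset.card_univ, ZMod.card, smul_eq_mul]

open Classical in
/-- Functions with the same multiset of values differ by a permutation. -/
lemma exists_perm_of_map_eq {α β : Type*} [Fintype α] {f g : α → β}
    (h : (Finset.univ : Finset α).val.map f = (Finset.univ : Finset α).val.map g) :
    ∃ σ : α ≃ α, ∀ a, f (σ a) = g a := by
  have hc : ∀ b, Nonempty ({a // g a = b} ≃ {a // f a = b}) := by
    intro b
    refine ⟨Fintype.equivOfCardEq ?_⟩
    have := congrArg (Multiset.count b) h
    rw [Multiset.count_map, Multiset.count_map] at this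
    rw [Fintype.card_subtype, Fintype.card_subtype, Finset.card_def, Finset.card_def,
      Finset.filter_val, Finset.filter_val]
    simpa only [eq_comm] using this.symm
  refine ⟨(Equiv.sigmaFiberEquiv g).symm.trans ((Equiv.sigmaCongrRight fun b =>
    Classical.choice (hc b)).trans (Equiv.sigmaFiberEquiv f)), fun a => ?_⟩
  exact (Classical.choice (hc (g a)) ⟨a, rfl⟩).2

end Pieces

/-! ### Few types: carvings outnumber multisets of pieces -/

section Counting

variable {n q : ℕ} {ι : Fin q → Fin q}

/-- The multiset of the pieces of a puzzle. -/
noncomputable def Carving.pieces (ω : Carving n ι) : Sym (PieceClass q) (n ^ 2) :=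
  ⟨(Finset.univ : Finset (Cell n)).val.map fun c =>
    (Quotient.mk'' (ω.1 c : Piece q) : PieceClass q), by
      rw [Multiset.card_map, ← Finset.card_def, Finset.card_univ, Fintype.card_prod,
        Fintype.card_fin, pow_two]⟩

lemma exists_assembly_of_pieces_eq {ω ω' : Carving n ι} (h : ω.pieces = ω'.pieces) :
    ∃ A : Assembly n, A.shown ω.1 = ω'.1 := by
  obtain ⟨σ, hσ⟩ := exists_perm_of_map_eq (congrArg Subtype.val h)
  have h1 : ∀ c, ∃ r : ZMod 4, ∀ d, ω.1 (σ c) (d - r) = ω'.1 c d := by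
    intro c
    obtain ⟨r, hr⟩ := Quotient.exact (hσ c).symm
    exact ⟨r, fun d => congrFun hr d⟩
  choose r hr using h1
  refine ⟨⟨σ.symm, fun p => r (σ.symm p)⟩, funext fun c => funext fun d => ?_⟩
  simpa [Assembly.shown] using hr c d

open Classical in
/-- Puzzles all of whose solutions are similar are determined by their pieces, up to rotation. -/
lemma card_allSolutionsSimilar_le :
    Nat.card {ω : Carving n ι // ¬ HasNonSimilarSolutions ω} ≤
      4 * Nat.card (Sym (PieceClass q) (n ^ 2)) := by
  have := Fintype.ofFinite {ω : Carving n ι // ¬ HasNonSimilarSolutions ω}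
  have := Fintype.ofFinite (Sym (PieceClass q) (n ^ 2))
  rw [Nat.card_eq_fintype_card, Nat.card_eq_fintype_card, ← Finset.card_univ]
  let φ : {ω : Carving n ι // ¬ HasNonSimilarSolutions ω} → Sym (PieceClass q) (n ^ 2) :=
    fun ω => ω.1.pieces
  refine (Finset.card_le_mul_card_image (f := φ) _ 4 fun a ha => ?_).trans
    (Nat.mul_le_mul_left 4 (Finset.card_le_univ _))
  obtain ⟨ω, -, rfl⟩ := Finset.mem_image.1 ha
  let e : {ω : Carving n ι // ¬ HasNonSimilarSolutions ω} ↪ Labelling n q :=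
    ⟨fun ω => ω.1.1, fun ω ω' h => Subtype.ext (Subtype.ext h)⟩
  rw [← Finset.card_map e]
  refine le_trans (Finset.card_le_card (t := (Finset.range 4).image
    fun k => (Assembly.turn^[k] (planted n)).shown ω.1.1) ?_)
    (Finset.card_image_le.trans (Finset.card_range 4).le)
  intro f hf
  obtain ⟨ω', hω', rfl⟩ := Finset.mem_map.1 hf
  -- A puzzle `ω'` with the same pieces is shown by some solution of `ω`. This solution is similar
  -- to the planted one, which leaves at most four labellings.
  obtain ⟨A, hA⟩ := exists_assembly_of_pieces_eq (Finset.mem_filter.1 hω').2.symm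
  have hAs : IsSolution ω.1 A := by
    rw [IsSolution, hA]
    exact ω'.1.2
  have hsim : Similar ω.1 (planted n) A := by
    by_contra hne
    exact ω.2 ⟨planted n, A, isSolution_planted _, hAs, hne⟩
  obtain ⟨k, hk, hkA⟩ := hsim
  exact Finset.mem_image.2 ⟨k, Finset.mem_range.2 hk, hkA.trans hA⟩

/-- The number of edges of the grid is at least `2 n ^ 2 + n`. -/
lemma le_cc_empty [NeZero n] (A : Cell n → Tile n) : 2 * n ^ 2 + n ≤ cc ∅ A := by
  -- Eastern and northern sides of all cells and the western boundary; the `n` edges of the southern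
  -- boundary can be spared.
  let g : Cell n ⊕ Cell n ⊕ Fin n → Tile n :=
    Sum.elim (fun c => (c, 0)) (Sum.elim (fun c => (c, 1)) fun j => ((0, j), 2))
  have hg : Function.Injective fun x => mid (g x) := by
    rintro (c | c | j) (c' | c' | j') h <;>
      have h1 := congrArg Prod.fst h <;> have h2 := congrArg Prod.snd h <;>
      simp only [g, Sum.elim_inl, Sum.elim_inr, mid, co, step_zero, step_one, step_two,
        Prod.fst_add, Prod.snd_add, Fin.val_zero] at h1 h2 <;>
      first
      | omega
      | (refine congrArg _ ?_
         first
         | exact Prod.ext (Fin.ext (by omega)) (Fin.ext (by omega))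
         | (refine congrArg _ ?_
            first
            | exact Prod.ext (Fin.ext (by omega)) (Fin.ext (by omega))
            | exact Fin.ext (by omega)))
  have hinj : Function.Injective fun x => (Quotient.mk'' (g x) : Quotient (rel ∅ A)) := by
    intro x y h
    exact hg (rel_empty_iff.1 (Quotient.exact h))
  have := Nat.card_le_card_of_injective _ hinj
  rw [Nat.card_sum, Nat.card_sum, Nat.card_prod, Nat.card_fin] at this
  rw [cc]
  linarith

/-- A bound for the number of multisets. -/
lemma choose_le_exp_mul_pow {M N : ℕ} (hN : 0 < N) :
    ((M + N - 1).choose N : ℝ) ≤ (Real.exp 1 * (M + N) / N) ^ N := by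
  have hN' : (0 : ℝ) < N := by exact_mod_cast hN
  have h1 := Nat.choose_le_pow_div (α := ℝ) N (M + N - 1)
  have h2 := Real.pow_div_factorial_le_exp (x := N) hN'.le N
  have h3 : ((M + N - 1 : ℕ) : ℝ) ≤ M + N := by exact_mod_cast Nat.sub_le _ _
  have h4 : (0 : ℝ) < (N.factorial : ℝ) := by exact_mod_cast N.factorial_pos
  have h5 : ((N.factorial : ℝ))⁻¹ ≤ Real.exp N / N ^ N := by
    rw [le_div_iff₀ (by positivity), inv_mul_eq_div]
    exact h2
  calc ((M + N - 1).choose N : ℝ) ≤ ((M + N - 1 : ℕ) : ℝ) ^ N / N.factorial := by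
        exact_mod_cast h1
    _ ≤ (M + N : ℝ) ^ N * (Real.exp N / N ^ N) := by
        rw [div_eq_mul_inv]
        gcongr
    _ = (Real.exp 1 * (M + N) / N) ^ N := by
        rw [div_pow, mul_pow, ← Real.exp_nat_mul, mul_one]
        ring

/-- With few types of jigs, most puzzles have several solutions. -/
lemma prob_not_hasNonSimilar_le (hι : Function.Involutive ι) (hn : 0 < n) (hq2 : 2 ≤ q)
    (hq : (q : ℝ) ≤ 2 / Real.sqrt (Real.exp 1) * n) :
    prob (fun ω : Carving n ι => ¬ HasNonSimilarSolutions ω) ≤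
      4 * Real.exp 5 * (1 / 2 : ℝ) ^ n := by
  have : NeZero n := ⟨hn.ne'⟩
  have hn' : (0 : ℝ) < n := by exact_mod_cast hn
  have hq' : (2 : ℝ) ≤ q := by exact_mod_cast hq2
  set E : ℝ := Real.exp 1 with hE
  have hE0 : 0 < E := Real.exp_pos 1
  have hE3 : E < 3 := Real.exp_one_lt_three
  set N : ℕ := n ^ 2 with hN
  have hN0 : 0 < N := by positivity
  have hNr : (N : ℝ) = n ^ 2 := by rw [hN]; push_cast; ring
  have hN' : (0 : ℝ) < N := by exact_mod_cast hN0
  set y : ℝ := (q : ℝ) ^ 2 with hy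
  have hy4 : 4 ≤ y := by nlinarith
  have hyE : E * y ≤ 4 * N := by
    have h1 : y ≤ (2 / Real.sqrt E * n) ^ 2 := by
      rw [hy]; gcongr
    rw [mul_pow, div_pow, Real.sq_sqrt hE0.le] at h1
    calc E * y ≤ E * (2 ^ 2 / E * n ^ 2) := by gcongr
      _ = 4 * N := by rw [hNr]; field_simp; norm_num
  have hbase : E * (Nat.card (PieceClass q) + N) / N ≤ y * (1 + (E * (E + 3) / 4) / N) := by
    have h1 : 4 * (Nat.card (PieceClass q) : ℝ) ≤ y ^ 2 + 3 * y := by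
      have h2 : (4 * Nat.card (PieceClass q) : ℝ) ≤ (q : ℝ) ^ 4 + 3 * (q : ℝ) ^ 2 := by
        exact_mod_cast four_mul_card_pieceClass_le q
      rw [hy]
      linarith
    have h3 : y * (1 + (E * (E + 3) / 4) / N) = y * (N + E * (E + 3) / 4) / N := by
      field_simp
    rw [h3, div_le_div_iff_of_pos_right hN']
    have h5 := mul_le_mul_of_nonneg_left h1 hE0.le
    -- The first factor is the bound on `q`, the second one uses `q ≥ 2`, whence `y ≥ 4 > e`.
    -- Expanded, this bounds `E * y ^ 2 / 4 + E * N` by `N * y` plus a multiple of `y`.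
    have h4 : (4 * N - E * y) * (y - E) ≥ 0 := mul_nonneg (by linarith) (by linarith)
    nlinarith
  have hexp : (1 + (E * (E + 3) / 4) / N) ^ N ≤ Real.exp 5 := by
    calc (1 + (E * (E + 3) / 4) / N) ^ N ≤ Real.exp ((E * (E + 3) / 4) / N) ^ N := by
          gcongr
          linarith [Real.add_one_le_exp ((E * (E + 3) / 4) / N)]
      _ = Real.exp (E * (E + 3) / 4) := by
          rw [← Real.exp_nat_mul]
          congr 1
          field_simp
      _ ≤ Real.exp 5 := Real.exp_le_exp.2 (by nlinarith)
  have hcard : (Nat.card {ω : Carving n ι // ¬ HasNonSimilarSolutions ω} : ℝ) ≤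
      4 * ((q : ℝ) ^ (2 * n ^ 2) * Real.exp 5) := by
    have h1 : (Nat.card {ω : Carving n ι // ¬ HasNonSimilarSolutions ω} : ℝ) ≤
        4 * (Nat.card (Sym (PieceClass q) N) : ℝ) := by
      exact_mod_cast card_allSolutionsSimilar_le
    refine h1.trans (mul_le_mul_of_nonneg_left ?_ (by norm_num))
    rw [Sym.natCard_sym_eq_choose]
    refine (choose_le_exp_mul_pow hN0).trans ?_
    calc (E * (Nat.card (PieceClass q) + N) / N) ^ N
        ≤ (y * (1 + (E * (E + 3) / 4) / N)) ^ N := by gcongr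
      _ = (q : ℝ) ^ (2 * n ^ 2) * (1 + (E * (E + 3) / 4) / N) ^ N := by
          rw [mul_pow, hy, ← pow_mul]
      _ ≤ _ := by gcongr
  have htot : (q : ℝ) ^ (2 * n ^ 2 + n) ≤ Nat.card (Carving n ι) := by
    have h1 := pow_le_card_carving (n := n) hι fun c => (c, 0)
    have h2 := (Nat.pow_le_pow_right (by omega : 0 < q) (le_cc_empty (n := n) fun c => (c, 0))).trans h1
    exact_mod_cast h2
  unfold prob
  -- The leading powers `q ^ (2 * n ^ 2)` cancel, and the additional `n` boundary edges make the
  -- quotient exponentially small.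
  calc (Nat.card {ω : Carving n ι // ¬ HasNonSimilarSolutions ω} : ℝ) / Nat.card (Carving n ι)
      ≤ 4 * ((q : ℝ) ^ (2 * n ^ 2) * Real.exp 5) / (q : ℝ) ^ (2 * n ^ 2 + n) := by gcongr
    _ = 4 * Real.exp 5 * (1 / (q : ℝ)) ^ n := by
        rw [pow_add, div_pow, one_pow]
        field_simp
    _ ≤ 4 * Real.exp 5 * (1 / 2 : ℝ) ^ n := by gcongr

end Counting

end Jigsaw

/-! ### The theorem -/

/-- Here `q n` is the number of jig types and `ι n` the complementarity relation of the
`n × n` puzzle; edge-matching puzzles are the case in which every `ι n` is the identity. -/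
theorem theorem1p1 (q : ℕ → ℕ) (ι : ∀ n, Fin (q n) → Fin (q n))
    (hι : ∀ n, Function.Involutive (ι n)) :
    ((∀ᶠ n : ℕ in atTop, 2 ≤ q n ∧ (q n : ℝ) ≤ 2 / Real.sqrt (Real.exp 1) * (n : ℝ)) →
      Tendsto (fun n => Jigsaw.prob (fun ω : Jigsaw.Carving n (ι n) =>
        Jigsaw.HasNonSimilarSolutions ω)) atTop (𝓝 1)) ∧
    (∀ ε : ℝ, 0 < ε → (∀ᶠ n : ℕ in atTop, (2 + ε) * (n : ℝ) ≤ (q n : ℝ)) →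
      Tendsto (fun n => Jigsaw.prob (fun ω : Jigsaw.Carving n (ι n) =>
        Jigsaw.AllSolutionsSimilar ω)) atTop (𝓝 1)) ∧
    ((fun n : ℕ => (n : ℝ)) =o[atTop] (fun n : ℕ => (q n : ℝ)) →
      Tendsto (fun n => Jigsaw.prob (fun ω : Jigsaw.Carving n (ι n) =>
        Jigsaw.UniqueUpToRotation ω)) atTop (𝓝 1)) := by
  refine ⟨fun hq => ?_, fun ε hε hq => ?_, fun hq => ?_⟩
  · have h1 : Tendsto (fun n : ℕ => 4 * Real.exp 5 * (1 / 2 : ℝ) ^ n) atTop (𝓝 0) := by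
      simpa using (tendsto_pow_atTop_nhds_zero_of_lt_one (r := (1 / 2 : ℝ)) (by norm_num)
        (by norm_num)).const_mul (4 * Real.exp 5)
    refine Jigsaw.tendsto_prob_of_not hι (hq.mono fun n hn => by omega)
      (fun n ω => Jigsaw.HasNonSimilarSolutions ω) h1 ?_
    filter_upwards [hq, eventually_gt_atTop 0] with n hn hn0
    exact Jigsaw.prob_not_hasNonSimilar_le (hι n) hn0 hn.1 hn.2
  · obtain ⟨f, hf, h⟩ := Jigsaw.exists_prob_not_similar_bound hε
    refine Jigsaw.tendsto_prob_of_not hι ?_ (fun n ω => Jigsaw.AllSolutionsSimilar ω) hf ?_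
    · filter_upwards [hq, eventually_gt_atTop 0] with n hn hn0
      have hn' : (0 : ℝ) < n := by exact_mod_cast hn0
      exact_mod_cast lt_of_lt_of_le (by positivity : 0 < (2 + ε) * (n : ℝ)) hn
    · filter_upwards [hq, h] with n hn h
      exact h (q n) (ι n) (hι n) hn
  · obtain ⟨f, hf, h⟩ := Jigsaw.exists_prob_not_similar_bound one_pos
    have hx : Tendsto (fun n : ℕ => (n : ℝ) * (q n : ℝ)⁻¹) atTop (𝓝 0) := by
      simpa only [div_eq_mul_inv] using hq.tendsto_div_nhds_zero
    have hg : Tendsto (fun n : ℕ => f n + (4 * ((n : ℝ) * (q n : ℝ)⁻¹) ^ 4 +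
        20 * ((n : ℝ) * (q n : ℝ)⁻¹) ^ 2)) atTop (𝓝 0) := by
      simpa using hf.add (((hx.pow 4).const_mul 4).add ((hx.pow 2).const_mul 20))
    have hq3 : ∀ᶠ n : ℕ in atTop, (2 + 1) * (n : ℝ) ≤ (q n : ℝ) := by
      filter_upwards [hq.def (show (0 : ℝ) < 1 / 3 by norm_num)] with n hn
      simp only [Real.norm_natCast] at hn
      linarith
    have hq0 : ∀ᶠ n in atTop, 0 < q n := by
      filter_upwards [hq3, eventually_gt_atTop 0] with n hn hn0
      have hn' : (0 : ℝ) < n := by exact_mod_cast hn0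
      exact_mod_cast lt_of_lt_of_le (by positivity : 0 < (2 + 1) * (n : ℝ)) hn
    refine Jigsaw.tendsto_prob_of_not hι hq0 (fun n ω => Jigsaw.UniqueUpToRotation ω) hg ?_
    filter_upwards [hq3, hq0, h] with n hn hn0 h
    refine (Jigsaw.prob_mono fun ω hω => ?_).trans ((Jigsaw.prob_or_le _ _).trans (add_le_add
      (h (q n) (ι n) (hι n) hn) (Jigsaw.prob_not_noDuplicates_le (hι n) hn0)))
    by_contra hne
    push Not at hne
    exact hω (hne.2.uniqueUpToRotation hne.1)
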